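/- Let $\mathbf M$ and $\mathbf Q$ be small symmetric monoidal categories with the same objects, and let $J:\mathbf M\to\mathbf Q$ be a symmetric monoidal functor that is bijective on objects (for example, strict and the identity on objects). Assume that the tensor product of $\mathbf Q$ preserves, in each variable, all binary coproducts that exist in $\mathbf Q$. Let $\mathcal V=\mathbf{Set}^{\mathbf 2^{op}}$ be the cartesian closed category of bisets $(X_0,X_1,X_1\to X_0)$. Let $\mathbf C$ be the symmetric monoidal $\mathcal V$-category with the objects of $\mathbf M$ and $\mathbf C(A,B)=(\mathbf Q(JA,JB),\mathbf M(A,B),J)$, and let $\overline{\mathbf C}=\mathcal V^{\mathbf C^{op}}$ be the $\mathcal V$-category of $\mathcal V$-presheaves on $\mathbf C$, with Day's tensor product and internal hom $$(F\otimes_{Day}G)(C)=\int^{A,B}\mathbf C(C,A\otimes B)\times FA\times GB,\qquad (G\multimap_{Day}H)(C)=\int_{A}\bigl(GA\Rightarrow H(C\otimes A)\bigr).$$ Call $F\in\overline{\mathbf C}$ *smooth* if the presheaf $F^0:\mathbf Q^{op}\to\mathbf{Set}$, $F^0A=(FA)_0$, sends every binary coproduct that exists in $\mathbf Q$ to a product,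 that is, the canonical map $F^0(A+B)\to F^0A\times F^0B$ is bijective. Let $i:\widetilde{\mathbf C}\hookrightarrow\overline{\mathbf C}$ be the full $\mathcal V$-subcategory of smooth presheaves. Then: 1. the inclusion $i$ has a left $\mathcal V$-adjoint; 2. $G\multimap_{Day}iH$ is smooth for all $G\in\overline{\mathbf C}$ and $H\in\widetilde{\mathbf C}$; 3. for every left $\mathcal V$-adjoint $\tilde L$ of $i$, the $\mathcal V$-category $\widetilde{\mathbf C}$ is symmetric monoidal closed, with tensor product $F\otimes_{Lam}G=\tilde L(iF\otimes_{Day}iG)$, unit $\mathbf C(-,I)$ and internal hom $G\multimap_{Lam}H=iG\multimap_{Day}iH$; and there are isomorphisms of bisets $$\widetilde{\mathbf C}(F\otimes_{Lam}G,H)\;\cong\;\widetilde{\mathbf C}(F,G\multimap_{Lam}H),$$ $\mathcal V$-natural in $F$, $G$ and $H$. -/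

import Mathlib

open CategoryTheory MonoidalCategory Opposite

universe w v u₁ u₂ u

noncomputable section

namespace EnrichedSM

/-! ## Symmetric monoidal closed `V`-categories -/

section General

variable (V : Type v) [Category.{w} V] [MonoidalCategory V]

/-- Postcomposition `A(X, Y) ⟶ A(X, Z)` with a map `g : Y ⟶ Z` of the underlying category of the
`V`-category `A`, that is, with `g : 𝟙_ V ⟶ A(Y, Z)`. -/
def postcomp {A : Type u₁} [EnrichedCategory V A] (X : A) {Y Z : A}
    (g : ForgetEnrichment.of V Y ⟶ ForgetEnrichment.of V Z) :
    (X ⟶[V] Y) ⟶ (X ⟶[V] Z) :=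
  (ρ_ (X ⟶[V] Y)).inv ≫ ((X ⟶[V] Y) ◁ ForgetEnrichment.homTo V g) ≫ eComp V X Y Z

/-- Precomposition `A(Y, Z) ⟶ A(X, Z)` with a map `f : X ⟶ Y` of the underlying category. -/
def precomp {A : Type u₁} [EnrichedCategory V A] {X Y : A}
    (f : ForgetEnrichment.of V X ⟶ ForgetEnrichment.of V Y) (Z : A) :
    (Y ⟶[V] Z) ⟶ (X ⟶[V] Z) :=
  (λ_ (Y ⟶[V] Z)).inv ≫ (ForgetEnrichment.homTo V f ▷ (Y ⟶[V] Z)) ≫ eComp V X Y Z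

/-- A `V`-adjunction `L ⊣ R`: isomorphisms `B(L X, Y) ≅ A(X, R Y)` in `V`, `V`-natural in
`X` and in `Y`. -/
structure VAdjunction {A : Type u₁} {B : Type u₂} [EnrichedCategory V A] [EnrichedCategory V B]
    (L : EnrichedFunctor V A B) (R : EnrichedFunctor V B A) where
  homIso (X : A) (Y : B) : (L.obj X ⟶[V] Y) ≅ (X ⟶[V] R.obj Y)
  naturality_left (X' X : A) (Y : B) :
    ((X' ⟶[V] X) ◁ (homIso X Y).hom) ≫ eComp V X' X (R.obj Y) =
      (L.map X' X ▷ (L.obj X ⟶[V] Y)) ≫ eComp V (L.obj X') (L.obj X) Y ≫ (homIso X' Y).hom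
  naturality_right (X : A) (Y Y' : B) :
    ((homIso X Y).hom ⊗ₘ R.map Y Y') ≫ eComp V X (R.obj Y) (R.obj Y') =
      eComp V (L.obj X) Y Y' ≫ (homIso X Y').hom

variable [BraidedCategory V]

/-- A `V`-bifunctor `A ⊗ A ⟶ A`. -/
structure TensorBifunctor (A : Type u₁) [EnrichedCategory V A] where
  obj : A → A → A
  map (X₁ Y₁ X₂ Y₂ : A) : (X₁ ⟶[V] Y₁) ⊗ (X₂ ⟶[V] Y₂) ⟶ (obj X₁ X₂ ⟶[V] obj Y₁ Y₂)
  map_id (X₁ X₂ : A) :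
    (eId V X₁ ⊗ₘ eId V X₂) ≫ map X₁ X₁ X₂ X₂ = (λ_ (𝟙_ V)).hom ≫ eId V (obj X₁ X₂)
  map_comp (X₁ Y₁ Z₁ X₂ Y₂ Z₂ : A) :
    (map X₁ Y₁ X₂ Y₂ ⊗ₘ map Y₁ Z₁ Y₂ Z₂) ≫ eComp V (obj X₁ X₂) (obj Y₁ Y₂) (obj Z₁ Z₂) =
      tensorμ (X₁ ⟶[V] Y₁) (X₂ ⟶[V] Y₂) (Y₁ ⟶[V] Z₁) (Y₂ ⟶[V] Z₂) ≫
        (eComp V X₁ Y₁ Z₁ ⊗ₘ eComp V X₂ Y₂ Z₂) ≫ map X₁ Z₁ X₂ Z₂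

/-- A `V`-bifunctor `Aᵒᵖ ⊗ A ⟶ A`. -/
structure HomBifunctor (A : Type u₁) [EnrichedCategory V A] where
  obj : A → A → A
  map (Y' Y Z Z' : A) : (Y' ⟶[V] Y) ⊗ (Z ⟶[V] Z') ⟶ (obj Y Z ⟶[V] obj Y' Z')
  map_id (Y Z : A) :
    (eId V Y ⊗ₘ eId V Z) ≫ map Y Y Z Z = (λ_ (𝟙_ V)).hom ≫ eId V (obj Y Z)
  map_comp (Y'' Y' Y Z Z' Z'' : A) :
    (map Y' Y Z Z' ⊗ₘ map Y'' Y' Z' Z'') ≫ eComp V (obj Y Z) (obj Y' Z') (obj Y'' Z'') =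
      tensorμ (Y' ⟶[V] Y) (Z ⟶[V] Z') (Y'' ⟶[V] Y') (Z' ⟶[V] Z'') ≫
        (((β_ (Y' ⟶[V] Y) (Y'' ⟶[V] Y')).hom ≫ eComp V Y'' Y' Y) ⊗ₘ eComp V Z Z' Z'') ≫
          map Y'' Y Z Z''

variable {V}

/-- The tensor product of two maps of the underlying category. -/
def TensorBifunctor.homTensor {A : Type u₁} [EnrichedCategory V A] (T : TensorBifunctor V A)
    {X₁ Y₁ X₂ Y₂ : A}
    (f : ForgetEnrichment.of V X₁ ⟶ ForgetEnrichment.of V Y₁)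
    (g : ForgetEnrichment.of V X₂ ⟶ ForgetEnrichment.of V Y₂) :
    ForgetEnrichment.of V (T.obj X₁ X₂) ⟶ ForgetEnrichment.of V (T.obj Y₁ Y₂) :=
  ForgetEnrichment.homOf V ((λ_ (𝟙_ V)).inv ≫
    (ForgetEnrichment.homTo V f ⊗ₘ ForgetEnrichment.homTo V g) ≫ T.map X₁ Y₁ X₂ Y₂)

/-- A symmetric monoidal structure on the `V`-category `A` with tensor product `T` and unit `I`:
`V`-natural associators, unitors and braidings satisfying the coherence laws of a symmetric
monoidal category. -/
structure SymmetricMonoidalStructure {A : Type u₁} [EnrichedCategory V A]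
    (T : TensorBifunctor V A) (I : A) where
  assoc (X Y Z : A) :
    ForgetEnrichment.of V (T.obj (T.obj X Y) Z) ≅ ForgetEnrichment.of V (T.obj X (T.obj Y Z))
  leftUnit (X : A) : ForgetEnrichment.of V (T.obj I X) ≅ ForgetEnrichment.of V X
  rightUnit (X : A) : ForgetEnrichment.of V (T.obj X I) ≅ ForgetEnrichment.of V X
  braid (X Y : A) : ForgetEnrichment.of V (T.obj X Y) ≅ ForgetEnrichment.of V (T.obj Y X)
  assoc_naturality (X X' Y Y' Z Z' : A) :
    (T.map X X' Y Y' ▷ (Z ⟶[V] Z')) ≫ T.map (T.obj X Y) (T.obj X' Y') Z Z' ≫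
        postcomp V _ (assoc X' Y' Z').hom =
      (α_ (X ⟶[V] X') (Y ⟶[V] Y') (Z ⟶[V] Z')).hom ≫ ((X ⟶[V] X') ◁ T.map Y Y' Z Z') ≫
        T.map X X' (T.obj Y Z) (T.obj Y' Z') ≫ precomp V (assoc X Y Z).hom _
  leftUnit_naturality (X X' : A) :
    (λ_ (X ⟶[V] X')).inv ≫ (eId V I ▷ (X ⟶[V] X')) ≫ T.map I I X X' ≫
      postcomp V _ (leftUnit X').hom = precomp V (leftUnit X).hom X'
  rightUnit_naturality (X X' : A) :
    (ρ_ (X ⟶[V] X')).inv ≫ ((X ⟶[V] X') ◁ eId V I) ≫ T.map X X' I I ≫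
      postcomp V _ (rightUnit X').hom = precomp V (rightUnit X).hom X'
  braid_naturality (X X' Y Y' : A) :
    T.map X X' Y Y' ≫ postcomp V _ (braid X' Y').hom =
      (β_ (X ⟶[V] X') (Y ⟶[V] Y')).hom ≫ T.map Y Y' X X' ≫ precomp V (braid X Y).hom _
  pentagon (W X Y Z : A) :
    T.homTensor (assoc W X Y).hom (𝟙 (ForgetEnrichment.of V Z)) ≫
        (assoc W (T.obj X Y) Z).hom ≫
        T.homTensor (𝟙 (ForgetEnrichment.of V W)) (assoc X Y Z).hom =
      (assoc (T.obj W X) Y Z).hom ≫ (assoc W X (T.obj Y Z)).hom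
  triangle (X Y : A) :
    (assoc X I Y).hom ≫ T.homTensor (𝟙 (ForgetEnrichment.of V X)) (leftUnit Y).hom =
      T.homTensor (rightUnit X).hom (𝟙 (ForgetEnrichment.of V Y))
  hexagon (X Y Z : A) :
    (assoc X Y Z).hom ≫ (braid X (T.obj Y Z)).hom ≫ (assoc Y Z X).hom =
      T.homTensor (braid X Y).hom (𝟙 (ForgetEnrichment.of V Z)) ≫ (assoc Y X Z).hom ≫
        T.homTensor (𝟙 (ForgetEnrichment.of V Y)) (braid X Z).hom
  symmetry (X Y : A) : (braid X Y).hom ≫ (braid Y X).hom = 𝟙 (ForgetEnrichment.of V (T.obj X Y))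

/-- Isomorphisms `A(X ⊗ Y, Z) ≅ A(X, Y ⊸ Z)` in `V`, `V`-natural in `X`, `Y` and `Z`.
In particular, for every `Y`, a `V`-adjunction `- ⊗ Y ⊣ Y ⊸ -`. -/
structure TensorHomAdjunction {A : Type u₁} [EnrichedCategory V A]
    (T : TensorBifunctor V A) (H : HomBifunctor V A) where
  homIso (X Y Z : A) : (T.obj X Y ⟶[V] Z) ≅ (X ⟶[V] H.obj Y Z)
  naturality_left (X' X Y Z : A) :
    ((X' ⟶[V] X) ◁ (homIso X Y Z).hom) ≫ eComp V X' X (H.obj Y Z) =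
      (((ρ_ (X' ⟶[V] X)).inv ≫ ((X' ⟶[V] X) ◁ eId V Y) ≫ T.map X' X Y Y) ▷
          (T.obj X Y ⟶[V] Z)) ≫
        eComp V (T.obj X' Y) (T.obj X Y) Z ≫ (homIso X' Y Z).hom
  naturality_mid (X Y' Y Z : A) :
    (((ρ_ (Y' ⟶[V] Y)).inv ≫ ((Y' ⟶[V] Y) ◁ eId V Z) ≫ H.map Y' Y Z Z) ⊗ₘ
          (homIso X Y Z).hom) ≫
        (β_ (H.obj Y Z ⟶[V] H.obj Y' Z) (X ⟶[V] H.obj Y Z)).hom ≫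
        eComp V X (H.obj Y Z) (H.obj Y' Z) =
      (((λ_ (Y' ⟶[V] Y)).inv ≫ (eId V X ▷ (Y' ⟶[V] Y)) ≫ T.map X X Y' Y) ▷
          (T.obj X Y ⟶[V] Z)) ≫
        eComp V (T.obj X Y') (T.obj X Y) Z ≫ (homIso X Y' Z).hom
  naturality_right (X Y Z Z' : A) :
    ((homIso X Y Z).hom ⊗ₘ
          ((λ_ (Z ⟶[V] Z')).inv ≫ (eId V Y ▷ (Z ⟶[V] Z')) ≫ H.map Y Y Z Z')) ≫
        eComp V X (H.obj Y Z) (H.obj Y Z') =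
      eComp V (T.obj X Y) Z Z' ≫ (homIso X Y Z').hom

/-- The `V`-bifunctor `(X, Y) ↦ L (i X ⊗ i Y)`. -/
def TensorBifunctor.reflect {A : Type u₁} {B : Type u₂} [EnrichedCategory V A]
    [EnrichedCategory V B] (T : TensorBifunctor V A) (i : EnrichedFunctor V B A)
    (L : EnrichedFunctor V A B) : TensorBifunctor V B where
  obj X Y := L.obj (T.obj (i.obj X) (i.obj Y))
  map X₁ Y₁ X₂ Y₂ := (i.map X₁ Y₁ ⊗ₘ i.map X₂ Y₂) ≫ T.map _ _ _ _ ≫ L.map _ _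
  map_id X₁ X₂ := by
    rw [tensorHom_comp_tensorHom_assoc, i.map_id, i.map_id, reassoc_of% (T.map_id),
      L.map_id]
  map_comp X₁ Y₁ Z₁ X₂ Y₂ Z₂ := by
    rw [← tensorHom_comp_tensorHom, ← tensorHom_comp_tensorHom, Category.assoc,
      Category.assoc, ← L.map_comp, reassoc_of% (T.map_comp), tensorμ_natural_assoc,
      tensorHom_comp_tensorHom_assoc, tensorHom_comp_tensorHom_assoc, i.map_comp, i.map_comp]

end General

/-! ## Bisets -/

/-- A biset: two sets and a function `one → zero`. -/
structure Biset : Type (u + 1) where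
  zero : Type u
  one : Type u
  res : one → zero

namespace Biset

/-- A morphism of bisets: a commutative square. -/
@[ext]
structure Hom (X Y : Biset.{u}) : Type u where
  app0 : X.zero → Y.zero
  app1 : X.one → Y.one
  comm : ∀ x, Y.res (app1 x) = app0 (X.res x)

instance : Category.{u} Biset.{u} where
  Hom := Hom
  id X := ⟨fun x => x, fun x => x, fun _ => rfl⟩
  comp f g := ⟨fun x => g.app0 (f.app0 x), fun x => g.app1 (f.app1 x), fun x => by
    rw [g.comm, f.comm]⟩

@[ext]
theorem hom_ext {X Y : Biset.{u}} {f g : X ⟶ Y} (h0 : ∀ x, f.app0 x = g.app0 x)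
    (h1 : ∀ x, f.app1 x = g.app1 x) : f = g :=
  Hom.ext (funext h0) (funext h1)

theorem congr0 {X Y : Biset.{u}} {f g : X ⟶ Y} (h : f = g) (x : X.zero) : f.app0 x = g.app0 x :=
  h ▸ rfl

theorem congr1 {X Y : Biset.{u}} {f g : X ⟶ Y} (h : f = g) (x : X.one) : f.app1 x = g.app1 x :=
  h ▸ rfl

/-- The cartesian product of bisets. -/
def prod (X Y : Biset.{u}) : Biset.{u} :=
  ⟨X.zero × Y.zero, X.one × Y.one, fun p => (X.res p.1, Y.res p.2)⟩

/-- The terminal biset. -/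
def unit : Biset.{u} := ⟨PUnit, PUnit, fun x => x⟩

/-- The product of two morphisms. -/
def prodMap {X X' Y Y' : Biset.{u}} (f : X ⟶ X') (g : Y ⟶ Y') : prod X Y ⟶ prod X' Y' :=
  Hom.mk (fun p => (f.app0 p.1, g.app0 p.2)) (fun p => (f.app1 p.1, g.app1 p.2))
    (fun p => Prod.ext (f.comm p.1) (g.comm p.2))

/-- The cartesian monoidal structure on bisets. -/
instance : MonoidalCategory Biset.{u} where
  tensorObj := prod
  tensorUnit := unit
  tensorHom := prodMap
  whiskerLeft X _ _ g := prodMap (𝟙 X) g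
  whiskerRight f Y := prodMap f (𝟙 Y)
  associator _ _ _ :=
    { hom := Hom.mk (fun p => (p.1.1, p.1.2, p.2)) (fun p => (p.1.1, p.1.2, p.2)) (fun _ => rfl)
      inv := Hom.mk (fun p => ((p.1, p.2.1), p.2.2)) (fun p => ((p.1, p.2.1), p.2.2))
        (fun _ => rfl)
      hom_inv_id := rfl
      inv_hom_id := rfl }
  leftUnitor _ :=
    { hom := Hom.mk (fun p => p.2) (fun p => p.2) (fun _ => rfl)
      inv := Hom.mk (fun x => (PUnit.unit, x)) (fun x => (PUnit.unit, x)) (fun _ => rfl)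
      hom_inv_id := rfl
      inv_hom_id := rfl }
  rightUnitor _ :=
    { hom := Hom.mk (fun p => p.1) (fun p => p.1) (fun _ => rfl)
      inv := Hom.mk (fun x => (x, PUnit.unit)) (fun x => (x, PUnit.unit)) (fun _ => rfl)
      hom_inv_id := rfl
      inv_hom_id := rfl }
  tensorHom_def _ _ := rfl
  id_tensorHom_id _ _ := rfl
  tensorHom_comp_tensorHom _ _ _ _ := rfl
  whiskerLeft_id _ _ := rfl
  id_whiskerRight _ _ := rfl
  associator_naturality _ _ _ := rfl
  leftUnitor_naturality _ := rfl
  rightUnitor_naturality _ := rfl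
  pentagon _ _ _ _ := rfl
  triangle _ _ := rfl

instance : SymmetricCategory Biset.{u} where
  braiding _ _ :=
    { hom := Hom.mk (fun p => (p.2, p.1)) (fun p => (p.2, p.1)) (fun _ => rfl)
      inv := Hom.mk (fun p => (p.2, p.1)) (fun p => (p.2, p.1)) (fun _ => rfl)
      hom_inv_id := rfl
      inv_hom_id := rfl }
  braiding_naturality_right _ _ _ _ := rfl
  braiding_naturality_left _ _ := rfl
  hexagon_forward _ _ _ := rfl
  hexagon_reverse _ _ _ := rfl
  symmetry _ _ := rfl

/-- The exponential `X ⇒ Y`: its `one` is the set of morphisms of bisets, its `zero` the set of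
functions between the zero parts. -/
def exp (X Y : Biset.{u}) : Biset.{u} :=
  ⟨X.zero → Y.zero, X ⟶ Y, fun h => h.app0⟩

/-- Bisets are enriched in themselves by exponentials. -/
instance : EnrichedCategory Biset.{u} Biset.{u} where
  Hom := exp
  id X := Hom.mk (fun _ x => x) (fun _ => 𝟙 X) (fun _ => rfl)
  comp _ _ _ := Hom.mk (fun p x => p.2 (p.1 x)) (fun p => p.1 ≫ p.2) (fun _ => rfl)
  id_comp _ _ := rfl
  comp_id _ _ := rfl
  assoc _ _ _ _ := rfl

end Biset

/-! ## The elements of a biset-enriched category -/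

section Elements

variable {A : Type u₁} [EnrichedCategory Biset.{u} A]

/-- Composition of elements of the zero parts. -/
abbrev comp0 {X Y Z : A} (f : (X ⟶[Biset.{u}] Y).zero) (g : (Y ⟶[Biset.{u}] Z).zero) :
    (X ⟶[Biset.{u}] Z).zero :=
  (eComp Biset.{u} X Y Z).app0 (f, g)

/-- Composition of elements of the one parts. -/
abbrev comp1 {X Y Z : A} (f : (X ⟶[Biset.{u}] Y).one) (g : (Y ⟶[Biset.{u}] Z).one) :
    (X ⟶[Biset.{u}] Z).one :=
  (eComp Biset.{u} X Y Z).app1 (f, g)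

/-- The identity as an element of the zero part. -/
abbrev id0 (X : A) : (X ⟶[Biset.{u}] X).zero := (eId Biset.{u} X).app0 PUnit.unit

/-- The identity as an element of the one part. -/
abbrev id1 (X : A) : (X ⟶[Biset.{u}] X).one := (eId Biset.{u} X).app1 PUnit.unit

theorem id0_comp {X Y : A} (f : (X ⟶[Biset.{u}] Y).zero) : comp0 (id0 X) f = f :=
  Biset.congr0 (e_id_comp Biset.{u} X Y) f

theorem comp0_id {X Y : A} (f : (X ⟶[Biset.{u}] Y).zero) : comp0 f (id0 Y) = f :=
  Biset.congr0 (e_comp_id Biset.{u} X Y) f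

theorem assoc0 {W X Y Z : A} (f : (W ⟶[Biset.{u}] X).zero) (g : (X ⟶[Biset.{u}] Y).zero)
    (h : (Y ⟶[Biset.{u}] Z).zero) : comp0 (comp0 f g) h = comp0 f (comp0 g h) :=
  Biset.congr0 (e_assoc Biset.{u} W X Y Z) (f, (g, h))

theorem id1_comp {X Y : A} (f : (X ⟶[Biset.{u}] Y).one) : comp1 (id1 X) f = f :=
  Biset.congr1 (e_id_comp Biset.{u} X Y) f

theorem comp1_id {X Y : A} (f : (X ⟶[Biset.{u}] Y).one) : comp1 f (id1 Y) = f :=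
  Biset.congr1 (e_comp_id Biset.{u} X Y) f

theorem assoc1 {W X Y Z : A} (f : (W ⟶[Biset.{u}] X).one) (g : (X ⟶[Biset.{u}] Y).one)
    (h : (Y ⟶[Biset.{u}] Z).one) : comp1 (comp1 f g) h = comp1 f (comp1 g h) :=
  Biset.congr1 (e_assoc Biset.{u} W X Y Z) (f, (g, h))

theorem res_comp {X Y Z : A} (f : (X ⟶[Biset.{u}] Y).one) (g : (Y ⟶[Biset.{u}] Z).one) :
    (X ⟶[Biset.{u}] Z).res (comp1 f g) =
      comp0 ((X ⟶[Biset.{u}] Y).res f) ((Y ⟶[Biset.{u}] Z).res g) :=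
  (eComp Biset.{u} X Y Z).comm (f, g)

theorem res_id (X : A) : (X ⟶[Biset.{u}] X).res (id1 X) = id0 X :=
  (eId Biset.{u} X).comm PUnit.unit

end Elements

/-! ## Biset-enriched functor categories -/

section FunctorCategory

variable {A : Type u} [EnrichedCategory Biset.{u} A]
  {B : Type u₂} [EnrichedCategory Biset.{u} B]

/-- Naturality of a family of elements of the zero parts. -/
def IsNatural0 (F G : EnrichedFunctor Biset.{u} A B)
    (β : ∀ X : A, (F.obj X ⟶[Biset.{u}] G.obj X).zero) : Prop :=
  ∀ (X Y : A) (g : (X ⟶[Biset.{u}] Y).zero),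
    comp0 ((F.map X Y).app0 g) (β Y) = comp0 (β X) ((G.map X Y).app0 g)

/-- Naturality of a family of elements of the one parts. -/
def IsNatural1 (F G : EnrichedFunctor Biset.{u} A B)
    (α : ∀ X : A, (F.obj X ⟶[Biset.{u}] G.obj X).one) : Prop :=
  (∀ (X Y : A) (f : (X ⟶[Biset.{u}] Y).one),
    comp1 ((F.map X Y).app1 f) (α Y) = comp1 (α X) ((G.map X Y).app1 f)) ∧
  IsNatural0 F G (fun X => (F.obj X ⟶[Biset.{u}] G.obj X).res (α X))

/-- The biset of `V`-natural transformations, that is, the end of `B(F X, G X)` in bisets. -/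
def natBiset (F G : EnrichedFunctor Biset.{u} A B) : Biset.{u} where
  zero := { β : ∀ X : A, (F.obj X ⟶[Biset.{u}] G.obj X).zero // IsNatural0 F G β }
  one := { α : ∀ X : A, (F.obj X ⟶[Biset.{u}] G.obj X).one // IsNatural1 F G α }
  res α := ⟨fun X => (F.obj X ⟶[Biset.{u}] G.obj X).res (α.1 X), α.2.2⟩

/-- The biset-enriched functor category. -/
instance functorCategory : EnrichedCategory Biset.{u} (EnrichedFunctor Biset.{u} A B) where
  Hom := natBiset
  id F := Biset.Hom.mk
    (fun _ => ⟨fun X => id0 (F.obj X), fun X Y g => by rw [comp0_id, id0_comp]⟩)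
    (fun _ => ⟨fun X => id1 (F.obj X), fun X Y g => by rw [comp1_id, id1_comp],
      fun X Y g => by simp only [res_id]; rw [comp0_id, id0_comp]⟩)
    (fun _ => Subtype.ext (funext fun X => res_id _))
  comp F G H := Biset.Hom.mk
    (fun p => ⟨fun X => comp0 (p.1.1 X) (p.2.1 X), fun X Y g => by
      rw [← assoc0, p.1.2 X Y g, assoc0, p.2.2 X Y g, assoc0]⟩)
    (fun p => ⟨fun X => comp1 (p.1.1 X) (p.2.1 X), fun X Y g => by
      rw [← assoc1, p.1.2.1 X Y g, assoc1, p.2.2.1 X Y g, assoc1], fun X Y g => by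
      simp only [res_comp]
      rw [← assoc0, p.1.2.2 X Y g, assoc0, p.2.2.2 X Y g, assoc0]⟩)
    (fun p => Subtype.ext (funext fun X => res_comp _ _))
  id_comp F G := Biset.hom_ext (fun β => Subtype.ext (funext fun X => id0_comp _))
    (fun β => Subtype.ext (funext fun X => id1_comp _))
  comp_id F G := Biset.hom_ext (fun β => Subtype.ext (funext fun X => comp0_id _))
    (fun β => Subtype.ext (funext fun X => comp1_id _))
  assoc F G H K := Biset.hom_ext (fun β => Subtype.ext (funext fun X => assoc0 _ _ _))
    (fun β => Subtype.ext (funext fun X => assoc1 _ _ _))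

end FunctorCategory

/-! ## Full subcategories -/

section FullSub

variable (V : Type v) [Category.{w} V] [MonoidalCategory V] {A : Type u₁} [EnrichedCategory V A]
  (P : A → Prop)

/-- The full `V`-subcategory on the objects satisfying `P`. -/
instance fullSub : EnrichedCategory V { X : A // P X } where
  Hom X Y := X.1 ⟶[V] Y.1
  id X := eId V X.1
  comp X Y Z := eComp V X.1 Y.1 Z.1
  id_comp X Y := e_id_comp V X.1 Y.1
  comp_id X Y := e_comp_id V X.1 Y.1
  assoc W X Y Z := e_assoc V W.1 X.1 Y.1 Z.1

/-- The inclusion of a full `V`-subcategory. -/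
def incl : EnrichedFunctor V { X : A // P X } A where
  obj X := X.1
  map X Y := 𝟙 (X.1 ⟶[V] Y.1)
  map_id _ := Category.comp_id _
  map_comp X Y Z := by
    refine (Category.comp_id _).trans ?_
    erw [id_tensorHom_id, Category.id_comp]
    rfl

variable {V} {P} in
/-- The restriction of an internal hom bifunctor to a full subcategory that is closed under it. -/
def HomBifunctor.restrict [BraidedCategory V] (H : HomBifunctor V A)
    (h : ∀ Y Z : { X : A // P X }, P (H.obj Y.1 Z.1)) : HomBifunctor V { X : A // P X } where
  obj Y Z := ⟨H.obj Y.1 Z.1, h Y Z⟩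
  map Y' Y Z Z' := H.map Y'.1 Y.1 Z.1 Z'.1
  map_id Y Z := H.map_id Y.1 Z.1
  map_comp Y'' Y' Y Z Z' Z'' := H.map_comp Y''.1 Y'.1 Y.1 Z.1 Z'.1 Z''.1

end FullSub

/-! ## Presheaves and Day convolution -/

section Day

variable {C : Type u} [EnrichedCategory Biset.{u} C]

variable (C) in
/-- The `V`-category of presheaves `Cᵒᵖ ⟶ V`, with `V` the category of bisets. -/
abbrev Presheaf : Type (u + 1) := EnrichedFunctor Biset.{u} Cᵒᵖ Biset.{u}

namespace Presheaf

/-- The action of an element of the zero part of `C(X, Y)` on a presheaf. -/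
def act0 (F : Presheaf C) {X Y : C} (f : (X ⟶[Biset.{u}] Y).zero) :
    (F.obj (op Y)).zero → (F.obj (op X)).zero :=
  (F.map (op Y) (op X)).app0 f

/-- The action of an element of the one part of `C(X, Y)` on a presheaf. -/
def act1 (F : Presheaf C) {X Y : C} (f : (X ⟶[Biset.{u}] Y).one) :
    F.obj (op Y) ⟶ F.obj (op X) :=
  (F.map (op Y) (op X)).app1 f

theorem act1_app0 (F : Presheaf C) {X Y : C} (f : (X ⟶[Biset.{u}] Y).one) :
    (F.act1 f).app0 = F.act0 ((X ⟶[Biset.{u}] Y).res f) :=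
  (F.map (op Y) (op X)).comm f

theorem act0_id (F : Presheaf C) (X : C) (x : (F.obj (op X)).zero) : F.act0 (id0 X) x = x :=
  congrFun (Biset.congr0 (F.map_id (op X)) PUnit.unit) x

theorem act1_id (F : Presheaf C) (X : C) : F.act1 (id1 X) = 𝟙 (F.obj (op X)) :=
  Biset.congr1 (F.map_id (op X)) PUnit.unit

theorem act0_comp (F : Presheaf C) {X Y Z : C} (f : (X ⟶[Biset.{u}] Y).zero)
    (g : (Y ⟶[Biset.{u}] Z).zero) (x : (F.obj (op Z)).zero) :
    F.act0 (comp0 f g) x = F.act0 f (F.act0 g x) :=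
  congrFun (Biset.congr0 (F.map_comp (op Z) (op Y) (op X)) (g, f)) x

theorem act1_comp (F : Presheaf C) {X Y Z : C} (f : (X ⟶[Biset.{u}] Y).one)
    (g : (Y ⟶[Biset.{u}] Z).one) : F.act1 (comp1 f g) = F.act1 g ≫ F.act1 f :=
  Biset.congr1 (F.map_comp (op Z) (op Y) (op X)) (g, f)

/-- The enriched Yoneda embedding on objects: the presheaf `C(-, Z)`. -/
def yoneda (Z : C) : Presheaf C where
  obj X := (unop X ⟶[Biset.{u}] Z)
  map X Y := Biset.Hom.mk (fun f x => comp0 f x)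
    (fun f => Biset.Hom.mk (fun x => comp0 ((unop Y ⟶[Biset.{u}] unop X).res f) x)
      (fun x => comp1 f x) (fun x => res_comp (X := unop Y) (Y := unop X) f x))
    (fun _ => rfl)
  map_id X := Biset.hom_ext (fun _ => funext fun x => id0_comp x)
    (fun _ => Biset.hom_ext
      (fun x => (congrArg (fun t => comp0 t x) (res_id (unop X))).trans (id0_comp x))
      (fun x => id1_comp x))
  map_comp X Y Z' := Biset.hom_ext (fun p => funext fun x => assoc0 (W := unop Z') (X := unop Y) (Y := unop X) p.2 p.1 x)
    (fun p => Biset.hom_ext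
      (fun x => (congrArg (fun t => comp0 t x) (res_comp (X := unop Z') (Y := unop Y) (Z := unop X) p.2 p.1)).trans (assoc0 _ _ x))
      (fun x => assoc1 (W := unop Z') (X := unop Y) (Y := unop X) p.2 p.1 x))

end Presheaf

/-- The tensor product of elements of the zero parts. -/
abbrev TensorBifunctor.map0 (T : TensorBifunctor Biset.{u} C) {X₁ Y₁ X₂ Y₂ : C}
    (f : (X₁ ⟶[Biset.{u}] Y₁).zero) (g : (X₂ ⟶[Biset.{u}] Y₂).zero) :
    (T.obj X₁ X₂ ⟶[Biset.{u}] T.obj Y₁ Y₂).zero :=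
  (T.map X₁ Y₁ X₂ Y₂).app0 (f, g)

/-- The tensor product of elements of the one parts. -/
abbrev TensorBifunctor.map1 (T : TensorBifunctor Biset.{u} C) {X₁ Y₁ X₂ Y₂ : C}
    (f : (X₁ ⟶[Biset.{u}] Y₁).one) (g : (X₂ ⟶[Biset.{u}] Y₂).one) :
    (T.obj X₁ X₂ ⟶[Biset.{u}] T.obj Y₁ Y₂).one :=
  (T.map X₁ Y₁ X₂ Y₂).app1 (f, g)

section TensorLemmas

variable (T : TensorBifunctor Biset.{u} C)

theorem TensorBifunctor.map0_id (X Y : C) : T.map0 (id0 X) (id0 Y) = id0 (T.obj X Y) :=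
  Biset.congr0 (T.map_id X Y) (PUnit.unit, PUnit.unit)

theorem TensorBifunctor.map1_id (X Y : C) : T.map1 (id1 X) (id1 Y) = id1 (T.obj X Y) :=
  Biset.congr1 (T.map_id X Y) (PUnit.unit, PUnit.unit)

theorem TensorBifunctor.map0_comp {X₁ Y₁ Z₁ X₂ Y₂ Z₂ : C}
    (f₁ : (X₁ ⟶[Biset.{u}] Y₁).zero) (g₁ : (Y₁ ⟶[Biset.{u}] Z₁).zero)
    (f₂ : (X₂ ⟶[Biset.{u}] Y₂).zero) (g₂ : (Y₂ ⟶[Biset.{u}] Z₂).zero) :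
    T.map0 (comp0 f₁ g₁) (comp0 f₂ g₂) = comp0 (T.map0 f₁ f₂) (T.map0 g₁ g₂) :=
  (Biset.congr0 (T.map_comp X₁ Y₁ Z₁ X₂ Y₂ Z₂) ((f₁, f₂), (g₁, g₂))).symm

theorem TensorBifunctor.map1_comp {X₁ Y₁ Z₁ X₂ Y₂ Z₂ : C}
    (f₁ : (X₁ ⟶[Biset.{u}] Y₁).one) (g₁ : (Y₁ ⟶[Biset.{u}] Z₁).one)
    (f₂ : (X₂ ⟶[Biset.{u}] Y₂).one) (g₂ : (Y₂ ⟶[Biset.{u}] Z₂).one) :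
    T.map1 (comp1 f₁ g₁) (comp1 f₂ g₂) = comp1 (T.map1 f₁ f₂) (T.map1 g₁ g₂) :=
  (Biset.congr1 (T.map_comp X₁ Y₁ Z₁ X₂ Y₂ Z₂) ((f₁, f₂), (g₁, g₂))).symm

theorem TensorBifunctor.res_map {X₁ Y₁ X₂ Y₂ : C}
    (f : (X₁ ⟶[Biset.{u}] Y₁).one) (g : (X₂ ⟶[Biset.{u}] Y₂).one) :
    (T.obj X₁ X₂ ⟶[Biset.{u}] T.obj Y₁ Y₂).res (T.map1 f g) =
      T.map0 ((X₁ ⟶[Biset.{u}] Y₁).res f) ((X₂ ⟶[Biset.{u}] Y₂).res g) :=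
  (T.map X₁ Y₁ X₂ Y₂).comm (f, g)

end TensorLemmas

variable (T : TensorBifunctor Biset.{u} C)

/-! ### The Day tensor product

The coend `∫^{A, B} C(Z, A ⊗ B) × F A × G B` in bisets. Colimits of bisets are computed in the zero
and in the one parts separately, so that each part is a quotient of the set of triples
`(h : Z → A ⊗ B, x ∈ F A, y ∈ G B)`. -/

/-- The elements of the zero part of `∐_{A, B} C(Z, A ⊗ B) × F A × G B`. -/
structure DayGen0 (F G : Presheaf C) (Z : C) : Type u where
  left : C
  right : C
  hom : (Z ⟶[Biset.{u}] T.obj left right).zero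
  fst : (F.obj (op left)).zero
  snd : (G.obj (op right)).zero

/-- The elements of the one part of `∐_{A, B} C(Z, A ⊗ B) × F A × G B`. -/
structure DayGen1 (F G : Presheaf C) (Z : C) : Type u where
  left : C
  right : C
  hom : (Z ⟶[Biset.{u}] T.obj left right).one
  fst : (F.obj (op left)).one
  snd : (G.obj (op right)).one

/-- The identifications `(h, a^* x, b^* y) ∼ ((a ⊗ b) ∘ h, x, y)` made by the coend. -/
inductive DayRel0 (F G : Presheaf C) (Z : C) : DayGen0 T F G Z → DayGen0 T F G Z → Prop
  | mk {A A' B B' : C} (a : (A ⟶[Biset.{u}] A').zero) (b : (B ⟶[Biset.{u}] B').zero)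
      (h : (Z ⟶[Biset.{u}] T.obj A B).zero) (x : (F.obj (op A')).zero)
      (y : (G.obj (op B')).zero) :
      DayRel0 F G Z ⟨A, B, h, F.act0 a x, G.act0 b y⟩ ⟨A', B', comp0 h (T.map0 a b), x, y⟩

/-- The identifications `(h, a^* x, b^* y) ∼ ((a ⊗ b) ∘ h, x, y)` made by the coend. -/
inductive DayRel1 (F G : Presheaf C) (Z : C) : DayGen1 T F G Z → DayGen1 T F G Z → Prop
  | mk {A A' B B' : C} (a : (A ⟶[Biset.{u}] A').one) (b : (B ⟶[Biset.{u}] B').one)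
      (h : (Z ⟶[Biset.{u}] T.obj A B).one) (x : (F.obj (op A')).one)
      (y : (G.obj (op B')).one) :
      DayRel1 F G Z ⟨A, B, h, (F.act1 a).app1 x, (G.act1 b).app1 y⟩
        ⟨A', B', comp1 h (T.map1 a b), x, y⟩

variable {T} in
/-- The map from the one part to the zero part before taking quotients. -/
def DayGen1.res {F G : Presheaf C} {Z : C} (p : DayGen1 T F G Z) : DayGen0 T F G Z :=
  ⟨p.left, p.right, (Z ⟶[Biset.{u}] T.obj p.left p.right).res p.hom,
    (F.obj (op p.left)).res p.fst, (G.obj (op p.right)).res p.snd⟩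

theorem DayRel1.res {F G : Presheaf C} {Z : C} (p q : DayGen1 T F G Z)
    (h : DayRel1 T F G Z p q) : DayRel0 T F G Z p.res q.res := by
  obtain ⟨a, b, h, x, y⟩ := h
  simp only [DayGen1.res]
  rw [res_comp, T.res_map, (F.act1 a).comm, (G.act1 b).comm, F.act1_app0, G.act1_app0]
  exact .mk _ _ _ _ _

/-- The value at `Z` of the Day tensor product. -/
def dayTensorBiset (F G : Presheaf C) (Z : C) : Biset.{u} where
  zero := Quot (DayRel0 T F G Z)
  one := Quot (DayRel1 T F G Z)
  res := Quot.map DayGen1.res (DayRel1.res T)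

/-- Reindexing of the zero part of the Day tensor product along `f : Z' → Z`. -/
def dayTensorAct0 (F G : Presheaf C) {Z' Z : C} (f : (Z' ⟶[Biset.{u}] Z).zero) :
    (dayTensorBiset T F G Z).zero → (dayTensorBiset T F G Z').zero :=
  Quot.map (fun p => ⟨p.left, p.right, comp0 f p.hom, p.fst, p.snd⟩) (by
    rintro _ _ ⟨a, b, h, x, y⟩
    simp only [← assoc0]
    exact .mk a b _ x y)

/-- Reindexing of the one part of the Day tensor product along `f : Z' → Z`. -/
def dayTensorAct1 (F G : Presheaf C) {Z' Z : C} (f : (Z' ⟶[Biset.{u}] Z).one) :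
    (dayTensorBiset T F G Z).one → (dayTensorBiset T F G Z').one :=
  Quot.map (fun p => ⟨p.left, p.right, comp1 f p.hom, p.fst, p.snd⟩) (by
    rintro _ _ ⟨a, b, h, x, y⟩
    simp only [← assoc1]
    exact .mk a b _ x y)

/-- The Day tensor product `F ⊗ G = ∫^{A, B} C(-, A ⊗ B) × F A × G B`. -/
def dayTensorObj (F G : Presheaf C) : Presheaf C where
  obj Z := dayTensorBiset T F G (unop Z)
  map Z Z' := Biset.Hom.mk (fun f => dayTensorAct0 T F G f)
    (fun f => Biset.Hom.mk (dayTensorAct0 T F G ((unop Z' ⟶[Biset.{u}] unop Z).res f))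
      (dayTensorAct1 T F G f) (by
        rintro ⟨p⟩
        refine congrArg (Quot.mk _) ?_
        simp only [DayGen1.res, res_comp]))
    (fun _ => rfl)
  map_id Z := Biset.hom_ext
    (fun _ => funext (by
      rintro ⟨p⟩
      exact congrArg (fun t => Quot.mk _ (DayGen0.mk p.left p.right t p.fst p.snd))
        (id0_comp p.hom)))
    (fun _ => Biset.hom_ext
      (by
        rintro ⟨p⟩
        exact congrArg (fun t => Quot.mk _ (DayGen0.mk p.left p.right t p.fst p.snd))
          ((congrArg (fun s => comp0 s p.hom) (res_id (unop Z))).trans (id0_comp p.hom)))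
      (by
        rintro ⟨p⟩
        exact congrArg (fun t => Quot.mk _ (DayGen1.mk p.left p.right t p.fst p.snd))
          (id1_comp p.hom)))
  map_comp Z Z' Z'' := Biset.hom_ext
    (fun q => funext (by
      rintro ⟨p⟩
      exact congrArg (fun t => Quot.mk _ (DayGen0.mk p.left p.right t p.fst p.snd))
        (assoc0 (W := unop Z'') (X := unop Z') (Y := unop Z) q.2 q.1 p.hom)))
    (fun q => Biset.hom_ext
      (by
        rintro ⟨p⟩
        exact congrArg (fun t => Quot.mk _ (DayGen0.mk p.left p.right t p.fst p.snd))
          ((congrArg (fun s => comp0 s p.hom) (res_comp (X := unop Z'') (Y := unop Z') (Z := unop Z) q.2 q.1)).trans (assoc0 _ _ p.hom)))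
      (by
        rintro ⟨p⟩
        exact congrArg (fun t => Quot.mk _ (DayGen1.mk p.left p.right t p.fst p.snd))
          (assoc1 (W := unop Z'') (X := unop Z') (Y := unop Z) q.2 q.1 p.hom)))

/-- The Day tensor product of two elements of the zero parts of hom-bisets. -/
def dayTensorMap0 {F F' G G' : Presheaf C} (β : (F ⟶[Biset.{u}] F').zero)
    (γ : (G ⟶[Biset.{u}] G').zero) (Z : C) :
    (dayTensorBiset T F G Z).zero → (dayTensorBiset T F' G' Z).zero :=
  Quot.map
    (fun p => ⟨p.left, p.right, p.hom, β.1 (op p.left) p.fst, γ.1 (op p.right) p.snd⟩) (by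
    rintro _ _ ⟨a, b, h, x, y⟩
    have hx : β.1 _ (F.act0 a x) = F'.act0 a (β.1 _ x) := congrFun (β.2 _ _ a) x
    have hy : γ.1 _ (G.act0 b y) = G'.act0 b (γ.1 _ y) := congrFun (γ.2 _ _ b) y
    simp only [hx, hy]
    exact .mk a b _ _ _)

/-- The Day tensor product of two `V`-natural transformations, on the one parts. -/
def dayTensorMap1 {F F' G G' : Presheaf C} (β : (F ⟶[Biset.{u}] F').one)
    (γ : (G ⟶[Biset.{u}] G').one) (Z : C) :
    (dayTensorBiset T F G Z).one → (dayTensorBiset T F' G' Z).one :=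
  Quot.map
    (fun p => ⟨p.left, p.right, p.hom, (β.1 (op p.left)).app1 p.fst,
      (γ.1 (op p.right)).app1 p.snd⟩) (by
    rintro _ _ ⟨a, b, h, x, y⟩
    have hx : (β.1 _).app1 ((F.act1 a).app1 x) = (F'.act1 a).app1 ((β.1 _).app1 x) :=
      congrArg (fun t => Biset.Hom.app1 t x) (β.2.1 _ _ a)
    have hy : (γ.1 _).app1 ((G.act1 b).app1 y) = (G'.act1 b).app1 ((γ.1 _).app1 y) :=
      congrArg (fun t => Biset.Hom.app1 t y) (γ.2.1 _ _ b)
    simp only [hx, hy]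
    exact .mk a b _ _ _)

/-- Day convolution as a `V`-bifunctor. -/
def dayTensor : TensorBifunctor Biset.{u} (Presheaf C) where
  obj := dayTensorObj T
  map F F' G G' := Biset.Hom.mk
    (fun p => ⟨fun Z => dayTensorMap0 T p.1 p.2 (unop Z), fun _ _ _ => funext (by
      rintro ⟨_⟩
      rfl)⟩)
    (fun p => ⟨fun Z => Biset.Hom.mk
        (dayTensorMap0 T ((F ⟶[Biset.{u}] F').res p.1) ((G ⟶[Biset.{u}] G').res p.2) (unop Z))
        (dayTensorMap1 T p.1 p.2 (unop Z)) (by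
          rintro ⟨q⟩
          refine congrArg (Quot.mk _) ?_
          simp only [DayGen1.res, (p.1.1 _).comm, (p.2.1 _).comm]
          rfl),
      fun _ _ _ => Biset.hom_ext (by rintro ⟨_⟩; rfl) (by rintro ⟨_⟩; rfl),
      fun _ _ _ => funext (by
        rintro ⟨_⟩
        rfl)⟩)
    (fun _ => rfl)
  map_id F G := Biset.hom_ext
    (fun _ => Subtype.ext (funext fun _ => funext (by rintro ⟨_⟩; rfl)))
    (fun _ => Subtype.ext (funext fun _ => Biset.hom_ext (by rintro ⟨_⟩; rfl)
      (by rintro ⟨_⟩; rfl)))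
  map_comp F₁ F₂ F₃ G₁ G₂ G₃ := Biset.hom_ext
    (fun _ => Subtype.ext (funext fun _ => funext (by rintro ⟨_⟩; rfl)))
    (fun _ => Subtype.ext (funext fun _ => Biset.hom_ext (by rintro ⟨_⟩; rfl)
      (by rintro ⟨_⟩; rfl)))

/-! ### The Day internal hom -/

/-- The presheaf `H (Z ⊗ -)`. -/
def shift (H : Presheaf C) (Z : C) : Presheaf C where
  obj X := H.obj (op (T.obj Z (unop X)))
  map X Y := Biset.Hom.mk (fun f => H.act0 (T.map0 (id0 Z) f)) (fun f => H.act1 (T.map1 (id1 Z) f))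
    (fun f => (H.act1_app0 (T.map1 (id1 Z) f)).trans (congrArg (fun t => H.act0 t)
      ((T.res_map (X₂ := unop Y) (Y₂ := unop X) (id1 Z) f).trans
        (congrArg (fun t => T.map0 t _) (res_id Z)))))
  map_id X := Biset.hom_ext
    (fun _ => funext fun x =>
      (congrArg (fun t => H.act0 t x) (T.map0_id Z (unop X))).trans (H.act0_id _ x))
    (fun _ => (congrArg (fun t => H.act1 t) (T.map1_id Z (unop X))).trans (H.act1_id _))
  map_comp X Y W := Biset.hom_ext
    (fun p => funext fun x => by
      refine Eq.trans ?_ (H.act0_comp (T.map0 (id0 Z) p.2) (T.map0 (id0 Z) p.1) x)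
      rw [← T.map0_comp, comp0_id]
      rfl)
    (fun p => by
      refine Eq.trans ?_ (H.act1_comp (T.map1 (id1 Z) p.2) (T.map1 (id1 Z) p.1))
      rw [← T.map1_comp, comp1_id]
      rfl)

/-- `H (f ⊗ -) : H (Z ⊗ -) ⟶ H (Z' ⊗ -)` for `f : Z' → Z`, on the zero parts. -/
def shiftMap0 (H : Presheaf C) {Z' Z : C} (f : (Z' ⟶[Biset.{u}] Z).zero) :
    (shift T H Z ⟶[Biset.{u}] shift T H Z').zero :=
  ⟨fun X => H.act0 (T.map0 f (id0 (unop X))), fun X Y g => funext fun x => by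
    refine (H.act0_comp (T.map0 f (id0 (unop Y))) (T.map0 (id0 Z) g) x).symm.trans
      (Eq.trans ?_ (H.act0_comp (T.map0 (id0 Z') g) (T.map0 f (id0 (unop X))) x))
    rw [← T.map0_comp, ← T.map0_comp, comp0_id, id0_comp, id0_comp, comp0_id]⟩

/-- `H (f ⊗ -) : H (Z ⊗ -) ⟶ H (Z' ⊗ -)` for `f : Z' → Z`, on the one parts. -/
def shiftMap1 (H : Presheaf C) {Z' Z : C} (f : (Z' ⟶[Biset.{u}] Z).one) :
    (shift T H Z ⟶[Biset.{u}] shift T H Z').one :=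
  ⟨fun X => H.act1 (T.map1 f (id1 (unop X))), fun X Y g => by
    refine (H.act1_comp (T.map1 f (id1 (unop Y))) (T.map1 (id1 Z) g)).symm.trans
      (Eq.trans ?_ (H.act1_comp (T.map1 (id1 Z') g) (T.map1 f (id1 (unop X)))))
    rw [← T.map1_comp, ← T.map1_comp, comp1_id, id1_comp, id1_comp, comp1_id], by
    have h : (fun X : Cᵒᵖ => (H.act1 (T.map1 f (id1 (unop X)))).app0) =
        (shiftMap0 T H ((Z' ⟶[Biset.{u}] Z).res f)).1 := funext fun X => by
      rw [H.act1_app0, T.res_map, res_id]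
      rfl
    exact h ▸ (shiftMap0 T H ((Z' ⟶[Biset.{u}] Z).res f)).2⟩

theorem res_shiftMap (H : Presheaf C) {Z' Z : C} (f : (Z' ⟶[Biset.{u}] Z).one) :
    (shift T H Z ⟶[Biset.{u}] shift T H Z').res (shiftMap1 T H f) =
      shiftMap0 T H ((Z' ⟶[Biset.{u}] Z).res f) :=
  Subtype.ext (funext fun X => by
    refine (H.act1_app0 (T.map1 f (id1 (unop X)))).trans ?_
    rw [T.res_map, res_id]
    rfl)

theorem shiftMap0_id (H : Presheaf C) (Z : C) : shiftMap0 T H (id0 Z) = id0 (shift T H Z) :=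
  Subtype.ext (funext fun X => funext fun x =>
    (congrArg (fun t => H.act0 t x) (T.map0_id Z (unop X))).trans (H.act0_id _ x))

theorem shiftMap1_id (H : Presheaf C) (Z : C) : shiftMap1 T H (id1 Z) = id1 (shift T H Z) :=
  Subtype.ext (funext fun X =>
    (congrArg (fun t => H.act1 t) (T.map1_id Z (unop X))).trans (H.act1_id _))

theorem shiftMap0_comp (H : Presheaf C) {Z'' Z' Z : C} (g : (Z'' ⟶[Biset.{u}] Z').zero)
    (f : (Z' ⟶[Biset.{u}] Z).zero) :
    shiftMap0 T H (comp0 g f) = comp0 (shiftMap0 T H f) (shiftMap0 T H g) :=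
  Subtype.ext (funext fun X => funext fun x => by
    refine Eq.trans ?_ (H.act0_comp (T.map0 g (id0 (unop X))) (T.map0 f (id0 (unop X))) x)
    rw [← T.map0_comp, comp0_id]
    rfl)

theorem shiftMap1_comp (H : Presheaf C) {Z'' Z' Z : C} (g : (Z'' ⟶[Biset.{u}] Z').one)
    (f : (Z' ⟶[Biset.{u}] Z).one) :
    shiftMap1 T H (comp1 g f) = comp1 (shiftMap1 T H f) (shiftMap1 T H g) :=
  Subtype.ext (funext fun X => by
    refine Eq.trans ?_ (H.act1_comp (T.map1 g (id1 (unop X))) (T.map1 f (id1 (unop X))))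
    rw [← T.map1_comp, comp1_id]
    rfl)

/-- `γ_{Z ⊗ -} : H (Z ⊗ -) ⟶ H' (Z ⊗ -)`, on the zero parts. -/
def shiftNat0 {H H' : Presheaf C} (γ : (H ⟶[Biset.{u}] H').zero) (Z : C) :
    (shift T H Z ⟶[Biset.{u}] shift T H' Z).zero :=
  ⟨fun X => γ.1 (op (T.obj Z (unop X))), fun _ _ g => γ.2 _ _ (T.map0 (id0 Z) g)⟩

/-- `γ_{Z ⊗ -} : H (Z ⊗ -) ⟶ H' (Z ⊗ -)`, on the one parts. -/
def shiftNat1 {H H' : Presheaf C} (γ : (H ⟶[Biset.{u}] H').one) (Z : C) :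
    (shift T H Z ⟶[Biset.{u}] shift T H' Z).one :=
  ⟨fun X => γ.1 (op (T.obj Z (unop X))), fun _ _ g => γ.2.1 _ _ (T.map1 (id1 Z) g),
    fun _ _ g => γ.2.2 _ _ (T.map0 (id0 Z) g)⟩

/-- The Day internal hom
`(G ⊸ H)(Z) = ∫_A (G A ⇒ H (Z ⊗ A))`, the biset of `V`-natural transformations
`G ⟶ H (Z ⊗ -)`. -/
def dayHomObj (G H : Presheaf C) : Presheaf C where
  obj Z := (G ⟶[Biset.{u}] shift T H (unop Z))
  map Z Z' := Biset.Hom.mk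
    (fun f θ => comp0 θ (shiftMap0 T H (Z' := unop Z') (Z := unop Z) f))
    (fun f => Biset.Hom.mk
      (fun θ => comp0 θ (shiftMap0 T H ((unop Z' ⟶[Biset.{u}] unop Z).res f)))
      (fun θ => comp1 θ (shiftMap1 T H (Z' := unop Z') (Z := unop Z) f))
      (fun θ => (res_comp θ (shiftMap1 T H (Z' := unop Z') (Z := unop Z) f)).trans
        (congrArg (fun t => comp0 _ t) (res_shiftMap T H (Z' := unop Z') (Z := unop Z) f))))
    (fun _ => rfl)
  map_id Z := Biset.hom_ext
    (fun _ => funext fun θ =>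
      (congrArg (fun t => comp0 θ t) (shiftMap0_id T H (unop Z))).trans (comp0_id θ))
    (fun _ => Biset.hom_ext
      (fun θ => (congrArg (fun t => comp0 θ (shiftMap0 T H t)) (res_id (unop Z))).trans
        ((congrArg (fun t => comp0 θ t) (shiftMap0_id T H (unop Z))).trans (comp0_id θ)))
      (fun θ => (congrArg (fun t => comp1 θ t) (shiftMap1_id T H (unop Z))).trans (comp1_id θ)))
  map_comp Z Z' Z'' := Biset.hom_ext
    (fun p => funext fun θ =>
      (congrArg (fun t => comp0 θ t) (shiftMap0_comp T H (Z'' := unop Z'') (Z' := unop Z')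
        (Z := unop Z) p.2 p.1)).trans (assoc0 θ _ _).symm)
    (fun p => Biset.hom_ext
      (fun θ => (congrArg (fun t => comp0 θ (shiftMap0 T H t)) (res_comp (X := unop Z'')
        (Y := unop Z') (Z := unop Z) p.2 p.1)).trans
        ((congrArg (fun t => comp0 θ t) (shiftMap0_comp T H (Z'' := unop Z'') (Z' := unop Z')
          (Z := unop Z) _ _)).trans (assoc0 θ _ _).symm))
      (fun θ => (congrArg (fun t => comp1 θ t) (shiftMap1_comp T H (Z'' := unop Z'')
        (Z' := unop Z') (Z := unop Z) p.2 p.1)).trans (assoc1 θ _ _).symm))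

/-- The Day internal hom as a `V`-bifunctor. -/
def dayHom : HomBifunctor Biset.{u} (Presheaf C) where
  obj := dayHomObj T
  map G' G H H' := Biset.Hom.mk
    (fun p => ⟨fun Z θ => comp0 (comp0 p.1 θ) (shiftNat0 T p.2 (unop Z)),
      fun Z Z' f => funext fun _ => Subtype.ext (funext fun X => funext fun _ =>
        congrFun (p.2.2 _ _ (T.map0 (X₁ := unop Z') (Y₁ := unop Z) f (id0 (unop X)))) _)⟩)
    (fun p => ⟨fun Z => Biset.Hom.mk
        (fun θ => comp0 (comp0 ((G' ⟶[Biset.{u}] G).res p.1) θ)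
          (shiftNat0 T ((H ⟶[Biset.{u}] H').res p.2) (unop Z)))
        (fun θ => comp1 (comp1 p.1 θ) (shiftNat1 T p.2 (unop Z)))
        (fun _ => rfl),
      fun Z Z' f => Biset.hom_ext
        (fun _ => Subtype.ext (funext fun X => funext fun _ =>
          congrFun (p.2.2.2 _ _ (T.map0 ((unop Z' ⟶[Biset.{u}] unop Z).res f)
            (id0 (unop X)))) _))
        (fun θ => Subtype.ext (funext fun X =>
          congrArg (fun t => p.1.1 X ≫ θ.1 X ≫ t)
            (p.2.2.1 _ _ (T.map1 (X₁ := unop Z') (Y₁ := unop Z) f (id1 (unop X)))))),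
      fun Z Z' f => funext fun _ => Subtype.ext (funext fun X => funext fun _ =>
        congrFun (p.2.2.2 _ _ (T.map0 (X₁ := unop Z') (Y₁ := unop Z) f (id0 (unop X)))) _)⟩)
    (fun _ => rfl)
  map_id _ _ := rfl
  map_comp _ _ _ _ _ _ := rfl

end Day

/-! ## Circuits and quantum operations

`M` is the category of circuits, `Q` the category of quantum operations, and `J : M ⥤ Q` the
interpretation functor, by which the objects of `M` are identified with those of `Q`. -/

section Circuits

variable {M Q : Type u} [SmallCategory M] [SmallCategory Q] (J : M ⥤ Q)

/-- The objects of the biset-enriched category `C` built from `J : M ⥤ Q`. -/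
def CircCat (_ : M ⥤ Q) : Type u := M

variable {J} in
/-- An object of `C` as an object of `M`. -/
abbrev CircCat.toM (A : CircCat J) : M := A

/-- An object of `M` as an object of `C`. -/
abbrev CircCat.ofM (A : M) : CircCat J := A

/-- The hom-bisets of `C` are `(Q(A, B), M(A, B), J)`. -/
instance : EnrichedCategory Biset.{u} (CircCat J) where
  Hom A B := ⟨J.obj A.toM ⟶ J.obj B.toM, A.toM ⟶ B.toM, fun f => J.map f⟩
  id A := Biset.Hom.mk (fun _ => 𝟙 (J.obj A.toM)) (fun _ => 𝟙 A.toM) (fun _ => J.map_id A)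
  comp _ _ _ := Biset.Hom.mk (fun p => p.1 ≫ p.2) (fun p => p.1 ≫ p.2)
    (fun p => J.map_comp p.1 p.2)
  id_comp _ _ := Biset.hom_ext (fun f => Category.id_comp f) (fun f => Category.id_comp f)
  comp_id _ _ := Biset.hom_ext (fun f => Category.comp_id f) (fun f => Category.comp_id f)
  assoc _ _ _ _ := Biset.hom_ext (fun p => Category.assoc p.1 p.2.1 p.2.2)
    (fun p => Category.assoc p.1 p.2.1 p.2.2)

open Functor.LaxMonoidal Functor.OplaxMonoidal in
/-- The tensor product of `C`: on objects and on `M` it is that of `M`; on `Q` it is that of `Q`,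
read through the identification of `J (A ⊗ B)` with `J A ⊗ J B`. -/
def circTensor [MonoidalCategory M] [SymmetricCategory M] [MonoidalCategory Q]
    [SymmetricCategory Q] [J.Braided] : TensorBifunctor Biset.{u} (CircCat J) where
  obj A B := CircCat.ofM J (A.toM ⊗ B.toM)
  map A₁ B₁ A₂ B₂ := Biset.Hom.mk
    (fun p => δ J A₁.toM A₂.toM ≫ (p.1 ⊗ₘ p.2) ≫
      μ J B₁.toM B₂.toM)
    (fun p => p.1 ⊗ₘ p.2)
    (fun p => by
      change J.map (p.1 ⊗ₘ p.2) = _ ≫ (J.map p.1 ⊗ₘ J.map p.2) ≫ _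
      rw [μ_natural, Functor.Monoidal.δ_μ_assoc])
  map_id A₁ A₂ := Biset.hom_ext
    (fun _ => by
      change δ J A₁.toM A₂.toM ≫ (𝟙 (J.obj A₁.toM) ⊗ₘ 𝟙 (J.obj A₂.toM)) ≫
        μ J A₁.toM A₂.toM = 𝟙 (J.obj (A₁.toM ⊗ A₂.toM))
      rw [id_tensorHom_id, Category.id_comp, Functor.Monoidal.δ_μ])
    (fun _ => id_tensorHom_id A₁.toM A₂.toM)
  map_comp A₁ B₁ C₁ A₂ B₂ C₂ := Biset.hom_ext
    (fun p => by
      obtain ⟨⟨f₁, f₂⟩, ⟨g₁, g₂⟩⟩ := p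
      change (δ J A₁.toM A₂.toM ≫ (f₁ ⊗ₘ f₂) ≫
          μ J B₁.toM B₂.toM) ≫
          (δ J B₁.toM B₂.toM ≫ (g₁ ⊗ₘ g₂) ≫
          μ J C₁.toM C₂.toM) =
        δ J A₁.toM A₂.toM ≫ ((f₁ ≫ g₁) ⊗ₘ (f₂ ≫ g₂)) ≫
          μ J C₁.toM C₂.toM
      rw [Category.assoc, Category.assoc, Functor.Monoidal.μ_δ_assoc,
        tensorHom_comp_tensorHom_assoc])
    (fun p => tensorHom_comp_tensorHom p.1.1 p.1.2 p.2.1 p.2.2)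

/-- A presheaf `F` on `C` is smooth if the presheaf `F⁰` on `Q` formed by its zero parts takes
every binary coproduct `A + B` of `Q` to a product: the map `F⁰ (A + B) → F⁰ A × F⁰ B` is
bijective. -/
def IsSmooth (F : Presheaf (CircCat J)) : Prop :=
  ∀ (A B P : CircCat J) (i : (A ⟶[Biset.{u}] P).zero) (j : (B ⟶[Biset.{u}] P).zero),
    Nonempty (Limits.IsColimit (Limits.BinaryCofan.mk (C := Q) (X := J.obj A.toM) (Y := J.obj B.toM)
      (P := J.obj P.toM) i j)) →
    Function.Bijective (fun x : (F.obj (op P)).zero => (F.act0 i x, F.act0 j x))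

/-- The full `V`-subcategory of smooth presheaves. -/
abbrev SmoothPresheaf : Type (u + 1) := { F : Presheaf (CircCat J) // IsSmooth J F }

/-- The inclusion of the smooth presheaves in all presheaves. -/
abbrev smoothIncl : EnrichedFunctor Biset.{u} (SmoothPresheaf J) (Presheaf (CircCat J)) :=
  incl Biset.{u} (IsSmooth J)

theorem isSmooth_yoneda (Z : CircCat J) : IsSmooth J (Presheaf.yoneda Z) := by
  rintro A B P i j ⟨h⟩
  refine ⟨fun x y hxy => ?_, fun p => ?_⟩
  · exact Limits.BinaryCofan.IsColimit.hom_ext h (congrArg Prod.fst hxy) (congrArg Prod.snd hxy)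
  · obtain ⟨l, h1, h2⟩ := Limits.BinaryCofan.IsColimit.desc' h p.1 p.2
    exact ⟨l, Prod.ext h1 h2⟩

/-- The corestriction of the Yoneda embedding to the smooth presheaves, on objects. -/
def lambek (Z : CircCat J) : SmoothPresheaf J := ⟨Presheaf.yoneda Z, isSmooth_yoneda J Z⟩

end Circuits

end EnrichedSM

/-! Smoothness constrains only the presheaf `F⁰` on `Q`: a pair of elements over the two summands of
a coproduct glues to exactly one element over the coproduct. The theorem is an instance of Day's
reflection theorem: a reflective full subcategory of presheaves that is closed under `G ⊸ -`
inherits a symmetric monoidal closed structure from Day convolution.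

Reflection. Unique gluing is algebraic structure: one binary operation for each coproduct cocone,
with equations making it inverse to the pair of restrictions. So the reflection of `F` is a free
construction. Its zero parts are terms built from elements of `F`, the action and formal gluings,
modulo the equations; its one parts are those of `F` (`completionArrow`). As `C` is small, terms
stay in the same universe. The universal property holds for the zero and for the one parts of
hom-bisets, compatibly with restriction, and this gives a `V`-adjunction.

Closure. The tensor product of `Q` preserves coproducts in each variable, so `A ⊗ -` and `- ⊗ A`
preserve coproduct cocones. Hence `H (A ⊗ -)` is smooth whenever `H` is, and elements of `G ⊸ H` can
be glued value by value (`IsContinuous.shift`, `IsContinuous.dayHom`).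

Tensor product. For any left adjoint `L` and any smooth `W`, maps `L (F ⊗ G) → W` are the natural
families `F A × G B → W (A ⊗ B)`, and so are maps `F → G ⊸ W`; this is the tensor-hom adjunction
(`reflTensorHomAdjunction`). The same universal property defines associator, braiding and unitors by
their values on products `x ⊗ y` of elements, as pullbacks along the structure maps of `C`. Maps to
smooth presheaves are determined by their values on iterated products (`Dense0.prod`,
`Dense1.prod`), and on these each law reduces to the corresponding law of `C` (`circElements`). Only
the adjunction and the closure properties enter, not the construction of `L`.

Most statements come in a version for zero parts and one for one parts, because neither kind of
element determines the other. -/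

namespace EnrichedSM

/-! ## Symmetric monoidal biset-categories in terms of elements -/

section Underlying

variable {A : Type u₁} [EnrichedCategory Biset.{u} A]

/-- The map of the underlying category given by an element of the one part of a hom-biset. -/
def underlyingHom {X Y : A} (f : (X ⟶[Biset.{u}] Y).one) :
    ForgetEnrichment.of Biset.{u} X ⟶ ForgetEnrichment.of Biset.{u} Y :=
  ForgetEnrichment.homOf Biset.{u} (Biset.Hom.mk (X := Biset.unit)
    (fun _ => (X ⟶[Biset.{u}] Y).res f) (fun _ => f) (fun _ => rfl))

theorem underlyingHom_comp {X Y Z : A} (f : (X ⟶[Biset.{u}] Y).one)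
    (g : (Y ⟶[Biset.{u}] Z).one) :
    underlyingHom f ≫ underlyingHom g = underlyingHom (comp1 f g) :=
  Biset.hom_ext (X := Biset.unit) (fun _ => (res_comp f g).symm) (fun _ => rfl)

theorem underlyingHom_id (X : A) :
    underlyingHom (id1 X) = 𝟙 (ForgetEnrichment.of Biset.{u} X) := by
  refine Eq.trans ?_ (ForgetEnrichment.homOf_eId Biset.{u} X)
  exact Biset.hom_ext (X := Biset.unit) (fun _ => res_id X) (fun _ => rfl)

/-- The tensor product of elements of the zero parts. -/
abbrev TensorBifunctor.tens0 (T : TensorBifunctor Biset.{u} A)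
    {X₁ Y₁ X₂ Y₂ : A} (f : (X₁ ⟶[Biset.{u}] Y₁).zero) (g : (X₂ ⟶[Biset.{u}] Y₂).zero) :
    (T.obj X₁ X₂ ⟶[Biset.{u}] T.obj Y₁ Y₂).zero :=
  (T.map X₁ Y₁ X₂ Y₂).app0 (f, g)

/-- The tensor product of elements of the one parts. -/
abbrev TensorBifunctor.tens1 (T : TensorBifunctor Biset.{u} A)
    {X₁ Y₁ X₂ Y₂ : A} (f : (X₁ ⟶[Biset.{u}] Y₁).one) (g : (X₂ ⟶[Biset.{u}] Y₂).one) :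
    (T.obj X₁ X₂ ⟶[Biset.{u}] T.obj Y₁ Y₂).one :=
  (T.map X₁ Y₁ X₂ Y₂).app1 (f, g)

theorem homTensor_underlyingHom (T : TensorBifunctor Biset.{u} A) {X₁ Y₁ X₂ Y₂ : A}
    (f : (X₁ ⟶[Biset.{u}] Y₁).one) (g : (X₂ ⟶[Biset.{u}] Y₂).one) :
    T.homTensor (underlyingHom f) (underlyingHom g) = underlyingHom (T.tens1 f g) :=
  Biset.hom_ext (X := Biset.unit) (fun _ => ((T.map X₁ Y₁ X₂ Y₂).comm (f, g)).symm) (fun _ => rfl)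

/-- An isomorphism of the underlying category given by mutually inverse elements. -/
def underlyingIso {X Y : A} (f : (X ⟶[Biset.{u}] Y).one) (g : (Y ⟶[Biset.{u}] X).one)
    (h : comp1 f g = id1 X) (h' : comp1 g f = id1 Y) :
    ForgetEnrichment.of Biset.{u} X ≅ ForgetEnrichment.of Biset.{u} Y where
  hom := underlyingHom f
  inv := underlyingHom g
  hom_inv_id := by rw [underlyingHom_comp, h, underlyingHom_id]
  inv_hom_id := by rw [underlyingHom_comp, h', underlyingHom_id]

end Underlying

/-- The data and laws of a symmetric monoidal structure on a biset-category, in terms of elements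
of the hom-bisets. -/
structure SymmetricMonoidalElements {A : Type u₁} [EnrichedCategory Biset.{u} A]
    (T : TensorBifunctor Biset.{u} A) (I : A) where
  a (X Y Z : A) : (T.obj (T.obj X Y) Z ⟶[Biset.{u}] T.obj X (T.obj Y Z)).one
  a' (X Y Z : A) : (T.obj X (T.obj Y Z) ⟶[Biset.{u}] T.obj (T.obj X Y) Z).one
  l (X : A) : (T.obj I X ⟶[Biset.{u}] X).one
  l' (X : A) : (X ⟶[Biset.{u}] T.obj I X).one
  r (X : A) : (T.obj X I ⟶[Biset.{u}] X).one
  r' (X : A) : (X ⟶[Biset.{u}] T.obj X I).one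
  b (X Y : A) : (T.obj X Y ⟶[Biset.{u}] T.obj Y X).one
  a_a' (X Y Z : A) : comp1 (a X Y Z) (a' X Y Z) = id1 _
  a'_a (X Y Z : A) : comp1 (a' X Y Z) (a X Y Z) = id1 _
  l_l' (X : A) : comp1 (l X) (l' X) = id1 _
  l'_l (X : A) : comp1 (l' X) (l X) = id1 _
  r_r' (X : A) : comp1 (r X) (r' X) = id1 _
  r'_r (X : A) : comp1 (r' X) (r X) = id1 _
  b_b (X Y : A) : comp1 (b X Y) (b Y X) = id1 _
  -- An element of a zero part need not be a restriction, so naturality on zero parts is a law of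
  -- its own. The coherence laws below relate elements of one parts; their zero versions follow by
  -- restriction.
  a_nat0 {X X' Y Y' Z Z' : A} (f : (X ⟶[Biset.{u}] X').zero) (g : (Y ⟶[Biset.{u}] Y').zero)
    (h : (Z ⟶[Biset.{u}] Z').zero) :
    comp0 (T.tens0 (T.tens0 f g) h) (Biset.res _ (a X' Y' Z')) =
      comp0 (Biset.res _ (a X Y Z)) (T.tens0 f (T.tens0 g h))
  a_nat1 {X X' Y Y' Z Z' : A} (f : (X ⟶[Biset.{u}] X').one) (g : (Y ⟶[Biset.{u}] Y').one)
    (h : (Z ⟶[Biset.{u}] Z').one) :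
    comp1 (T.tens1 (T.tens1 f g) h) (a X' Y' Z') = comp1 (a X Y Z) (T.tens1 f (T.tens1 g h))
  l_nat0 {X X' : A} (f : (X ⟶[Biset.{u}] X').zero) :
    comp0 (T.tens0 (id0 I) f) (Biset.res _ (l X')) = comp0 (Biset.res _ (l X)) f
  l_nat1 {X X' : A} (f : (X ⟶[Biset.{u}] X').one) :
    comp1 (T.tens1 (id1 I) f) (l X') = comp1 (l X) f
  r_nat0 {X X' : A} (f : (X ⟶[Biset.{u}] X').zero) :
    comp0 (T.tens0 f (id0 I)) (Biset.res _ (r X')) = comp0 (Biset.res _ (r X)) f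
  r_nat1 {X X' : A} (f : (X ⟶[Biset.{u}] X').one) :
    comp1 (T.tens1 f (id1 I)) (r X') = comp1 (r X) f
  b_nat0 {X X' Y Y' : A} (f : (X ⟶[Biset.{u}] X').zero) (g : (Y ⟶[Biset.{u}] Y').zero) :
    comp0 (T.tens0 f g) (Biset.res _ (b X' Y')) = comp0 (Biset.res _ (b X Y)) (T.tens0 g f)
  b_nat1 {X X' Y Y' : A} (f : (X ⟶[Biset.{u}] X').one) (g : (Y ⟶[Biset.{u}] Y').one) :
    comp1 (T.tens1 f g) (b X' Y') = comp1 (b X Y) (T.tens1 g f)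
  pentagon (W X Y Z : A) :
    comp1 (T.tens1 (a W X Y) (id1 Z)) (comp1 (a W (T.obj X Y) Z) (T.tens1 (id1 W) (a X Y Z))) =
      comp1 (a (T.obj W X) Y Z) (a W X (T.obj Y Z))
  triangle (X Y : A) :
    comp1 (a X I Y) (T.tens1 (id1 X) (l Y)) = T.tens1 (r X) (id1 Y)
  hexagon (X Y Z : A) :
    comp1 (a X Y Z) (comp1 (b X (T.obj Y Z)) (a Y Z X)) =
      comp1 (T.tens1 (b X Y) (id1 Z)) (comp1 (a Y X Z) (T.tens1 (id1 Y) (b X Z)))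

namespace SymmetricMonoidalElements

variable {A : Type u₁} [EnrichedCategory Biset.{u} A] {T : TensorBifunctor Biset.{u} A} {I : A}

/-- The symmetric monoidal structure given by its elements. -/
def toStructure (S : SymmetricMonoidalElements T I) : SymmetricMonoidalStructure T I where
  assoc X Y Z := underlyingIso (S.a X Y Z) (S.a' X Y Z) (S.a_a' X Y Z) (S.a'_a X Y Z)
  leftUnit X := underlyingIso (S.l X) (S.l' X) (S.l_l' X) (S.l'_l X)
  rightUnit X := underlyingIso (S.r X) (S.r' X) (S.r_r' X) (S.r'_r X)
  braid X Y := underlyingIso (S.b X Y) (S.b Y X) (S.b_b X Y) (S.b_b Y X)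
  assoc_naturality _ _ _ _ _ _ := Biset.hom_ext (fun p => S.a_nat0 p.1.1 p.1.2 p.2)
    (fun p => S.a_nat1 p.1.1 p.1.2 p.2)
  leftUnit_naturality _ _ := Biset.hom_ext (fun p => S.l_nat0 p) (fun p => S.l_nat1 p)
  rightUnit_naturality _ _ := Biset.hom_ext (fun p => S.r_nat0 p) (fun p => S.r_nat1 p)
  braid_naturality _ _ _ _ := Biset.hom_ext (fun p => S.b_nat0 p.1 p.2)
    (fun p => S.b_nat1 p.1 p.2)
  pentagon W X Y Z := by
    simp only [underlyingIso, ← underlyingHom_id, homTensor_underlyingHom, underlyingHom_comp,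
      S.pentagon]
  triangle X Y := by
    simp only [underlyingIso, ← underlyingHom_id, homTensor_underlyingHom, underlyingHom_comp,
      S.triangle]
  hexagon X Y Z := by
    simp only [underlyingIso, ← underlyingHom_id, homTensor_underlyingHom, underlyingHom_comp,
      S.hexagon]
  symmetry X Y := by
    simp only [underlyingIso, ← underlyingHom_id, underlyingHom_comp, S.b_b]

end SymmetricMonoidalElements

/-! ## Elements of presheaves and of natural transformations -/

section Elements

variable {C : Type u} [EnrichedCategory Biset.{u} C]

namespace Presheaf

/-- The elements of the zero part of a presheaf. -/
abbrev el0 (F : Presheaf C) (X : C) : Type u := (F.obj (op X)).zero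

/-- The elements of the one part of a presheaf. -/
abbrev el1 (F : Presheaf C) (X : C) : Type u := (F.obj (op X)).one

/-- The map from the one part to the zero part of a presheaf. -/
def res (F : Presheaf C) {X : C} (x : F.el1 X) : F.el0 X := (F.obj (op X)).res x

/-- The action of an element of the one part of `C(X, Y)` on the one part of a presheaf. -/
def act (F : Presheaf C) {X Y : C} (f : (X ⟶[Biset.{u}] Y).one) (x : F.el1 Y) : F.el1 X :=
  (F.act1 f).app1 x

theorem act_id (F : Presheaf C) {X : C} (x : F.el1 X) : F.act (id1 X) x = x :=
  congrArg (fun t => Biset.Hom.app1 t x) (F.act1_id X)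

theorem act_comp (F : Presheaf C) {X Y Z : C} (f : (X ⟶[Biset.{u}] Y).one)
    (g : (Y ⟶[Biset.{u}] Z).one) (x : F.el1 Z) :
    F.act (comp1 f g) x = F.act f (F.act g x) :=
  congrArg (fun t => Biset.Hom.app1 t x) (F.act1_comp f g)

theorem res_act (F : Presheaf C) {X Y : C} (f : (X ⟶[Biset.{u}] Y).one) (x : F.el1 Y) :
    F.res (F.act f x) = F.act0 ((X ⟶[Biset.{u}] Y).res f) (F.res x) :=
  ((F.act1 f).comm x).trans (congrFun (F.act1_app0 f) _)

end Presheaf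

variable {F G H : Presheaf C}

/-- The value at an element of an element of the zero part of a hom-biset of presheaves. -/
def ap0 (β : (F ⟶[Biset.{u}] G).zero) {X : C} (x : F.el0 X) : G.el0 X := β.1 (op X) x

/-- The value at an element of a natural transformation. -/
def ap1 (α : (F ⟶[Biset.{u}] G).one) {X : C} (x : F.el1 X) : G.el1 X := (α.1 (op X)).app1 x

theorem ap0_comp (β : (F ⟶[Biset.{u}] G).zero) (γ : (G ⟶[Biset.{u}] H).zero) {X : C}
    (x : F.el0 X) : ap0 (comp0 β γ) x = ap0 γ (ap0 β x) := rfl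

theorem ap1_comp (β : (F ⟶[Biset.{u}] G).one) (γ : (G ⟶[Biset.{u}] H).one) {X : C}
    (x : F.el1 X) : ap1 (comp1 β γ) x = ap1 γ (ap1 β x) := rfl

theorem ap0_id {X : C} (x : F.el0 X) : ap0 (id0 F) x = x := rfl

theorem ap1_id {X : C} (x : F.el1 X) : ap1 (id1 F) x = x := rfl

theorem ap0_act (β : (F ⟶[Biset.{u}] G).zero) {X Y : C} (f : (X ⟶[Biset.{u}] Y).zero)
    (x : F.el0 Y) : ap0 β (F.act0 f x) = G.act0 f (ap0 β x) :=
  congrFun (β.2 (op Y) (op X) f) x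

theorem ap1_act (α : (F ⟶[Biset.{u}] G).one) {X Y : C} (f : (X ⟶[Biset.{u}] Y).one)
    (x : F.el1 Y) : ap1 α (F.act f x) = G.act f (ap1 α x) :=
  congrArg (fun t => Biset.Hom.app1 t x) (α.2.1 (op Y) (op X) f)

theorem res_ap1 (α : (F ⟶[Biset.{u}] G).one) {X : C} (x : F.el1 X) :
    G.res (ap1 α x) = ap0 ((F ⟶[Biset.{u}] G).res α) (F.res x) :=
  (α.1 (op X)).comm x

theorem nat0_ext {β γ : (F ⟶[Biset.{u}] G).zero} (h : ∀ X (x : F.el0 X), ap0 β x = ap0 γ x) :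
    β = γ :=
  Subtype.ext (funext fun X => funext fun x => h (unop X) x)

/-- The values on one parts do not see the elements of `F⁰` outside the image of restriction, hence
the separate hypothesis on zero parts. -/
theorem nat1_ext {β γ : (F ⟶[Biset.{u}] G).one}
    (h0 : (F ⟶[Biset.{u}] G).res β = (F ⟶[Biset.{u}] G).res γ)
    (h1 : ∀ X (x : F.el1 X), ap1 β x = ap1 γ x) : β = γ :=
  Subtype.ext (funext fun X => Biset.hom_ext
    (fun x => congrArg (fun t => ap0 (X := unop X) t x) h0) (fun x => h1 (unop X) x))

/-- An element of the zero part of a hom-biset of presheaves from its values. -/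
def mkNat0 (f : ∀ X, F.el0 X → G.el0 X)
    (hf : ∀ (X Y : C) (g : (X ⟶[Biset.{u}] Y).zero) (x : F.el0 Y),
      f X (F.act0 g x) = G.act0 g (f Y x)) : (F ⟶[Biset.{u}] G).zero :=
  ⟨fun X => f (unop X), fun X Y g => funext fun x => hf (unop Y) (unop X) g x⟩

/-- A natural transformation from its zero part and its values on the one parts. -/
def mkNat1 (β : (F ⟶[Biset.{u}] G).zero) (f : ∀ X, F.el1 X → G.el1 X)
    (hf : ∀ (X Y : C) (g : (X ⟶[Biset.{u}] Y).one) (x : F.el1 Y),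
      f X (F.act g x) = G.act g (f Y x))
    (hres : ∀ X (x : F.el1 X), G.res (f X x) = ap0 β (F.res x)) : (F ⟶[Biset.{u}] G).one :=
  ⟨fun X => Biset.Hom.mk (fun x => ap0 (X := unop X) β x) (f (unop X)) (hres (unop X)),
    fun X Y g => Biset.hom_ext
      (fun x => by
        refine Eq.trans ?_ ((ap0_act β ((unop Y ⟶[Biset.{u}] unop X).res g) x).trans ?_)
        · exact congrArg (ap0 β) (congrFun (F.act1_app0 (X := unop Y) (Y := unop X) g) x)
        · exact (congrFun (G.act1_app0 (X := unop Y) (Y := unop X) g) _).symm)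
      (fun x => hf (unop Y) (unop X) g x),
    β.2⟩

theorem ap0_mkNat0 (f : ∀ X, F.el0 X → G.el0 X) (hf) {X : C} (x : F.el0 X) :
    ap0 (mkNat0 (G := G) f hf) x = f X x := rfl

end Elements

/-! ## The universal property of the reflected Day tensor product -/

section ReflectedTensor

variable {C : Type u} [EnrichedCategory Biset.{u} C] (T : TensorBifunctor Biset.{u} C)

/-- A natural family of functions `F A × G B → W (A ⊗ B)` on the zero parts. -/
structure Bilinear0 (F G W : Presheaf C) where
  app {A B : C} (x : F.el0 A) (y : G.el0 B) : W.el0 (T.obj A B)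
  nat {A A' B B' : C} (f : (A ⟶[Biset.{u}] A').zero) (g : (B ⟶[Biset.{u}] B').zero)
    (x : F.el0 A') (y : G.el0 B') :
    app (F.act0 f x) (G.act0 g y) = W.act0 (T.map0 f g) (app x y)

/-- A natural family of maps of bisets `F A × G B → W (A ⊗ B)`. -/
structure Bilinear1 (F G W : Presheaf C) where
  toBilinear0 : Bilinear0 T F G W
  app {A B : C} (x : F.el1 A) (y : G.el1 B) : W.el1 (T.obj A B)
  nat {A A' B B' : C} (f : (A ⟶[Biset.{u}] A').one) (g : (B ⟶[Biset.{u}] B').one)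
    (x : F.el1 A') (y : G.el1 B') :
    app (F.act f x) (G.act g y) = W.act (T.map1 f g) (app x y)
  res_app {A B : C} (x : F.el1 A) (y : G.el1 B) :
    W.res (app x y) = toBilinear0.app (F.res x) (G.res y)

variable {T} {F G W : Presheaf C}

/-- The map out of the Day tensor product given by a bilinear family, on the zero parts. -/
def Bilinear0.dayDesc (b : Bilinear0 T F G W) : (dayTensorObj T F G ⟶[Biset.{u}] W).zero :=
  mkNat0 (F := dayTensorObj T F G) (fun _ => Quot.lift (fun p => W.act0 p.hom (b.app p.fst p.snd)) (by
    rintro _ _ ⟨f, g, h, x, y⟩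
    -- Naturality of `b` is exactly compatibility with the coend relation.
    simp only [b.nat, W.act0_comp])) (by
    rintro X Y g ⟨p⟩
    exact W.act0_comp g p.hom _)

/-- The map out of the Day tensor product given by a bilinear family. -/
def Bilinear1.dayDesc (b : Bilinear1 T F G W) : (dayTensorObj T F G ⟶[Biset.{u}] W).one :=
  mkNat1 (F := dayTensorObj T F G) b.toBilinear0.dayDesc
    (fun _ => Quot.lift (fun p => W.act p.hom (b.app p.fst p.snd)) (by
      rintro _ _ ⟨f, g, h, x, y⟩
      exact (congrArg (W.act h) (b.nat f g x y)).trans (W.act_comp h _ _).symm)) (by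
    rintro X Y g ⟨p⟩
    exact W.act_comp g p.hom _) (by
    rintro X ⟨p⟩
    exact (W.res_act p.hom _).trans (congrArg (W.act0 _) (b.res_app p.fst p.snd)))

variable {Sm : Presheaf C → Prop} {L : EnrichedFunctor Biset.{u} (Presheaf C) { F // Sm F }}
  (adj : VAdjunction Biset.{u} L (incl Biset.{u} Sm))

namespace VAdjunction

/-- The unit of a reflection. -/
def reflUnit (F : Presheaf C) : (F ⟶[Biset.{u}] (L.obj F).1).one :=
  (adj.homIso F (L.obj F)).hom.app1 (id1 (L.obj F))

/-- Yoneda argument: naturality in the second variable, applied to the identity of `L F`, forces the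
bijection of the adjunction to be composition with the unit. -/
theorem homIso_app0 (F : Presheaf C) (Y : { F // Sm F }) (β : ((L.obj F).1 ⟶[Biset.{u}] Y.1).zero) :
    (adj.homIso F Y).hom.app0 β =
      comp0 ((F ⟶[Biset.{u}] (L.obj F).1).res (adj.reflUnit F)) β := by
  have h := Biset.congr0 (adj.naturality_right F (L.obj F) Y) (id0 (L.obj F), β)
  have h' : comp0 ((adj.homIso F (L.obj F)).hom.app0 (id0 (L.obj F))) β =
    (adj.homIso F Y).hom.app0 (comp0 (X := L.obj F) (id0 (L.obj F)) β) := h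
  rw [id0_comp (X := L.obj F) (Y := Y)] at h'
  rw [← h']
  congr 1
  rw [← res_id]
  exact ((adj.homIso F (L.obj F)).hom.comm _).symm

theorem homIso_app1 (F : Presheaf C) (Y : { F // Sm F }) (β : ((L.obj F).1 ⟶[Biset.{u}] Y.1).one) :
    (adj.homIso F Y).hom.app1 β = comp1 (adj.reflUnit F) β := by
  have h := Biset.congr1 (adj.naturality_right F (L.obj F) Y) (id1 (L.obj F), β)
  have h' : comp1 (adj.reflUnit F) β =
    (adj.homIso F Y).hom.app1 (comp1 (X := L.obj F) (id1 (L.obj F)) β) := h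
  rw [id1_comp (X := L.obj F) (Y := Y)] at h'
  exact h'.symm

/-- Composition with the unit is the bijection of the adjunction, hence injective when the target
lies in `Sm`. -/
theorem reflUnit_ext0 (hW : Sm W)
    {β γ : ((L.obj F).1 ⟶[Biset.{u}] W).zero}
    (h : comp0 ((F ⟶[Biset.{u}] (L.obj F).1).res (adj.reflUnit F)) β =
      comp0 ((F ⟶[Biset.{u}] (L.obj F).1).res (adj.reflUnit F)) γ) : β = γ := by
  have hinv := Biset.congr0 (adj.homIso F ⟨W, hW⟩).hom_inv_id
  refine (hinv β).symm.trans (Eq.trans ?_ (hinv γ))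
  exact congrArg (adj.homIso F ⟨W, hW⟩).inv.app0
    ((adj.homIso_app0 F ⟨W, hW⟩ β).trans (h.trans (adj.homIso_app0 F ⟨W, hW⟩ γ).symm))

theorem reflUnit_ext1 (hW : Sm W) {β γ : ((L.obj F).1 ⟶[Biset.{u}] W).one}
    (h : comp1 (adj.reflUnit F) β = comp1 (adj.reflUnit F) γ) : β = γ := by
  have hinv := Biset.congr1 (adj.homIso F ⟨W, hW⟩).hom_inv_id
  refine (hinv β).symm.trans (Eq.trans ?_ (hinv γ))
  exact congrArg (adj.homIso F ⟨W, hW⟩).inv.app1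
    ((adj.homIso_app1 F ⟨W, hW⟩ β).trans (h.trans (adj.homIso_app1 F ⟨W, hW⟩ γ).symm))

theorem comp0_homIso_inv (hW : Sm W) (β : (F ⟶[Biset.{u}] W).zero) :
    comp0 (Z := W) ((F ⟶[Biset.{u}] (L.obj F).1).res (adj.reflUnit F))
      ((adj.homIso F ⟨W, hW⟩).inv.app0 β) = β :=
  (adj.homIso_app0 F ⟨W, hW⟩ _).symm.trans
    (Biset.congr0 (adj.homIso F ⟨W, hW⟩).inv_hom_id β)

theorem comp1_homIso_inv (hW : Sm W) (β : (F ⟶[Biset.{u}] W).one) :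
    comp1 (Z := W) (adj.reflUnit F) ((adj.homIso F ⟨W, hW⟩).inv.app1 β) = β :=
  (adj.homIso_app1 F ⟨W, hW⟩ _).symm.trans
    (Biset.congr1 (adj.homIso F ⟨W, hW⟩).inv_hom_id β)

/-- Naturality of the unit, read off from naturality in the first variable at an identity. -/
theorem reflUnit_map0 (β : (F ⟶[Biset.{u}] G).zero) :
    comp0 (Z := (L.obj G).1) ((F ⟶[Biset.{u}] (L.obj F).1).res (adj.reflUnit F))
        ((L.map F G).app0 β) =
      comp0 β ((G ⟶[Biset.{u}] (L.obj G).1).res (adj.reflUnit G)) := by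
  have h := Biset.congr0 (adj.naturality_left F G (L.obj G)) (β, id0 (L.obj G))
  have h' : comp0 β ((adj.homIso G (L.obj G)).hom.app0 (id0 (L.obj G))) =
    (adj.homIso F (L.obj G)).hom.app0 (comp0 ((L.map F G).app0 β) (id0 (L.obj G))) := h
  rw [comp0_id, homIso_app0, homIso_app0] at h'
  exact h'.symm

theorem reflUnit_map1 (β : (F ⟶[Biset.{u}] G).one) :
    comp1 (Z := (L.obj G).1) (adj.reflUnit F) ((L.map F G).app1 β) =
      comp1 β (adj.reflUnit G) := by
  have h := Biset.congr1 (adj.naturality_left F G (L.obj G)) (β, id1 (L.obj G))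
  have h' : comp1 β ((adj.homIso G (L.obj G)).hom.app1 (id1 (L.obj G))) =
    (adj.homIso F (L.obj G)).hom.app1 (comp1 ((L.map F G).app1 β) (id1 (L.obj G))) := h
  rw [comp1_id, homIso_app1, homIso_app1] at h'
  exact h'.symm

end VAdjunction

variable (T) (L) in
/-- The reflection of the Day tensor product. -/
def reflTensor (F G : Presheaf C) : Presheaf C := (L.obj (dayTensorObj T F G)).1

theorem reflTensor_mem : Sm (reflTensor T L F G) := (L.obj (dayTensorObj T F G)).2

variable (T)

/-- The universal bilinear family, on the zero parts. -/
def pair0 {A B : C} (x : F.el0 A) (y : G.el0 B) : (reflTensor T L F G).el0 (T.obj A B) :=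
  ap0 (F := dayTensorObj T F G) (G := (L.obj (dayTensorObj T F G)).1)
    (Biset.res _ (adj.reflUnit (dayTensorObj T F G))) (X := T.obj A B)
    (Quot.mk _ (⟨A, B, id0 _, x, y⟩ : DayGen0 T F G (T.obj A B)))

/-- The universal bilinear family, on the one parts. -/
def pair1 {A B : C} (x : F.el1 A) (y : G.el1 B) : (reflTensor T L F G).el1 (T.obj A B) :=
  ap1 (F := dayTensorObj T F G) (adj.reflUnit (dayTensorObj T F G)) (X := T.obj A B)
    (Quot.mk _ (⟨A, B, id1 _, x, y⟩ : DayGen1 T F G (T.obj A B)))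

/-- Every class of the coend is the pullback, along its arrow component, of a class whose arrow is
an identity. Maps out of the Day tensor product are therefore determined by the latter. -/
theorem day_mk0 {X : C} (p : DayGen0 T F G X) :
    (Quot.mk _ p : (dayTensorObj T F G).el0 X) = (dayTensorObj T F G).act0 p.hom
      (Quot.mk _ (⟨p.left, p.right, id0 _, p.fst, p.snd⟩ : DayGen0 T F G _)) :=
  congrArg (fun t => Quot.mk _ (DayGen0.mk p.left p.right t p.fst p.snd)) (comp0_id p.hom).symm

theorem day_mk1 {X : C} (p : DayGen1 T F G X) :
    (Quot.mk _ p : (dayTensorObj T F G).el1 X) = (dayTensorObj T F G).act p.hom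
      (Quot.mk _ (⟨p.left, p.right, id1 _, p.fst, p.snd⟩ : DayGen1 T F G _)) :=
  congrArg (fun t => Quot.mk _ (DayGen1.mk p.left p.right t p.fst p.snd)) (comp1_id p.hom).symm

/-- This is the coend relation at an identity arrow, carried through the unit of the reflection. -/
theorem pair0_act {A A' B B' : C} (f : (A ⟶[Biset.{u}] A').zero)
    (g : (B ⟶[Biset.{u}] B').zero) (x : F.el0 A') (y : G.el0 B') :
    pair0 T adj (F.act0 f x) (G.act0 g y) =
      (reflTensor T L F G).act0 (T.map0 f g) (pair0 T adj x y) := by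
  refine Eq.trans ?_ (ap0_act _ _ _)
  refine congrArg (ap0 _) ?_
  refine (Quot.sound (DayRel0.mk f g (id0 _) x y)).trans ?_
  exact congrArg (fun t => Quot.mk _ (DayGen0.mk A' B' t x y))
    ((id0_comp _).trans (comp0_id _).symm)

theorem pair1_act {A A' B B' : C} (f : (A ⟶[Biset.{u}] A').one)
    (g : (B ⟶[Biset.{u}] B').one) (x : F.el1 A') (y : G.el1 B') :
    pair1 T adj (F.act f x) (G.act g y) =
      (reflTensor T L F G).act (T.map1 f g) (pair1 T adj x y) := by
  refine Eq.trans ?_ (ap1_act _ _ _)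
  refine congrArg (ap1 _) ?_
  refine (Quot.sound (DayRel1.mk f g (id1 _) x y)).trans ?_
  exact congrArg (fun t => Quot.mk _ (DayGen1.mk A' B' t x y))
    ((id1_comp _).trans (comp1_id _).symm)

theorem res_pair {A B : C} (x : F.el1 A) (y : G.el1 B) :
    (reflTensor T L F G).res (pair1 T adj x y) = pair0 T adj (F.res x) (G.res y) := by
  refine (res_ap1 _ _).trans (congrArg (ap0 _) ?_)
  exact congrArg (fun t => Quot.mk _ (DayGen0.mk A B t (F.res x) (G.res y))) (res_id _)

/-- The reflection may add elements that are not pullbacks of products. A target in `Sm` permits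
restriction along the unit to the Day tensor product, where every element is such a pullback. -/
theorem pair_ext0 (hW : Sm W) {β γ : (reflTensor T L F G ⟶[Biset.{u}] W).zero}
    (h : ∀ (A B : C) (x : F.el0 A) (y : G.el0 B),
      ap0 β (pair0 T adj x y) = ap0 γ (pair0 T adj x y)) : β = γ := by
  refine adj.reflUnit_ext0 hW (nat0_ext ?_)
  rintro X ⟨p⟩
  rw [day_mk0]
  refine (ap0_act _ p.hom _).trans (Eq.trans ?_ (ap0_act _ p.hom _).symm)
  exact congrArg _ (h _ _ _ _)

theorem pair_ext1 (hW : Sm W) {β γ : (reflTensor T L F G ⟶[Biset.{u}] W).one}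
    (h0 : (reflTensor T L F G ⟶[Biset.{u}] W).res β = (reflTensor T L F G ⟶[Biset.{u}] W).res γ)
    (h : ∀ (A B : C) (x : F.el1 A) (y : G.el1 B),
      ap1 β (pair1 T adj x y) = ap1 γ (pair1 T adj x y)) : β = γ := by
  refine adj.reflUnit_ext1 hW (nat1_ext ?_ ?_)
  · exact (res_comp _ β).trans ((congrArg _ h0).trans (res_comp _ γ).symm)
  · rintro X ⟨p⟩
    rw [day_mk1]
    refine (ap1_act _ p.hom _).trans (Eq.trans ?_ (ap1_act _ p.hom _).symm)
    exact congrArg _ (h _ _ _ _)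

variable {T}

/-- The map out of the reflected tensor product given by a bilinear family, on the zero parts. -/
def Bilinear0.desc (b : Bilinear0 T F G W) (hW : Sm W) :
    (reflTensor T L F G ⟶[Biset.{u}] W).zero :=
  (adj.homIso _ ⟨W, hW⟩).inv.app0 b.dayDesc

/-- The map out of the reflected tensor product given by a bilinear family. -/
def Bilinear1.desc (b : Bilinear1 T F G W) (hW : Sm W) :
    (reflTensor T L F G ⟶[Biset.{u}] W).one :=
  (adj.homIso _ ⟨W, hW⟩).inv.app1 b.dayDesc

theorem Bilinear0.desc_pair (b : Bilinear0 T F G W) (hW : Sm W) {A B : C} (x : F.el0 A)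
    (y : G.el0 B) : ap0 (b.desc adj hW) (pair0 T adj x y) = b.app x y :=
  (congrArg (fun t => ap0 (F := dayTensorObj T F G) (X := T.obj A B) t
    (Quot.mk _ (⟨A, B, id0 _, x, y⟩ : DayGen0 T F G (T.obj A B))))
    (adj.comp0_homIso_inv hW b.dayDesc)).trans (W.act0_id _ _)

theorem Bilinear1.desc_pair (b : Bilinear1 T F G W) (hW : Sm W) {A B : C} (x : F.el1 A)
    (y : G.el1 B) : ap1 (b.desc adj hW) (pair1 T adj x y) = b.app x y :=
  (congrArg (fun t => ap1 (F := dayTensorObj T F G) (X := T.obj A B) t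
    (Quot.mk _ (⟨A, B, id1 _, x, y⟩ : DayGen1 T F G (T.obj A B))))
    (adj.comp1_homIso_inv hW b.dayDesc)).trans (W.act_id _)

theorem Bilinear1.res_desc (b : Bilinear1 T F G W) (hW : Sm W) :
    (reflTensor T L F G ⟶[Biset.{u}] W).res (b.desc adj hW) = b.toBilinear0.desc adj hW :=
  (adj.homIso _ ⟨W, hW⟩).inv.comm b.dayDesc

variable {F' G' : Presheaf C}

variable (T L) in
/-- Functoriality of the reflected tensor product, on the zero parts. -/
def reflMap0 (β : (F ⟶[Biset.{u}] F').zero) (γ : (G ⟶[Biset.{u}] G').zero) :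
    (reflTensor T L F G ⟶[Biset.{u}] reflTensor T L F' G').zero :=
  (L.map _ _).app0 (((dayTensor T).map F F' G G').app0 (β, γ))

variable (T L) in
/-- Functoriality of the reflected tensor product. -/
def reflMap1 (β : (F ⟶[Biset.{u}] F').one) (γ : (G ⟶[Biset.{u}] G').one) :
    (reflTensor T L F G ⟶[Biset.{u}] reflTensor T L F' G').one :=
  (L.map _ _).app1 (((dayTensor T).map F F' G G').app1 (β, γ))

theorem res_reflMap (β : (F ⟶[Biset.{u}] F').one) (γ : (G ⟶[Biset.{u}] G').one) :
    Biset.res _ (reflMap1 T L β γ) = reflMap0 T L (Biset.res _ β) (Biset.res _ γ) :=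
  ((L.map _ _).comm _).trans
    (congrArg _ (((dayTensor T).map F F' G G').comm (β, γ)))

theorem reflMap0_pair (β : (F ⟶[Biset.{u}] F').zero) (γ : (G ⟶[Biset.{u}] G').zero) {A B : C}
    (x : F.el0 A) (y : G.el0 B) :
    ap0 (reflMap0 T L β γ) (pair0 T adj x y) = pair0 T adj (ap0 β x) (ap0 γ y) :=
  congrArg (fun t => ap0 (F := dayTensorObj T F G) (X := T.obj A B) t
    (Quot.mk _ (⟨A, B, id0 _, x, y⟩ : DayGen0 T F G (T.obj A B))))
    (adj.reflUnit_map0 (((dayTensor T).map F F' G G').app0 (β, γ)))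

theorem reflMap1_pair (β : (F ⟶[Biset.{u}] F').one) (γ : (G ⟶[Biset.{u}] G').one) {A B : C}
    (x : F.el1 A) (y : G.el1 B) :
    ap1 (reflMap1 T L β γ) (pair1 T adj x y) = pair1 T adj (ap1 β x) (ap1 γ y) :=
  congrArg (fun t => ap1 (F := dayTensorObj T F G) (X := T.obj A B) t
    (Quot.mk _ (⟨A, B, id1 _, x, y⟩ : DayGen1 T F G (T.obj A B))))
    (adj.reflUnit_map1 (((dayTensor T).map F F' G G').app1 (β, γ)))

end ReflectedTensor

/-! ## Currying and density -/

section Curry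

variable {C : Type u} [EnrichedCategory Biset.{u} C] (T : TensorBifunctor Biset.{u} C)
  {F G W : Presheaf C}
  {Sm : Presheaf C → Prop} {L : EnrichedFunctor Biset.{u} (Presheaf C) { F // Sm F }}
  (adj : VAdjunction Biset.{u} L (incl Biset.{u} Sm))

/-- Evaluation of an element of the Day internal hom, on the zero parts. -/
def homEval0 {A B : C} (θ : (dayHomObj T G W).el0 A) (y : G.el0 B) : W.el0 (T.obj A B) :=
  ap0 (G := shift T W A) θ y

/-- Evaluation of an element of the Day internal hom. -/
def homEval1 {A B : C} (θ : (dayHomObj T G W).el1 A) (y : G.el1 B) : W.el1 (T.obj A B) :=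
  ap1 (G := shift T W A) θ y

/-- The arrow `f` acts through the shift, `g` through naturality of `θ`, and `f ⊗ g` factors as `f ⊗
1` followed by `1 ⊗ g`. -/
theorem homEval0_act {A A' B B' : C} (f : (A ⟶[Biset.{u}] A').zero)
    (g : (B ⟶[Biset.{u}] B').zero) (θ : (dayHomObj T G W).el0 A') (y : G.el0 B') :
    homEval0 T ((dayHomObj T G W).act0 f θ) (G.act0 g y) =
      W.act0 (T.map0 f g) (homEval0 T θ y) := by
  refine (congrArg (W.act0 (T.map0 f (id0 B))) (ap0_act (G := shift T W A') θ g y)).trans ?_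
  refine (W.act0_comp (T.map0 f (id0 B)) (T.map0 (id0 A') g) _).symm.trans ?_
  rw [← T.map0_comp, id0_comp, comp0_id]
  rfl

theorem homEval1_act {A A' B B' : C} (f : (A ⟶[Biset.{u}] A').one)
    (g : (B ⟶[Biset.{u}] B').one) (θ : (dayHomObj T G W).el1 A') (y : G.el1 B') :
    homEval1 T ((dayHomObj T G W).act f θ) (G.act g y) =
      W.act (T.map1 f g) (homEval1 T θ y) := by
  refine (congrArg (W.act (T.map1 f (id1 B))) (ap1_act (G := shift T W A') θ g y)).trans ?_
  refine (W.act_comp (T.map1 f (id1 B)) (T.map1 (id1 A') g) _).symm.trans ?_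
  rw [← T.map1_comp, id1_comp, comp1_id]
  rfl

theorem res_homEval {A B : C} (θ : (dayHomObj T G W).el1 A) (y : G.el1 B) :
    W.res (homEval1 T θ y) = homEval0 T ((dayHomObj T G W).res θ) (G.res y) :=
  res_ap1 (G := shift T W A) θ y

theorem homEval0_ext {A : C} {θ θ' : (dayHomObj T G W).el0 A}
    (h : ∀ B (y : G.el0 B), homEval0 T θ y = homEval0 T θ' y) : θ = θ' :=
  nat0_ext (G := shift T W A) h

theorem homEval1_ext {A : C} {θ θ' : (dayHomObj T G W).el1 A}
    (h0 : (dayHomObj T G W).res θ = (dayHomObj T G W).res θ')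
    (h : ∀ B (y : G.el1 B), homEval1 T θ y = homEval1 T θ' y) : θ = θ' :=
  nat1_ext (G := shift T W A) h0 h

/-- Used for the naturality squares of the tensor-hom adjunction. The agreement of zero parts
demanded by `nat1_ext` follows from `h0`, because `f` and `g` commute with restriction. -/
theorem hom_ext_dayHom {X : Biset.{u}} {f g : X ⟶ (F ⟶[Biset.{u}] dayHomObj T G W)}
    (h0 : ∀ p (A B : C) (x : F.el0 A) (y : G.el0 B),
      homEval0 T (ap0 (f.app0 p) x) y = homEval0 T (ap0 (g.app0 p) x) y)
    (h1 : ∀ p (A B : C) (x : F.el1 A) (y : G.el1 B),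
      homEval1 T (ap1 (f.app1 p) x) y = homEval1 T (ap1 (g.app1 p) x) y) : f = g := by
  have e0 : ∀ p, f.app0 p = g.app0 p := fun p =>
    nat0_ext fun A x => homEval0_ext T fun B y => h0 p A B x y
  have e1 : ∀ p, Biset.res _ (f.app1 p) = Biset.res _ (g.app1 p) := fun p => by
    rw [f.comm, g.comm, e0]
  exact Biset.hom_ext e0 fun p => nat1_ext (e1 p) fun A x => homEval1_ext T
    (by rw [res_ap1, res_ap1, e1]) fun B y => h1 p A B x y

/-- The element of the internal hom given by a natural family, on the zero parts. -/
def mkHom0 {A : C} (f : ∀ B, G.el0 B → W.el0 (T.obj A B))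
    (hf : ∀ (X Y : C) (g : (X ⟶[Biset.{u}] Y).zero) (y : G.el0 Y),
      f X (G.act0 g y) = W.act0 (T.map0 (id0 A) g) (f Y y)) : (dayHomObj T G W).el0 A :=
  mkNat0 (G := shift T W A) f hf

/-- The element of the internal hom given by a natural family. -/
def mkHom1 {A : C} (θ : (dayHomObj T G W).el0 A) (f : ∀ B, G.el1 B → W.el1 (T.obj A B))
    (hf : ∀ (X Y : C) (g : (X ⟶[Biset.{u}] Y).one) (y : G.el1 Y),
      f X (G.act g y) = W.act (T.map1 (id1 A) g) (f Y y))
    (hres : ∀ B (y : G.el1 B), W.res (f B y) = homEval0 T θ (G.res y)) :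
    (dayHomObj T G W).el1 A :=
  mkNat1 (G := shift T W A) θ f hf hres

/-- Partial application of a bilinear family, on the zero parts. -/
def Bilinear0.partialApp {T} (b : Bilinear0 T F G W) {A : C} (x : F.el0 A) :
    (dayHomObj T G W).el0 A :=
  mkHom0 T (fun _ y => b.app x y) (fun X Y g y => by
    have h := b.nat (id0 A) g x y
    rwa [F.act0_id] at h)

theorem Bilinear0.partialApp_act {T} (b : Bilinear0 T F G W) {A A' : C}
    (f : (A ⟶[Biset.{u}] A').zero) (x : F.el0 A') :
    b.partialApp (F.act0 f x) = (dayHomObj T G W).act0 f (b.partialApp x) :=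
  homEval0_ext T fun Z y => by
    have h := b.nat f (id0 Z) x y
    have h' := homEval0_act T f (id0 Z) (b.partialApp x) y
    rw [G.act0_id] at h h'
    exact h.trans h'.symm

/-- Currying a bilinear family, on the zero parts. -/
def Bilinear0.curry {T} (b : Bilinear0 T F G W) : (F ⟶[Biset.{u}] dayHomObj T G W).zero :=
  mkNat0 (G := dayHomObj T G W) (fun _ x => b.partialApp x) (fun _ _ g x => b.partialApp_act g x)

/-- Partial application of a bilinear family. -/
def Bilinear1.partialApp {T} (b : Bilinear1 T F G W) {A : C} (x : F.el1 A) :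
    (dayHomObj T G W).el1 A :=
  mkHom1 T (b.toBilinear0.partialApp (F.res x)) (fun _ y => b.app x y) (fun X Y g y => by
    have h := b.nat (id1 A) g x y
    rwa [F.act_id] at h) (fun _ y => b.res_app x y)

theorem Bilinear1.partialApp_act {T} (b : Bilinear1 T F G W) {A A' : C}
    (f : (A ⟶[Biset.{u}] A').one) (x : F.el1 A') :
    b.partialApp (F.act f x) = (dayHomObj T G W).act f (b.partialApp x) :=
  homEval1_ext T
    (((congrArg b.toBilinear0.partialApp (F.res_act f x)).trans
      (b.toBilinear0.partialApp_act _ (F.res x))).trans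
        ((dayHomObj T G W).res_act f (b.partialApp x)).symm)
    fun Z y => by
      have h := b.nat f (id1 Z) x y
      have h' := homEval1_act T f (id1 Z) (b.partialApp x) y
      rw [G.act_id] at h h'
      exact h.trans h'.symm

/-- Currying a bilinear family. -/
def Bilinear1.curry {T} (b : Bilinear1 T F G W) : (F ⟶[Biset.{u}] dayHomObj T G W).one :=
  mkNat1 (G := dayHomObj T G W) b.toBilinear0.curry (fun _ x => b.partialApp x)
    (fun _ _ g x => b.partialApp_act g x) (fun _ _ => rfl)

/-- The bilinear family of a map out of the reflected tensor product, on the zero parts. -/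
def pairing0 (β : (reflTensor T L F G ⟶[Biset.{u}] W).zero) : Bilinear0 T F G W where
  app x y := ap0 β (pair0 T adj x y)
  nat f g x y := by rw [pair0_act, ap0_act]

/-- The bilinear family of a map out of the reflected tensor product. -/
def pairing1 (β : (reflTensor T L F G ⟶[Biset.{u}] W).one) : Bilinear1 T F G W where
  toBilinear0 := pairing0 T adj (Biset.res _ β)
  app x y := ap1 β (pair1 T adj x y)
  nat f g x y := by rw [pair1_act, ap1_act]
  res_app x y := by
    rw [res_ap1, res_pair]
    rfl

/-- The bilinear family given by a map into the internal hom, on the zero parts. -/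
def bilinear0 (γ : (F ⟶[Biset.{u}] dayHomObj T G W).zero) : Bilinear0 T F G W where
  app x y := homEval0 T (ap0 γ x) y
  nat f g x y := by rw [ap0_act, homEval0_act]

/-- The bilinear family given by a map into the internal hom. -/
def bilinear1 (γ : (F ⟶[Biset.{u}] dayHomObj T G W).one) : Bilinear1 T F G W where
  toBilinear0 := bilinear0 T (Biset.res _ γ)
  app x y := homEval1 T (ap1 γ x) y
  nat f g x y := by rw [ap1_act, homEval1_act]
  res_app x y := by
    rw [res_homEval, res_ap1]
    rfl

/-- The reflected Day tensor product is left adjoint to the Day internal hom. -/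
def reflTensorHomAdjunction
    (hSm : ∀ G H : { F : Presheaf C // Sm F }, Sm ((dayHom T).obj G.1 H.1)) :
    TensorHomAdjunction ((dayTensor T).reflect (incl Biset.{u} Sm) L)
      ((dayHom T).restrict hSm) where
  homIso X Y Z :=
    -- Both hom-bisets are identified with the biset of bilinear families, by `pairing0`, `pairing1`
    -- on one side and `bilinear0`, `bilinear1` on the other.
    { hom := Biset.Hom.mk (fun β => (pairing0 T adj (F := X.1) (G := Y.1) (W := Z.1) β).curry)
        (fun β => (pairing1 T adj (F := X.1) (G := Y.1) (W := Z.1) β).curry) (fun _ => rfl)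
      inv := Biset.Hom.mk
        (fun γ => (bilinear0 T (F := X.1) (G := Y.1) (W := Z.1) γ).desc adj Z.2)
        (fun γ => (bilinear1 T (F := X.1) (G := Y.1) (W := Z.1) γ).desc adj Z.2)
        (fun γ => Bilinear1.res_desc adj (bilinear1 T (F := X.1) (G := Y.1) (W := Z.1) γ) Z.2)
      hom_inv_id := Biset.hom_ext
        (fun _ => pair_ext0 T adj (F := X.1) (G := Y.1) Z.2 fun _ _ x y =>
          Bilinear0.desc_pair adj _ Z.2 x y)
        (fun _ => pair_ext1 T adj (F := X.1) (G := Y.1) Z.2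
          ((Bilinear1.res_desc adj _ Z.2).trans
            (pair_ext0 T adj (F := X.1) (G := Y.1) Z.2 fun _ _ x y =>
              Bilinear0.desc_pair adj _ Z.2 x y)) fun _ _ x y =>
          Bilinear1.desc_pair adj _ Z.2 x y)
      inv_hom_id := hom_ext_dayHom T (F := X.1) (G := Y.1) (W := Z.1)
        (fun γ _ _ x y => Bilinear0.desc_pair adj
          (bilinear0 T (F := X.1) (G := Y.1) (W := Z.1) γ) Z.2 x y)
        (fun γ _ _ x y => Bilinear1.desc_pair adj
          (bilinear1 T (F := X.1) (G := Y.1) (W := Z.1) γ) Z.2 x y) }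
  naturality_left X' X Y Z := hom_ext_dayHom T (F := X'.1) (G := Y.1) (W := Z.1)
    (fun p _ _ x y => congrArg (ap0 (F := reflTensor T L X.1 Y.1) (G := Z.1) p.2)
      (reflMap0_pair (T := T) adj (F := X'.1) (F' := X.1) p.1 (id0 Y.1) x y).symm)
    (fun p _ _ x y => congrArg (ap1 (F := reflTensor T L X.1 Y.1) (G := Z.1) p.2)
      (reflMap1_pair (T := T) adj (F := X'.1) (F' := X.1) p.1 (id1 Y.1) x y).symm)
  naturality_mid X Y' Y Z := hom_ext_dayHom T (F := X.1) (G := Y'.1) (W := Z.1)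
    (fun p _ _ x y => congrArg (ap0 (F := reflTensor T L X.1 Y.1) (G := Z.1) p.2)
      (reflMap0_pair (T := T) adj (G := Y'.1) (G' := Y.1) (id0 X.1) p.1 x y).symm)
    (fun p _ _ x y => congrArg (ap1 (F := reflTensor T L X.1 Y.1) (G := Z.1) p.2)
      (reflMap1_pair (T := T) adj (G := Y'.1) (G' := Y.1) (id1 X.1) p.1 x y).symm)
  -- Postcomposition acts only on the values of a bilinear family, so the two sides agree by
  -- definition.
  naturality_right X Y _ Z' := hom_ext_dayHom T (F := X.1) (G := Y.1) (W := Z'.1)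
    (fun _ _ _ _ _ => rfl) (fun _ _ _ _ _ => rfl)

/-! ### Density -/

/-- A set of elements of the zero parts of `F` is dense if it determines the elements of the zero
parts of the hom-bisets to presheaves in `Sm`. -/
def Dense0 (Sm : Presheaf C → Prop) (F : Presheaf C) (D : ∀ A, F.el0 A → Prop) : Prop :=
  ∀ ⦃W : Presheaf C⦄, Sm W → ∀ β γ : (F ⟶[Biset.{u}] W).zero,
    (∀ A x, D A x → ap0 β x = ap0 γ x) → β = γ

/-- A set of elements of the one parts of `F` is dense if it determines the natural transformations
to presheaves in `Sm` with given zero part. -/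
def Dense1 (Sm : Presheaf C → Prop) (F : Presheaf C) (D : ∀ A, F.el1 A → Prop) : Prop :=
  ∀ ⦃W : Presheaf C⦄, Sm W → ∀ β γ : (F ⟶[Biset.{u}] W).one,
    Biset.res _ β = Biset.res _ γ → (∀ A x, D A x → ap1 β x = ap1 γ x) → β = γ

theorem dense0_all : Dense0 Sm F (fun _ _ => True) :=
  fun _ _ _ _ h => nat0_ext fun A x => h A x trivial

theorem dense1_all : Dense1 Sm F (fun _ _ => True) :=
  fun _ _ _ _ h0 h => nat1_ext h0 fun A x => h A x trivial

/-- The set of products of elements of two sets, on the zero parts. -/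
inductive Products0 (D : ∀ A, F.el0 A → Prop) (E : ∀ A, G.el0 A → Prop) :
    ∀ A, (reflTensor T L F G).el0 A → Prop
  | mk {A B : C} (x : F.el0 A) (y : G.el0 B) (hx : D A x) (hy : E B y) :
      Products0 D E (T.obj A B) (pair0 T adj x y)

/-- The set of products of elements of two sets, on the one parts. -/
inductive Products1 (D : ∀ A, F.el1 A → Prop) (E : ∀ A, G.el1 A → Prop) :
    ∀ A, (reflTensor T L F G).el1 A → Prop
  | mk {A B : C} (x : F.el1 A) (y : G.el1 B) (hx : D A x) (hy : E B y) :
      Products1 D E (T.obj A B) (pair1 T adj x y)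

variable {T} (hhom : ∀ G H : Presheaf C, Sm H → Sm (dayHomObj T G H))
  (hshift : ∀ (H : Presheaf C) (A : C), Sm H → Sm (shift T H A))

include hhom hshift

/-- Curry twice. A map `F → G ⊸ W` is determined on `D` because `G ⊸ W` lies in `Sm`; its value at
`x` is a map `G → W (A ⊗ -)`, determined on `E` because `W (A ⊗ -)` lies in `Sm`. Both closure
properties are needed. -/
theorem Dense0.prod {D : ∀ A, F.el0 A → Prop} {E : ∀ A, G.el0 A → Prop} (hD : Dense0 Sm F D)
    (hE : Dense0 Sm G E) : Dense0 Sm (reflTensor T L F G) (Products0 T adj D E) := by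
  intro W hW β γ h
  have key : (pairing0 T adj β).curry = (pairing0 T adj γ).curry :=
    hD (hhom G W hW) _ _ fun A x hx => hE (hshift W A hW) _ _ fun B y hy =>
      h _ _ (.mk x y hx hy)
  exact pair_ext0 T adj hW fun A B x y => congrArg (fun t => homEval0 T (ap0 t x) y) key

theorem Dense1.prod {D : ∀ A, F.el1 A → Prop} {E : ∀ A, G.el1 A → Prop} (hD : Dense1 Sm F D)
    (hE : Dense1 Sm G E) : Dense1 Sm (reflTensor T L F G) (Products1 T adj D E) := by
  intro W hW β γ h0 h
  -- `Dense1` compares only maps with a common zero part; for the curried maps this is `h0`,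
  -- curried.
  have e : Biset.res _ (pairing1 T adj β).curry = Biset.res _ (pairing1 T adj γ).curry :=
    congrArg (fun t => (pairing0 T adj t).curry) h0
  have key : (pairing1 T adj β).curry = (pairing1 T adj γ).curry :=
    hD (hhom G W hW) _ _ e fun A x hx => hE (hshift W A hW) _ _
      (congrArg (fun t => ap0 t (F.res x)) e) fun B y hy => h _ _ (.mk x y hx hy)
  exact pair_ext1 T adj hW h0 fun A B x y => congrArg (fun t => homEval1 T (ap1 t x) y) key

end Curry

/-! ## Trilinear families -/

section Trilinear

variable {C : Type u} [EnrichedCategory Biset.{u} C] (T : TensorBifunctor Biset.{u} C)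
  (F G H W : Presheaf C)

/-- A natural family of functions `F A × G B × H D → W ((A ⊗ B) ⊗ D)` on the zero parts. -/
structure TrilinearLeft0 where
  app {A B D : C} (x : F.el0 A) (y : G.el0 B) (z : H.el0 D) : W.el0 (T.obj (T.obj A B) D)
  nat {A A' B B' D D' : C} (f : (A ⟶[Biset.{u}] A').zero) (g : (B ⟶[Biset.{u}] B').zero)
    (h : (D ⟶[Biset.{u}] D').zero) (x : F.el0 A') (y : G.el0 B') (z : H.el0 D') :
    app (F.act0 f x) (G.act0 g y) (H.act0 h z) = W.act0 (T.map0 (T.map0 f g) h) (app x y z)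

/-- A natural family of maps of bisets `F A × G B × H D → W ((A ⊗ B) ⊗ D)`. -/
structure TrilinearLeft1 where
  zero : TrilinearLeft0 T F G H W
  app {A B D : C} (x : F.el1 A) (y : G.el1 B) (z : H.el1 D) : W.el1 (T.obj (T.obj A B) D)
  nat {A A' B B' D D' : C} (f : (A ⟶[Biset.{u}] A').one) (g : (B ⟶[Biset.{u}] B').one)
    (h : (D ⟶[Biset.{u}] D').one) (x : F.el1 A') (y : G.el1 B') (z : H.el1 D') :
    app (F.act f x) (G.act g y) (H.act h z) = W.act (T.map1 (T.map1 f g) h) (app x y z)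
  res_app {A B D : C} (x : F.el1 A) (y : G.el1 B) (z : H.el1 D) :
    W.res (app x y z) = zero.app (F.res x) (G.res y) (H.res z)

/-- A natural family of functions `F A × G B × H D → W (A ⊗ (B ⊗ D))` on the zero parts. -/
structure TrilinearRight0 where
  app {A B D : C} (x : F.el0 A) (y : G.el0 B) (z : H.el0 D) : W.el0 (T.obj A (T.obj B D))
  nat {A A' B B' D D' : C} (f : (A ⟶[Biset.{u}] A').zero) (g : (B ⟶[Biset.{u}] B').zero)
    (h : (D ⟶[Biset.{u}] D').zero) (x : F.el0 A') (y : G.el0 B') (z : H.el0 D') :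
    app (F.act0 f x) (G.act0 g y) (H.act0 h z) = W.act0 (T.map0 f (T.map0 g h)) (app x y z)

/-- A natural family of maps of bisets `F A × G B × H D → W (A ⊗ (B ⊗ D))`. -/
structure TrilinearRight1 where
  zero : TrilinearRight0 T F G H W
  app {A B D : C} (x : F.el1 A) (y : G.el1 B) (z : H.el1 D) : W.el1 (T.obj A (T.obj B D))
  nat {A A' B B' D D' : C} (f : (A ⟶[Biset.{u}] A').one) (g : (B ⟶[Biset.{u}] B').one)
    (h : (D ⟶[Biset.{u}] D').one) (x : F.el1 A') (y : G.el1 B') (z : H.el1 D') :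
    app (F.act f x) (G.act g y) (H.act h z) = W.act (T.map1 f (T.map1 g h)) (app x y z)
  res_app {A B D : C} (x : F.el1 A) (y : G.el1 B) (z : H.el1 D) :
    W.res (app x y z) = zero.app (F.res x) (G.res y) (H.res z)

variable {T F G H W}
  {Sm : Presheaf C → Prop} {L : EnrichedFunctor Biset.{u} (Presheaf C) { F // Sm F }}
  (adj : VAdjunction Biset.{u} L (incl Biset.{u} Sm))
  (hhom : ∀ G H : Presheaf C, Sm H → Sm (dayHomObj T G H))
  (hshift : ∀ (H : Presheaf C) (A : C), Sm H → Sm (shift T H A))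

/-- Partial application of a trilinear family, on the zero parts. -/
def TrilinearLeft0.partialApp (t : TrilinearLeft0 T F G H W) {A B : C} (x : F.el0 A)
    (y : G.el0 B) : (dayHomObj T H W).el0 (T.obj A B) :=
  mkHom0 T (fun _ z => t.app x y z) (fun X Y h z => by
    have e := t.nat (id0 _) (id0 _) h x y z
    rwa [F.act0_id, G.act0_id, T.map0_id] at e)

/-- A trilinear family as a bilinear family with values in the internal hom, on the zero parts. -/
def TrilinearLeft0.toBilinear (t : TrilinearLeft0 T F G H W) :
    Bilinear0 T F G (dayHomObj T H W) where
  app x y := t.partialApp x y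
  nat f g x y := homEval0_ext T fun Z z => by
    have h := t.nat f g (id0 Z) x y z
    have h' := homEval0_act T (T.map0 f g) (id0 Z) (t.partialApp x y) z
    rw [H.act0_id] at h h'
    exact h.trans h'.symm

/-- Partial application of a trilinear family. -/
def TrilinearLeft1.partialApp (t : TrilinearLeft1 T F G H W) {A B : C} (x : F.el1 A)
    (y : G.el1 B) : (dayHomObj T H W).el1 (T.obj A B) :=
  mkHom1 T (t.zero.partialApp (F.res x) (G.res y)) (fun _ z => t.app x y z)
    (fun X Y h z => by
      have e := t.nat (id1 _) (id1 _) h x y z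
      rwa [F.act_id, G.act_id, T.map1_id] at e) (fun _ z => t.res_app x y z)

theorem TrilinearLeft1.res_partialApp (t : TrilinearLeft1 T F G H W) {A B : C} (x : F.el1 A)
    (y : G.el1 B) : (dayHomObj T H W).res (t.partialApp x y) =
      t.zero.toBilinear.app (F.res x) (G.res y) := rfl

/-- A trilinear family as a bilinear family with values in the internal hom. -/
def TrilinearLeft1.toBilinear (t : TrilinearLeft1 T F G H W) :
    Bilinear1 T F G (dayHomObj T H W) where
  toBilinear0 := t.zero.toBilinear
  app x y := t.partialApp x y
  nat f g x y := homEval1_ext T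
    -- Agreement of the restrictions is naturality of the zero part of `t` at the restricted arrows.
    (by rw [t.res_partialApp, F.res_act, G.res_act, t.zero.toBilinear.nat,
      (dayHomObj T H W).res_act, t.res_partialApp, T.res_map])
    fun Z z => by
      have h := t.nat f g (id1 Z) x y z
      have h' := homEval1_act T (T.map1 f g) (id1 Z) (t.partialApp x y) z
      rw [H.act_id] at h h'
      exact h.trans h'.symm
  res_app _ _ := rfl

/-- The map given by a trilinear family, on the zero parts. -/
def TrilinearLeft0.desc (t : TrilinearLeft0 T F G H W) (hW : Sm W) :
    (reflTensor T L (reflTensor T L F G) H ⟶[Biset.{u}] W).zero :=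
  (bilinear0 T (t.toBilinear.desc adj (hhom H W hW))).desc adj hW

/-- The map given by a trilinear family. -/
def TrilinearLeft1.desc (t : TrilinearLeft1 T F G H W) (hW : Sm W) :
    (reflTensor T L (reflTensor T L F G) H ⟶[Biset.{u}] W).one :=
  (bilinear1 T (t.toBilinear.desc adj (hhom H W hW))).desc adj hW

/-- The last variable is curried away: a map out of `(F ⊗ G) ⊗ H` comes from a map `F ⊗ G → H ⊸ W`,
whose target lies in `Sm` by `hhom`. -/
theorem TrilinearLeft0.desc_pair (t : TrilinearLeft0 T F G H W) (hW : Sm W) {A B D : C}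
    (x : F.el0 A) (y : G.el0 B) (z : H.el0 D) :
    ap0 (t.desc adj hhom hW) (pair0 T adj (pair0 T adj x y) z) = t.app x y z :=
  (Bilinear0.desc_pair adj _ hW _ z).trans
    (congrArg (fun θ => homEval0 T θ z) (Bilinear0.desc_pair adj t.toBilinear _ x y))

theorem TrilinearLeft1.desc_pair (t : TrilinearLeft1 T F G H W) (hW : Sm W) {A B D : C}
    (x : F.el1 A) (y : G.el1 B) (z : H.el1 D) :
    ap1 (t.desc adj hhom hW) (pair1 T adj (pair1 T adj x y) z) = t.app x y z :=
  (Bilinear1.desc_pair adj _ hW _ z).trans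
    (congrArg (fun θ => homEval1 T θ z) (Bilinear1.desc_pair adj t.toBilinear _ x y))

theorem TrilinearLeft1.res_desc (t : TrilinearLeft1 T F G H W) (hW : Sm W) :
    Biset.res _ (t.desc adj hhom hW) = t.zero.desc adj hhom hW :=
  (Bilinear1.res_desc adj _ hW).trans
    (congrArg (fun θ => (bilinear0 T θ).desc adj hW) (Bilinear1.res_desc adj t.toBilinear _))

/-- Partial application of a trilinear family, on the zero parts. -/
def TrilinearRight0.partialApp (t : TrilinearRight0 T F G H W) {A : C} (x : F.el0 A) :
    Bilinear0 T G H (shift T W A) where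
  app y z := t.app x y z
  nat g h y z := by
    have e := t.nat (id0 A) g h x y z
    rwa [F.act0_id] at e

/-- Partial application of a trilinear family. -/
def TrilinearRight1.partialApp (t : TrilinearRight1 T F G H W) {A : C} (x : F.el1 A) :
    Bilinear1 T G H (shift T W A) where
  toBilinear0 := t.zero.partialApp (F.res x)
  app y z := t.app x y z
  nat g h y z := by
    have e := t.nat (id1 A) g h x y z
    rwa [F.act_id] at e
  res_app y z := t.res_app x y z

/-- A trilinear family as a map into the internal hom, on the zero parts. -/
def TrilinearRight0.curry (t : TrilinearRight0 T F G H W) (hW : Sm W) :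
    (F ⟶[Biset.{u}] dayHomObj T (reflTensor T L G H) W).zero :=
  mkNat0 (G := dayHomObj T (reflTensor T L G H) W)
    (fun A x => (t.partialApp x).desc adj (hshift W A hW)) (fun X Y f x =>
      -- Naturality in `x` compares two maps from the reflected product of `G` and `H` to `W (X ⊗
      -- -)`. The target lies in `Sm`, so products `y ⊗ z` suffice.
      pair_ext0 T adj (hshift W X hW) fun B D y z => by
        refine (Bilinear0.desc_pair adj (t.partialApp (F.act0 f x)) _ y z).trans ?_
        have h := t.nat f (id0 B) (id0 D) x y z
        rw [G.act0_id, H.act0_id, T.map0_id] at h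
        exact h.trans (congrArg (W.act0 _)
          (Bilinear0.desc_pair adj (t.partialApp x) (hshift W Y hW) y z).symm))

/-- A trilinear family as a map into the internal hom. -/
def TrilinearRight1.curry (t : TrilinearRight1 T F G H W) (hW : Sm W) :
    (F ⟶[Biset.{u}] dayHomObj T (reflTensor T L G H) W).one :=
  mkNat1 (G := dayHomObj T (reflTensor T L G H) W) (t.zero.curry adj hshift hW)
    (fun A x => (t.partialApp x).desc adj (hshift W A hW)) (fun X Y f x =>
      pair_ext1 T adj (hshift W X hW)
        (((Bilinear1.res_desc adj (t.partialApp (F.act f x)) _).trans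
          (congrArg (ap0 (t.zero.curry adj hshift hW)) (F.res_act f x))).trans
          ((ap0_act (t.zero.curry adj hshift hW) _ (F.res x)).trans
            ((congrArg ((dayHomObj T (reflTensor T L G H) W).act0 _)
              (Bilinear1.res_desc adj (t.partialApp x) (hshift W Y hW)).symm).trans
              ((dayHomObj T (reflTensor T L G H) W).res_act f _).symm)))
        fun B D y z => by
          refine (Bilinear1.desc_pair adj (t.partialApp (F.act f x)) _ y z).trans ?_
          have h := t.nat f (id1 B) (id1 D) x y z
          rw [G.act_id, H.act_id, T.map1_id] at h
          exact h.trans (congrArg (W.act _)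
            (Bilinear1.desc_pair adj (t.partialApp x) (hshift W Y hW) y z).symm))
    (fun A x => Bilinear1.res_desc adj (t.partialApp x) (hshift W A hW))

/-- The map given by a trilinear family, on the zero parts. -/
def TrilinearRight0.desc (t : TrilinearRight0 T F G H W) (hW : Sm W) :
    (reflTensor T L F (reflTensor T L G H) ⟶[Biset.{u}] W).zero :=
  (bilinear0 T (t.curry adj hshift hW)).desc adj hW

/-- The map given by a trilinear family. -/
def TrilinearRight1.desc (t : TrilinearRight1 T F G H W) (hW : Sm W) :
    (reflTensor T L F (reflTensor T L G H) ⟶[Biset.{u}] W).one :=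
  (bilinear1 T (t.curry adj hshift hW)).desc adj hW

/-- Here the first variable is fixed: each `x` gives a bilinear family on `G` and `H` with values in
`W (A ⊗ -)`, which lies in `Sm` by `hshift`. -/
theorem TrilinearRight0.desc_pair (t : TrilinearRight0 T F G H W) (hW : Sm W) {A B D : C}
    (x : F.el0 A) (y : G.el0 B) (z : H.el0 D) :
    ap0 (t.desc adj hshift hW) (pair0 T adj x (pair0 T adj y z)) = t.app x y z :=
  (Bilinear0.desc_pair adj _ hW x _).trans
    (Bilinear0.desc_pair adj (t.partialApp x) (hshift W A hW) y z)

theorem TrilinearRight1.desc_pair (t : TrilinearRight1 T F G H W) (hW : Sm W) {A B D : C}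
    (x : F.el1 A) (y : G.el1 B) (z : H.el1 D) :
    ap1 (t.desc adj hshift hW) (pair1 T adj x (pair1 T adj y z)) = t.app x y z :=
  (Bilinear1.desc_pair adj _ hW x _).trans
    (Bilinear1.desc_pair adj (t.partialApp x) (hshift W A hW) y z)

theorem TrilinearRight1.res_desc (t : TrilinearRight1 T F G H W) (hW : Sm W) :
    Biset.res _ (t.desc adj hshift hW) = t.zero.desc adj hshift hW :=
  Bilinear1.res_desc adj _ hW

end Trilinear

/-! ## The symmetric monoidal structure of the reflected Day tensor product -/

section Laws

variable {C : Type u} [EnrichedCategory Biset.{u} C] {T : TensorBifunctor Biset.{u} C} {I : C}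
  (S : SymmetricMonoidalElements T I)

theorem comp0_res_of_comp1 {X Y : C} {f : (X ⟶[Biset.{u}] Y).one} {g : (Y ⟶[Biset.{u}] X).one}
    (h : comp1 f g = id1 X) : comp0 (Biset.res _ f) (Biset.res _ g) = id0 X := by
  rw [← res_comp, h, res_id]

namespace Presheaf

variable (F : Presheaf C)

theorem act_act_of_comp {X Y : C} {f : (X ⟶[Biset.{u}] Y).one} {g : (Y ⟶[Biset.{u}] X).one}
    (h : comp1 f g = id1 X) (x : F.el1 X) : F.act f (F.act g x) = x := by
  rw [← F.act_comp, h, F.act_id]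

theorem act0_act0_of_comp {X Y : C} {f : (X ⟶[Biset.{u}] Y).one}
    {g : (Y ⟶[Biset.{u}] X).one} (h : comp1 f g = id1 X) (x : F.el0 X) :
    F.act0 (Biset.res _ f) (F.act0 (Biset.res _ g) x) = x := by
  rw [← F.act0_comp, comp0_res_of_comp1 h, F.act0_id]

end Presheaf

namespace SymmetricMonoidalElements

/-- Naturality of `S.a`, composed with the inverse at both ends. -/
theorem a'_nat0 {X X' Y Y' Z Z' : C} (f : (X ⟶[Biset.{u}] X').zero)
    (g : (Y ⟶[Biset.{u}] Y').zero) (h : (Z ⟶[Biset.{u}] Z').zero) :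
    comp0 (T.map0 f (T.map0 g h)) (Biset.res _ (S.a' X' Y' Z')) =
      comp0 (Biset.res _ (S.a' X Y Z)) (T.map0 (T.map0 f g) h) := by
  have e := congrArg (fun t => comp0 (Biset.res _ (S.a' X Y Z))
    (comp0 t (Biset.res _ (S.a' X' Y' Z')))) (S.a_nat0 f g h)
  beta_reduce at e
  rw [assoc0, comp0_res_of_comp1 (S.a_a' X' Y' Z'), comp0_id, assoc0, ← assoc0,
    comp0_res_of_comp1 (S.a'_a X Y Z), id0_comp] at e
  exact e.symm

theorem a'_nat1 {X X' Y Y' Z Z' : C} (f : (X ⟶[Biset.{u}] X').one)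
    (g : (Y ⟶[Biset.{u}] Y').one) (h : (Z ⟶[Biset.{u}] Z').one) :
    comp1 (T.map1 f (T.map1 g h)) (S.a' X' Y' Z') =
      comp1 (S.a' X Y Z) (T.map1 (T.map1 f g) h) := by
  have e := congrArg (fun t => comp1 (S.a' X Y Z) (comp1 t (S.a' X' Y' Z'))) (S.a_nat1 f g h)
  beta_reduce at e
  rw [assoc1, S.a_a' X' Y' Z', comp1_id, assoc1, ← assoc1, S.a'_a X Y Z, id1_comp] at e
  exact e.symm

theorem l'_nat0 {X X' : C} (f : (X ⟶[Biset.{u}] X').zero) :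
    comp0 f (Biset.res _ (S.l' X')) = comp0 (Biset.res _ (S.l' X)) (T.map0 (id0 I) f) := by
  have e := congrArg (fun t => comp0 (Biset.res _ (S.l' X)) (comp0 t (Biset.res _ (S.l' X'))))
    (S.l_nat0 f)
  beta_reduce at e
  rw [assoc0, comp0_res_of_comp1 (S.l_l' X'), comp0_id, assoc0, ← assoc0,
    comp0_res_of_comp1 (S.l'_l X), id0_comp] at e
  exact e.symm

theorem l'_nat1 {X X' : C} (f : (X ⟶[Biset.{u}] X').one) :
    comp1 f (S.l' X') = comp1 (S.l' X) (T.map1 (id1 I) f) := by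
  have e := congrArg (fun t => comp1 (S.l' X) (comp1 t (S.l' X'))) (S.l_nat1 f)
  beta_reduce at e
  rw [assoc1, S.l_l' X', comp1_id, assoc1, ← assoc1, S.l'_l X, id1_comp] at e
  exact e.symm

theorem r'_nat0 {X X' : C} (f : (X ⟶[Biset.{u}] X').zero) :
    comp0 f (Biset.res _ (S.r' X')) = comp0 (Biset.res _ (S.r' X)) (T.map0 f (id0 I)) := by
  have e := congrArg (fun t => comp0 (Biset.res _ (S.r' X)) (comp0 t (Biset.res _ (S.r' X'))))
    (S.r_nat0 f)
  beta_reduce at e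
  rw [assoc0, comp0_res_of_comp1 (S.r_r' X'), comp0_id, assoc0, ← assoc0,
    comp0_res_of_comp1 (S.r'_r X), id0_comp] at e
  exact e.symm

theorem r'_nat1 {X X' : C} (f : (X ⟶[Biset.{u}] X').one) :
    comp1 f (S.r' X') = comp1 (S.r' X) (T.map1 f (id1 I)) := by
  have e := congrArg (fun t => comp1 (S.r' X) (comp1 t (S.r' X'))) (S.r_nat1 f)
  beta_reduce at e
  rw [assoc1, S.r_r' X', comp1_id, assoc1, ← assoc1, S.r'_r X, id1_comp] at e
  exact e.symm

variable (F : Presheaf C)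

/-- The coherence laws of `C` in the contravariant form in which they act on elements of presheaves.
Computations with iterated products end in these equations. -/
theorem pentagon_act1 {W X Y Z : C} (x : F.el1 (T.obj W (T.obj X (T.obj Y Z)))) :
    F.act (T.map1 (S.a W X Y) (id1 Z)) (F.act (S.a W (T.obj X Y) Z)
      (F.act (T.map1 (id1 W) (S.a X Y Z)) x)) =
    F.act (S.a (T.obj W X) Y Z) (F.act (S.a W X (T.obj Y Z)) x) := by
  simp only [← F.act_comp]
  exact congrArg (fun t => F.act t x) (S.pentagon W X Y Z)

theorem pentagon_act0 {W X Y Z : C} (x : F.el0 (T.obj W (T.obj X (T.obj Y Z)))) :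
    F.act0 (T.map0 (Biset.res _ (S.a W X Y)) (id0 Z)) (F.act0 (Biset.res _ (S.a W (T.obj X Y) Z))
      (F.act0 (T.map0 (id0 W) (Biset.res _ (S.a X Y Z))) x)) =
    F.act0 (Biset.res _ (S.a (T.obj W X) Y Z))
      (F.act0 (Biset.res _ (S.a W X (T.obj Y Z))) x) := by
  -- Every arrow involved is a restriction, so the law on zero parts is the restricted law on one
  -- parts.
  simp only [← F.act0_comp, ← res_id, ← T.res_map, ← res_comp]
  exact congrArg (fun t => F.act0 (Biset.res _ t) x) (S.pentagon W X Y Z)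

theorem triangle_act1 {X Y : C} (x : F.el1 (T.obj X Y)) :
    F.act (S.a X I Y) (F.act (T.map1 (id1 X) (S.l Y)) x) =
      F.act (T.map1 (S.r X) (id1 Y)) x := by
  simp only [← F.act_comp]
  exact congrArg (fun t => F.act t x) (S.triangle X Y)

theorem triangle_act0 {X Y : C} (x : F.el0 (T.obj X Y)) :
    F.act0 (Biset.res _ (S.a X I Y)) (F.act0 (T.map0 (id0 X) (Biset.res _ (S.l Y))) x) =
      F.act0 (T.map0 (Biset.res _ (S.r X)) (id0 Y)) x := by
  simp only [← F.act0_comp, ← res_id, ← T.res_map, ← res_comp]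
  exact congrArg (fun t => F.act0 (Biset.res _ t) x) (S.triangle X Y)

theorem hexagon_act1 {X Y Z : C} (x : F.el1 (T.obj Y (T.obj Z X))) :
    F.act (S.a X Y Z) (F.act (S.b X (T.obj Y Z)) (F.act (S.a Y Z X) x)) =
      F.act (T.map1 (S.b X Y) (id1 Z)) (F.act (S.a Y X Z)
        (F.act (T.map1 (id1 Y) (S.b X Z)) x)) := by
  simp only [← F.act_comp]
  exact congrArg (fun t => F.act t x) (S.hexagon X Y Z)

theorem hexagon_act0 {X Y Z : C} (x : F.el0 (T.obj Y (T.obj Z X))) :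
    F.act0 (Biset.res _ (S.a X Y Z)) (F.act0 (Biset.res _ (S.b X (T.obj Y Z)))
        (F.act0 (Biset.res _ (S.a Y Z X)) x)) =
      F.act0 (T.map0 (Biset.res _ (S.b X Y)) (id0 Z)) (F.act0 (Biset.res _ (S.a Y X Z))
        (F.act0 (T.map0 (id0 Y) (Biset.res _ (S.b X Z))) x)) := by
  simp only [← F.act0_comp, ← res_id, ← T.res_map, ← res_comp]
  exact congrArg (fun t => F.act0 (Biset.res _ t) x) (S.hexagon X Y Z)

end SymmetricMonoidalElements

namespace Presheaf

/-- An element of the zero part of a representable presheaf as an element of a hom-biset. -/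
def toHom0 {A : C} (x : (yoneda I).el0 A) : (A ⟶[Biset.{u}] I).zero := x

/-- An element of the one part of a representable presheaf as an element of a hom-biset. -/
def toHom1 {A : C} (x : (yoneda I).el1 A) : (A ⟶[Biset.{u}] I).one := x

variable (I) in
/-- The universal element of a representable presheaf, in the zero part. -/
def generic0 : (yoneda I).el0 I := id0 I

variable (I) in
/-- The universal element of a representable presheaf, in the one part. -/
def generic1 : (yoneda I).el1 I := id1 I

theorem toHom0_act {A B : C} (f : (A ⟶[Biset.{u}] B).zero) (x : (yoneda I).el0 B) :
    toHom0 ((yoneda I).act0 f x) = comp0 f (toHom0 x) := rfl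

theorem toHom1_act {A B : C} (f : (A ⟶[Biset.{u}] B).one) (x : (yoneda I).el1 B) :
    toHom1 ((yoneda I).act f x) = comp1 f (toHom1 x) := rfl

theorem res_toHom {A : C} (x : (yoneda I).el1 A) :
    Biset.res _ (toHom1 x) = toHom0 ((yoneda I).res x) := rfl

theorem toHom0_generic : toHom0 (generic0 I) = id0 I := rfl

theorem toHom1_generic : toHom1 (generic1 I) = id1 I := rfl

theorem res_generic : (yoneda I).res (generic1 I) = generic0 I := res_id I

/-- Yoneda: an element `x : A → I` is the pullback of the identity of `I` along itself. -/
theorem act0_toHom_generic {A : C} (x : (yoneda I).el0 A) :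
    (yoneda I).act0 (toHom0 x) (generic0 I) = x := comp0_id (Y := I) _

theorem act_toHom_generic {A : C} (x : (yoneda I).el1 A) :
    (yoneda I).act (toHom1 x) (generic1 I) = x := comp1_id (Y := I) _

end Presheaf

end Laws

/-! ### Structure maps of the reflected tensor product and their values on products. -/

section Reflected

variable {C : Type u} [EnrichedCategory Biset.{u} C] {T : TensorBifunctor Biset.{u} C} {I : C}
  (S : SymmetricMonoidalElements T I)
  {Sm : Presheaf C → Prop} {L : EnrichedFunctor Biset.{u} (Presheaf C) { F // Sm F }}
  (adj : VAdjunction Biset.{u} L (incl Biset.{u} Sm))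
  (hhom : ∀ G H : Presheaf C, Sm H → Sm (dayHomObj T G H))
  (hshift : ∀ (H : Presheaf C) (A : C), Sm H → Sm (shift T H A))
  (F G H : Presheaf C)

-- The one-sided forms let `simp` pull every action out of a product.
variable {F G} in
theorem pair0_act_left {A A' B : C} (f : (A ⟶[Biset.{u}] A').zero) (x : F.el0 A')
    (y : G.el0 B) : pair0 T adj (F.act0 f x) y =
      (reflTensor T L F G).act0 (T.map0 f (id0 B)) (pair0 T adj x y) := by
  rw [← pair0_act, G.act0_id]

variable {F G} in
theorem pair0_act_right {A B B' : C} (f : (B ⟶[Biset.{u}] B').zero) (x : F.el0 A)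
    (y : G.el0 B') : pair0 T adj x (G.act0 f y) =
      (reflTensor T L F G).act0 (T.map0 (id0 A) f) (pair0 T adj x y) := by
  rw [← pair0_act, F.act0_id]

variable {F G} in
theorem pair1_act_left {A A' B : C} (f : (A ⟶[Biset.{u}] A').one) (x : F.el1 A')
    (y : G.el1 B) : pair1 T adj (F.act f x) y =
      (reflTensor T L F G).act (T.map1 f (id1 B)) (pair1 T adj x y) := by
  rw [← pair1_act, G.act_id]

variable {F G} in
theorem pair1_act_right {A B B' : C} (f : (B ⟶[Biset.{u}] B').one) (x : F.el1 A)
    (y : G.el1 B') : pair1 T adj x (G.act f y) =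
      (reflTensor T L F G).act (T.map1 (id1 A) f) (pair1 T adj x y) := by
  rw [← pair1_act, F.act_id]

/-- The braiding as a bilinear family. -/
def braidBilinear : Bilinear1 T F G (reflTensor T L G F) where
  toBilinear0 :=
    -- Presheaves are contravariant: the product `y ⊗ x` lives over `B ⊗ A` and is pulled back along
    -- the braiding `A ⊗ B → B ⊗ A`. The associators and unitors follow the same pattern.
    { app {A B} x y := (reflTensor T L G F).act0 (Biset.res _ (S.b A B)) (pair0 T adj y x)
      nat f g x y := by
        rw [pair0_act, ← Presheaf.act0_comp, ← Presheaf.act0_comp]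
        exact congrArg (fun t => (reflTensor T L G F).act0 t _) (S.b_nat0 f g).symm }
  app {A B} x y := (reflTensor T L G F).act (S.b A B) (pair1 T adj y x)
  nat f g x y := by
    rw [pair1_act, ← Presheaf.act_comp, ← Presheaf.act_comp]
    exact congrArg (fun t => (reflTensor T L G F).act t _) (S.b_nat1 f g).symm
  res_app x y := by rw [Presheaf.res_act, res_pair]

/-- The braiding of the reflected tensor product. -/
def reflBraid : (reflTensor T L F G ⟶[Biset.{u}] reflTensor T L G F).one :=
  (braidBilinear S adj F G).desc adj reflTensor_mem

/-- The associator as a trilinear family. -/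
def assocTrilinear :
    TrilinearLeft1 T F G H (reflTensor T L F (reflTensor T L G H)) where
  zero :=
    { app {A B D} x y z := Presheaf.act0 _ (Biset.res _ (S.a A B D))
        (pair0 T adj x (pair0 T adj y z))
      nat f g h x y z := by
        rw [pair0_act, pair0_act, ← Presheaf.act0_comp, ← Presheaf.act0_comp]
        exact congrArg (fun t => Presheaf.act0 _ t _) (S.a_nat0 f g h).symm }
  app {A B D} x y z := Presheaf.act _ (S.a A B D) (pair1 T adj x (pair1 T adj y z))
  nat f g h x y z := by
    rw [pair1_act, pair1_act, ← Presheaf.act_comp, ← Presheaf.act_comp]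
    exact congrArg (fun t => Presheaf.act _ t _) (S.a_nat1 f g h).symm
  res_app x y z := by rw [Presheaf.res_act, res_pair, res_pair]

/-- The inverse of the associator as a trilinear family. -/
def assocInvTrilinear :
    TrilinearRight1 T F G H (reflTensor T L (reflTensor T L F G) H) where
  zero :=
    { app {A B D} x y z := Presheaf.act0 _ (Biset.res _ (S.a' A B D))
        (pair0 T adj (pair0 T adj x y) z)
      nat f g h x y z := by
        rw [pair0_act, pair0_act, ← Presheaf.act0_comp, ← Presheaf.act0_comp]
        exact congrArg (fun t => Presheaf.act0 _ t _) (S.a'_nat0 f g h).symm }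
  app {A B D} x y z := Presheaf.act _ (S.a' A B D) (pair1 T adj (pair1 T adj x y) z)
  nat f g h x y z := by
    rw [pair1_act, pair1_act, ← Presheaf.act_comp, ← Presheaf.act_comp]
    exact congrArg (fun t => Presheaf.act _ t _) (S.a'_nat1 f g h).symm
  res_app x y z := by rw [Presheaf.res_act, res_pair, res_pair]

/-- The associator of the reflected tensor product. -/
def reflAssoc : (reflTensor T L (reflTensor T L F G) H ⟶[Biset.{u}]
    reflTensor T L F (reflTensor T L G H)).one :=
  (assocTrilinear S adj F G H).desc adj hhom reflTensor_mem

/-- The inverse of the associator of the reflected tensor product. -/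
def reflAssocInv : (reflTensor T L F (reflTensor T L G H) ⟶[Biset.{u}]
    reflTensor T L (reflTensor T L F G) H).one :=
  (assocInvTrilinear S adj F G H).desc adj hshift reflTensor_mem

/-- The left unitor as a bilinear family. -/
def leftUnitBilinear : Bilinear1 T (Presheaf.yoneda I) F F where
  toBilinear0 :=
    -- Since `x` is an arrow `A → I`, the element `y` is pulled back along `A ⊗ B → I ⊗ B → B`.
    { app {A B} x y := F.act0 (T.map0 (Presheaf.toHom0 x) (id0 B)) (F.act0 (Biset.res _ (S.l B)) y)
      nat {A A' B B'} f g x y := by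
        -- Two factorisations of `(x ∘ f) ⊗ g : A ⊗ B → I ⊗ B'`, through `I ⊗ B` and through `A' ⊗
        -- B'`. Naturality of the left unitor of `C` links them.
        have h : T.map0 (comp0 f (Presheaf.toHom0 x)) g = comp0 (T.map0 (comp0 f (Presheaf.toHom0 x)) (id0 B)) (T.map0 (id0 I) g) := by
          rw [← T.map0_comp, comp0_id, id0_comp]
        have h' : T.map0 (comp0 f (Presheaf.toHom0 x)) g = comp0 (T.map0 f g) (T.map0 (Presheaf.toHom0 x) (id0 B')) := by
          rw [← T.map0_comp, comp0_id]
        have e := S.l_nat0 g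
        rw [Presheaf.toHom0_act]
        simp only [← F.act0_comp]
        refine congrArg (fun t => F.act0 t y) ?_
        refine (congrArg (comp0 (T.map0 (comp0 f (Presheaf.toHom0 x)) (id0 B))) e.symm).trans ?_
        rw [← assoc0, ← assoc0, ← h', h] }
  app {A B} x y := F.act (T.map1 (Presheaf.toHom1 x) (id1 B)) (F.act (S.l B) y)
  nat {A A' B B'} f g x y := by
    have h : T.map1 (comp1 f (Presheaf.toHom1 x)) g = comp1 (T.map1 (comp1 f (Presheaf.toHom1 x)) (id1 B)) (T.map1 (id1 I) g) := by
      rw [← T.map1_comp, comp1_id, id1_comp]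
    have h' : T.map1 (comp1 f (Presheaf.toHom1 x)) g = comp1 (T.map1 f g) (T.map1 (Presheaf.toHom1 x) (id1 B')) := by
      rw [← T.map1_comp, comp1_id]
    have e := S.l_nat1 g
    rw [Presheaf.toHom1_act]
    simp only [← F.act_comp]
    refine congrArg (fun t => F.act t y) ?_
    refine (congrArg (comp1 (T.map1 (comp1 f (Presheaf.toHom1 x)) (id1 B))) e.symm).trans ?_
    rw [← assoc1, ← assoc1, ← h', h]
  res_app x y := by
    rw [Presheaf.res_act, Presheaf.res_act, T.res_map, res_id, Presheaf.res_toHom]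

/-- The right unitor as a bilinear family. -/
def rightUnitBilinear : Bilinear1 T F (Presheaf.yoneda I) F where
  toBilinear0 :=
    { app {B A} y x := F.act0 (T.map0 (id0 B) (Presheaf.toHom0 x)) (F.act0 (Biset.res _ (S.r B)) y)
      nat {B B' A A'} g f y x := by
        have h : T.map0 g (comp0 f (Presheaf.toHom0 x)) = comp0 (T.map0 (id0 B) (comp0 f (Presheaf.toHom0 x))) (T.map0 g (id0 I)) := by
          rw [← T.map0_comp, comp0_id, id0_comp]
        have h' : T.map0 g (comp0 f (Presheaf.toHom0 x)) = comp0 (T.map0 g f) (T.map0 (id0 B') (Presheaf.toHom0 x)) := by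
          rw [← T.map0_comp, comp0_id]
        have e := S.r_nat0 g
        rw [Presheaf.toHom0_act]
        simp only [← F.act0_comp]
        refine congrArg (fun t => F.act0 t y) ?_
        refine (congrArg (comp0 (T.map0 (id0 B) (comp0 f (Presheaf.toHom0 x)))) e.symm).trans ?_
        rw [← assoc0, ← assoc0, ← h', h] }
  app {B A} y x := F.act (T.map1 (id1 B) (Presheaf.toHom1 x)) (F.act (S.r B) y)
  nat {B B' A A'} g f y x := by
    have h : T.map1 g (comp1 f (Presheaf.toHom1 x)) = comp1 (T.map1 (id1 B) (comp1 f (Presheaf.toHom1 x))) (T.map1 g (id1 I)) := by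
      rw [← T.map1_comp, comp1_id, id1_comp]
    have h' : T.map1 g (comp1 f (Presheaf.toHom1 x)) = comp1 (T.map1 g f) (T.map1 (id1 B') (Presheaf.toHom1 x)) := by
      rw [← T.map1_comp, comp1_id]
    have e := S.r_nat1 g
    rw [Presheaf.toHom1_act]
    simp only [← F.act_comp]
    refine congrArg (fun t => F.act t y) ?_
    refine (congrArg (comp1 (T.map1 (id1 B) (comp1 f (Presheaf.toHom1 x)))) e.symm).trans ?_
    rw [← assoc1, ← assoc1, ← h', h]
  res_app x y := by
    rw [Presheaf.res_act, Presheaf.res_act, T.res_map, res_id, Presheaf.res_toHom]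

variable {F} in
/-- The left unitor of the reflected tensor product. -/
def reflLeftUnit (hF : Sm F) : (reflTensor T L (Presheaf.yoneda I) F ⟶[Biset.{u}] F).one :=
  (leftUnitBilinear S F).desc adj hF

variable {F} in
/-- The right unitor of the reflected tensor product. -/
def reflRightUnit (hF : Sm F) : (reflTensor T L F (Presheaf.yoneda I) ⟶[Biset.{u}] F).one :=
  (rightUnitBilinear S F).desc adj hF

/-- The inverse of the left unitor of the reflected tensor product. -/
def reflLeftUnitInv : (F ⟶[Biset.{u}] reflTensor T L (Presheaf.yoneda I) F).one :=
  -- The element `x` goes to the product of the universal element of `C(-, I)` with `x`, pulled back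
  -- along `A → I ⊗ A`. The source is `F` itself, so an explicit formula suffices.
  mkNat1 (mkNat0 (fun A x => Presheaf.act0 _ (Biset.res _ (S.l' A))
      (pair0 T adj (Presheaf.generic0 I) x)) (fun X Y g x => by
        rw [pair0_act_right, ← Presheaf.act0_comp, ← Presheaf.act0_comp, S.l'_nat0]))
    (fun A x => Presheaf.act _ (S.l' A)
      (pair1 T adj (Presheaf.generic1 I) x)) (fun X Y g x => by
        rw [pair1_act_right, ← Presheaf.act_comp, ← Presheaf.act_comp, S.l'_nat1])
    (fun X x => by
      rw [Presheaf.res_act, res_pair, ap0_mkNat0, Presheaf.res_generic])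

/-- The inverse of the right unitor of the reflected tensor product. -/
def reflRightUnitInv : (F ⟶[Biset.{u}] reflTensor T L F (Presheaf.yoneda I)).one :=
  mkNat1 (mkNat0 (fun A x => Presheaf.act0 _ (Biset.res _ (S.r' A))
      (pair0 T adj x (Presheaf.generic0 I))) (fun X Y g x => by
        rw [pair0_act_left, ← Presheaf.act0_comp, ← Presheaf.act0_comp, S.r'_nat0]))
    (fun A x => Presheaf.act _ (S.r' A)
      (pair1 T adj x (Presheaf.generic1 I))) (fun X Y g x => by
        rw [pair1_act_left, ← Presheaf.act_comp, ← Presheaf.act_comp, S.r'_nat1])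
    (fun X x => by
      rw [Presheaf.res_act, res_pair, ap0_mkNat0, Presheaf.res_generic])

variable {F G H}

theorem ap0_reflBraid {A B : C} (x : F.el0 A) (y : G.el0 B) :
    ap0 (Biset.res _ (reflBraid S adj F G)) (pair0 T adj x y) =
      (reflTensor T L G F).act0 (Biset.res _ (S.b A B)) (pair0 T adj y x) :=
  (congrArg (fun t => ap0 t (pair0 T adj x y)) (Bilinear1.res_desc adj _ _)).trans
    (Bilinear0.desc_pair adj (braidBilinear S adj F G).toBilinear0 _ x y)

theorem ap1_reflBraid {A B : C} (x : F.el1 A) (y : G.el1 B) :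
    ap1 (reflBraid S adj F G) (pair1 T adj x y) =
      (reflTensor T L G F).act (S.b A B) (pair1 T adj y x) :=
  Bilinear1.desc_pair adj (braidBilinear S adj F G) _ x y

theorem ap0_reflAssoc {A B D : C} (x : F.el0 A) (y : G.el0 B) (z : H.el0 D) :
    ap0 (Biset.res _ (reflAssoc S adj hhom F G H)) (pair0 T adj (pair0 T adj x y) z) =
      Presheaf.act0 _ (Biset.res _ (S.a A B D)) (pair0 T adj x (pair0 T adj y z)) :=
  (congrArg (fun t => ap0 t (pair0 T adj (pair0 T adj x y) z))
    (TrilinearLeft1.res_desc adj hhom _ _)).trans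
    (TrilinearLeft0.desc_pair adj hhom (assocTrilinear S adj F G H).zero _ x y z)

theorem ap1_reflAssoc {A B D : C} (x : F.el1 A) (y : G.el1 B) (z : H.el1 D) :
    ap1 (reflAssoc S adj hhom F G H) (pair1 T adj (pair1 T adj x y) z) =
      Presheaf.act _ (S.a A B D) (pair1 T adj x (pair1 T adj y z)) :=
  TrilinearLeft1.desc_pair adj hhom (assocTrilinear S adj F G H) _ x y z

theorem ap0_reflAssocInv {A B D : C} (x : F.el0 A) (y : G.el0 B) (z : H.el0 D) :
    ap0 (Biset.res _ (reflAssocInv S adj hshift F G H)) (pair0 T adj x (pair0 T adj y z)) =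
      Presheaf.act0 _ (Biset.res _ (S.a' A B D)) (pair0 T adj (pair0 T adj x y) z) :=
  (congrArg (fun t => ap0 t (pair0 T adj x (pair0 T adj y z)))
    (TrilinearRight1.res_desc adj hshift _ _)).trans
    (TrilinearRight0.desc_pair adj hshift (assocInvTrilinear S adj F G H).zero _ x y z)

theorem ap1_reflAssocInv {A B D : C} (x : F.el1 A) (y : G.el1 B) (z : H.el1 D) :
    ap1 (reflAssocInv S adj hshift F G H) (pair1 T adj x (pair1 T adj y z)) =
      Presheaf.act _ (S.a' A B D) (pair1 T adj (pair1 T adj x y) z) :=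
  TrilinearRight1.desc_pair adj hshift (assocInvTrilinear S adj F G H) _ x y z

theorem ap0_reflLeftUnit (hF : Sm F) {A B : C} (x : (Presheaf.yoneda I).el0 A) (y : F.el0 B) :
    ap0 (Biset.res _ (reflLeftUnit S adj hF))
        (pair0 T adj x y) =
      F.act0 (T.map0 (Presheaf.toHom0 x) (id0 B)) (F.act0 (Biset.res _ (S.l B)) y) :=
  (congrArg (fun t => ap0 t (pair0 T adj x y))
    (Bilinear1.res_desc adj _ hF)).trans
    (Bilinear0.desc_pair adj (leftUnitBilinear S F).toBilinear0 _ x y)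

theorem ap1_reflLeftUnit (hF : Sm F) {A B : C} (x : (Presheaf.yoneda I).el1 A) (y : F.el1 B) :
    ap1 (reflLeftUnit S adj hF) (pair1 T adj x y) =
      F.act (T.map1 (Presheaf.toHom1 x) (id1 B)) (F.act (S.l B) y) :=
  Bilinear1.desc_pair adj (leftUnitBilinear S F) _ x y

theorem ap0_reflRightUnit (hF : Sm F) {A B : C} (x : (Presheaf.yoneda I).el0 B) (y : F.el0 A) :
    ap0 (Biset.res _ (reflRightUnit S adj hF))
        (pair0 T adj y x) =
      F.act0 (T.map0 (id0 A) (Presheaf.toHom0 x)) (F.act0 (Biset.res _ (S.r A)) y) :=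
  (congrArg (fun t => ap0 t (pair0 T adj y x))
    (Bilinear1.res_desc adj _ hF)).trans
    (Bilinear0.desc_pair adj (rightUnitBilinear S F).toBilinear0 _ y x)

theorem ap1_reflRightUnit (hF : Sm F) {A B : C} (x : (Presheaf.yoneda I).el1 B) (y : F.el1 A) :
    ap1 (reflRightUnit S adj hF) (pair1 T adj y x) =
      F.act (T.map1 (id1 A) (Presheaf.toHom1 x)) (F.act (S.r A) y) :=
  Bilinear1.desc_pair adj (rightUnitBilinear S F) _ y x

theorem ap0_reflLeftUnitInv {A : C} (x : F.el0 A) :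
    ap0 (Biset.res _ (reflLeftUnitInv S adj F)) x = Presheaf.act0 _ (Biset.res _ (S.l' A))
      (pair0 T adj (Presheaf.generic0 I) x) := rfl

theorem ap1_reflLeftUnitInv {A : C} (x : F.el1 A) :
    ap1 (reflLeftUnitInv S adj F) x = Presheaf.act _ (S.l' A)
      (pair1 T adj (Presheaf.generic1 I) x) := rfl

theorem ap0_reflRightUnitInv {A : C} (x : F.el0 A) :
    ap0 (Biset.res _ (reflRightUnitInv S adj F)) x = Presheaf.act0 _ (Biset.res _ (S.r' A))
      (pair0 T adj x (Presheaf.generic0 I)) := rfl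

theorem ap1_reflRightUnitInv {A : C} (x : F.el1 A) :
    ap1 (reflRightUnitInv S adj F) x = Presheaf.act _ (S.r' A)
      (pair1 T adj x (Presheaf.generic1 I)) := rfl

end Reflected

/-! ### Laws of the reflected tensor product, checked on dense sets of products. -/

section ReflectedStructure

variable {C : Type u} [EnrichedCategory Biset.{u} C] {T : TensorBifunctor Biset.{u} C} {I : C}
  (S : SymmetricMonoidalElements T I)
  {Sm : Presheaf C → Prop} {L : EnrichedFunctor Biset.{u} (Presheaf C) { F // Sm F }}
  (adj : VAdjunction Biset.{u} L (incl Biset.{u} Sm))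
  (hhom : ∀ G H : Presheaf C, Sm H → Sm (dayHomObj T G H))
  (hshift : ∀ (H : Presheaf C) (A : C), Sm H → Sm (shift T H A))
  {F F' G G' H H' W : Presheaf C}

/-- The dense set in the zero parts settles the restrictions, which is what density in the one parts
presupposes. -/
theorem Dense0.ext_one (hW : Sm W) {D : ∀ A, F.el0 A → Prop} {E : ∀ A, F.el1 A → Prop}
    (hD : Dense0 Sm F D) (hE : Dense1 Sm F E) {β γ : (F ⟶[Biset.{u}] W).one}
    (h0 : ∀ A x, D A x → ap0 (Biset.res _ β) x = ap0 (Biset.res _ γ) x)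
    (h1 : ∀ A x, E A x → ap1 β x = ap1 γ x) : β = γ :=
  hE hW β γ (hD hW _ _ h0) h1

variable (I) in
/-- The universal element of a representable presheaf as a set of elements of the zero parts. -/
inductive Generic0 : ∀ A, (Presheaf.yoneda I).el0 A → Prop
  | mk : Generic0 I (Presheaf.generic0 I)

variable (I) in
/-- The universal element of a representable presheaf as a set of elements of the one parts. -/
inductive Generic1 : ∀ A, (Presheaf.yoneda I).el1 A → Prop
  | mk : Generic1 I (Presheaf.generic1 I)

/-- Yoneda lemma. Testing a unit factor only at its universal element replaces an arbitrary arrow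
into `I` by the identity, which simplifies the triangle law. -/
theorem dense0_generic : Dense0 Sm (Presheaf.yoneda I) (Generic0 I) :=
  fun _ _ β γ h => nat0_ext fun A x => by
    rw [← Presheaf.act0_toHom_generic x, ap0_act, ap0_act, h I _ .mk]

theorem dense1_generic : Dense1 Sm (Presheaf.yoneda I) (Generic1 I) :=
  fun _ _ β γ h0 h => nat1_ext h0 fun A x => by
    rw [← Presheaf.act_toHom_generic x, ap1_act, ap1_act, h I _ .mk]

theorem reflBraid_symmetry :
    comp1 (reflBraid S adj F G) (reflBraid S adj G F) = id1 (reflTensor T L F G) := by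
  refine pair_ext1 T adj reflTensor_mem (pair_ext0 T adj reflTensor_mem ?_) ?_
  · intro A B x y
    rw [res_comp, res_id, ap0_comp, ap0_id, ap0_reflBraid, ap0_act, ap0_reflBraid,
      Presheaf.act0_act0_of_comp _ (S.b_b _ _)]
  · intro A B x y
    rw [ap1_comp, ap1_id, ap1_reflBraid, ap1_act, ap1_reflBraid,
      Presheaf.act_act_of_comp _ (S.b_b _ _)]

theorem reflBraid_naturality0 (β : (F ⟶[Biset.{u}] F').zero) (γ : (G ⟶[Biset.{u}] G').zero) :
    comp0 (reflMap0 T L β γ) (Biset.res _ (reflBraid S adj F' G')) =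
      comp0 (Biset.res _ (reflBraid S adj F G)) (reflMap0 T L γ β) := by
  refine pair_ext0 T adj reflTensor_mem fun A B x y => ?_
  rw [ap0_comp, ap0_comp, reflMap0_pair, ap0_reflBraid, ap0_reflBraid, ap0_act, reflMap0_pair]

theorem reflBraid_naturality1 (β : (F ⟶[Biset.{u}] F').one) (γ : (G ⟶[Biset.{u}] G').one) :
    comp1 (reflMap1 T L β γ) (reflBraid S adj F' G') =
      comp1 (reflBraid S adj F G) (reflMap1 T L γ β) := by
  refine pair_ext1 T adj reflTensor_mem ?_ fun A B x y => ?_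
  · rw [res_comp, res_comp, res_reflMap, res_reflMap, reflBraid_naturality0]
  · rw [ap1_comp, ap1_comp, reflMap1_pair, ap1_reflBraid, ap1_reflBraid, ap1_act, reflMap1_pair]

theorem reflLeftUnit_inv (hF : Sm F) :
    comp1 (reflLeftUnit S adj hF) (reflLeftUnitInv S adj F) =
      id1 (reflTensor T L (Presheaf.yoneda I) F) := by
  refine pair_ext1 T adj reflTensor_mem (pair_ext0 T adj reflTensor_mem ?_) ?_
  · intro A B x y
    rw [res_comp, res_id, ap0_comp, ap0_id, ap0_reflLeftUnit, ap0_act, ap0_act,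
      ap0_reflLeftUnitInv, Presheaf.act0_act0_of_comp _ (S.l_l' _), ← pair0_act_left,
      Presheaf.act0_toHom_generic]
  · intro A B x y
    rw [ap1_comp, ap1_id, ap1_reflLeftUnit, ap1_act, ap1_act,
      ap1_reflLeftUnitInv, Presheaf.act_act_of_comp _ (S.l_l' _), ← pair1_act_left,
      Presheaf.act_toHom_generic]

theorem reflLeftUnitInv_hom (hF : Sm F) :
    comp1 (reflLeftUnitInv S adj F) (reflLeftUnit S adj hF) = id1 F := by
  refine nat1_ext (nat0_ext fun A x => ?_) fun A x => ?_
  · rw [res_comp, res_id, ap0_comp, ap0_id, ap0_reflLeftUnitInv, ap0_act, ap0_reflLeftUnit,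
      Presheaf.toHom0_generic, T.map0_id, F.act0_id, Presheaf.act0_act0_of_comp _ (S.l'_l _)]
  · rw [ap1_comp, ap1_id, ap1_reflLeftUnitInv, ap1_act, ap1_reflLeftUnit,
      Presheaf.toHom1_generic, T.map1_id, F.act_id, Presheaf.act_act_of_comp _ (S.l'_l _)]

theorem reflRightUnit_inv (hF : Sm F) :
    comp1 (reflRightUnit S adj hF) (reflRightUnitInv S adj F) =
      id1 (reflTensor T L F (Presheaf.yoneda I)) := by
  refine pair_ext1 T adj reflTensor_mem (pair_ext0 T adj reflTensor_mem ?_) ?_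
  · intro A B x y
    rw [res_comp, res_id, ap0_comp, ap0_id, ap0_reflRightUnit, ap0_act, ap0_act,
      ap0_reflRightUnitInv, Presheaf.act0_act0_of_comp _ (S.r_r' _), ← pair0_act_right,
      Presheaf.act0_toHom_generic]
  · intro A B x y
    rw [ap1_comp, ap1_id, ap1_reflRightUnit, ap1_act, ap1_act,
      ap1_reflRightUnitInv, Presheaf.act_act_of_comp _ (S.r_r' _), ← pair1_act_right,
      Presheaf.act_toHom_generic]

theorem reflRightUnitInv_hom (hF : Sm F) :
    comp1 (reflRightUnitInv S adj F) (reflRightUnit S adj hF) = id1 F := by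
  refine nat1_ext (nat0_ext fun A x => ?_) fun A x => ?_
  · rw [res_comp, res_id, ap0_comp, ap0_id, ap0_reflRightUnitInv, ap0_act, ap0_reflRightUnit,
      Presheaf.toHom0_generic, T.map0_id, F.act0_id, Presheaf.act0_act0_of_comp _ (S.r'_r _)]
  · rw [ap1_comp, ap1_id, ap1_reflRightUnitInv, ap1_act, ap1_reflRightUnit,
      Presheaf.toHom1_generic, T.map1_id, F.act_id, Presheaf.act_act_of_comp _ (S.r'_r _)]

theorem reflLeftUnit_naturality0 (hF : Sm F) (hF' : Sm F') (β : (F ⟶[Biset.{u}] F').zero) :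
    comp0 (reflMap0 T L (id0 (Presheaf.yoneda I)) β) (Biset.res _ (reflLeftUnit S adj hF')) =
      comp0 (Biset.res _ (reflLeftUnit S adj hF)) β := by
  refine pair_ext0 T adj hF' fun A B x y => ?_
  rw [ap0_comp, ap0_comp, reflMap0_pair, ap0_id, ap0_reflLeftUnit, ap0_reflLeftUnit, ap0_act,
    ap0_act]

theorem reflLeftUnit_naturality1 (hF : Sm F) (hF' : Sm F') (β : (F ⟶[Biset.{u}] F').one) :
    comp1 (reflMap1 T L (id1 (Presheaf.yoneda I)) β) (reflLeftUnit S adj hF') =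
      comp1 (reflLeftUnit S adj hF) β := by
  refine pair_ext1 T adj hF' ?_ fun A B x y => ?_
  · rw [res_comp, res_comp, res_reflMap, res_id, reflLeftUnit_naturality0]
  · rw [ap1_comp, ap1_comp, reflMap1_pair, ap1_id, ap1_reflLeftUnit, ap1_reflLeftUnit, ap1_act,
      ap1_act]

theorem reflRightUnit_naturality0 (hF : Sm F) (hF' : Sm F') (β : (F ⟶[Biset.{u}] F').zero) :
    comp0 (reflMap0 T L β (id0 (Presheaf.yoneda I))) (Biset.res _ (reflRightUnit S adj hF')) =
      comp0 (Biset.res _ (reflRightUnit S adj hF)) β := by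
  refine pair_ext0 T adj hF' fun A B x y => ?_
  rw [ap0_comp, ap0_comp, reflMap0_pair, ap0_id, ap0_reflRightUnit, ap0_reflRightUnit, ap0_act,
    ap0_act]

theorem reflRightUnit_naturality1 (hF : Sm F) (hF' : Sm F') (β : (F ⟶[Biset.{u}] F').one) :
    comp1 (reflMap1 T L β (id1 (Presheaf.yoneda I))) (reflRightUnit S adj hF') =
      comp1 (reflRightUnit S adj hF) β := by
  refine pair_ext1 T adj hF' ?_ fun A B x y => ?_
  · rw [res_comp, res_comp, res_reflMap, res_id, reflRightUnit_naturality0]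
  · rw [ap1_comp, ap1_comp, reflMap1_pair, ap1_id, ap1_reflRightUnit, ap1_reflRightUnit, ap1_act,
      ap1_act]

-- On a product `(x ⊗ y) ⊗ z` the composite pulls back along the associator of `C` and along its
-- inverse, and these cancel.
include hshift in
theorem reflAssoc_inv :
    comp1 (reflAssoc S adj hhom F G H) (reflAssocInv S adj hshift F G H) =
      id1 (reflTensor T L (reflTensor T L F G) H) := by
  refine Dense0.ext_one reflTensor_mem
    (Dense0.prod adj hhom hshift (Dense0.prod adj hhom hshift dense0_all dense0_all) dense0_all)
    (Dense1.prod adj hhom hshift (Dense1.prod adj hhom hshift dense1_all dense1_all) dense1_all)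
    ?_ ?_
  · rintro _ _ ⟨_, z, ⟨x, y, -, -⟩, -⟩
    rw [res_comp, res_id, ap0_comp, ap0_id, ap0_reflAssoc, ap0_act, ap0_reflAssocInv,
      Presheaf.act0_act0_of_comp _ (S.a_a' _ _ _)]
  · rintro _ _ ⟨_, z, ⟨x, y, -, -⟩, -⟩
    rw [ap1_comp, ap1_id, ap1_reflAssoc, ap1_act, ap1_reflAssocInv,
      Presheaf.act_act_of_comp _ (S.a_a' _ _ _)]

include hhom in
theorem reflAssocInv_hom :
    comp1 (reflAssocInv S adj hshift F G H) (reflAssoc S adj hhom F G H) =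
      id1 (reflTensor T L F (reflTensor T L G H)) := by
  refine Dense0.ext_one reflTensor_mem
    (Dense0.prod adj hhom hshift dense0_all (Dense0.prod adj hhom hshift dense0_all dense0_all))
    (Dense1.prod adj hhom hshift dense1_all (Dense1.prod adj hhom hshift dense1_all dense1_all))
    ?_ ?_
  · rintro _ _ ⟨x, _, -, ⟨y, z, -, -⟩⟩
    rw [res_comp, res_id, ap0_comp, ap0_id, ap0_reflAssocInv, ap0_act, ap0_reflAssoc,
      Presheaf.act0_act0_of_comp _ (S.a'_a _ _ _)]
  · rintro _ _ ⟨x, _, -, ⟨y, z, -, -⟩⟩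
    rw [ap1_comp, ap1_id, ap1_reflAssocInv, ap1_act, ap1_reflAssoc,
      Presheaf.act_act_of_comp _ (S.a'_a _ _ _)]

include hshift

theorem reflAssoc_naturality0 (β : (F ⟶[Biset.{u}] F').zero) (γ : (G ⟶[Biset.{u}] G').zero)
    (δ : (H ⟶[Biset.{u}] H').zero) :
    comp0 (reflMap0 T L (reflMap0 T L β γ) δ) (Biset.res _ (reflAssoc S adj hhom F' G' H')) =
      comp0 (Biset.res _ (reflAssoc S adj hhom F G H))
        (reflMap0 T L β (reflMap0 T L γ δ)) := by
  refine Dense0.prod adj hhom hshift (Dense0.prod adj hhom hshift dense0_all dense0_all)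
    dense0_all reflTensor_mem _ _ ?_
  rintro _ _ ⟨_, z, ⟨x, y, -, -⟩, -⟩
  rw [ap0_comp, ap0_comp, reflMap0_pair, reflMap0_pair, ap0_reflAssoc, ap0_reflAssoc, ap0_act,
    reflMap0_pair, reflMap0_pair]

theorem reflAssoc_naturality1 (β : (F ⟶[Biset.{u}] F').one) (γ : (G ⟶[Biset.{u}] G').one)
    (δ : (H ⟶[Biset.{u}] H').one) :
    comp1 (reflMap1 T L (reflMap1 T L β γ) δ) (reflAssoc S adj hhom F' G' H') =
      comp1 (reflAssoc S adj hhom F G H) (reflMap1 T L β (reflMap1 T L γ δ)) := by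
  refine Dense1.prod adj hhom hshift (Dense1.prod adj hhom hshift dense1_all dense1_all)
    dense1_all reflTensor_mem _ _ ?_ ?_
  · rw [res_comp, res_comp, res_reflMap, res_reflMap, res_reflMap, res_reflMap,
      reflAssoc_naturality0 S adj hhom hshift]
  · rintro _ _ ⟨_, z, ⟨x, y, -, -⟩, -⟩
    rw [ap1_comp, ap1_comp, reflMap1_pair, reflMap1_pair, ap1_reflAssoc, ap1_reflAssoc, ap1_act,
      reflMap1_pair, reflMap1_pair]

/-- On `((w ⊗ x) ⊗ y) ⊗ z` both sides are pullbacks of `w ⊗ (x ⊗ (y ⊗ z))`, along the two sides of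
the pentagon in `C`. -/
theorem reflTensor_pentagon :
    comp1 (reflMap1 T L (reflAssoc S adj hhom W F G) (id1 H))
        (comp1 (reflAssoc S adj hhom W (reflTensor T L F G) H)
          (reflMap1 T L (id1 W) (reflAssoc S adj hhom F G H))) =
      comp1 (reflAssoc S adj hhom (reflTensor T L W F) G H)
        (reflAssoc S adj hhom W F (reflTensor T L G H)) := by
  refine Dense0.ext_one reflTensor_mem
    (Dense0.prod adj hhom hshift (Dense0.prod adj hhom hshift
      (Dense0.prod adj hhom hshift dense0_all dense0_all) dense0_all) dense0_all)
    (Dense1.prod adj hhom hshift (Dense1.prod adj hhom hshift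
      (Dense1.prod adj hhom hshift dense1_all dense1_all) dense1_all) dense1_all) ?_ ?_
  · rintro _ _ ⟨_, z, ⟨_, y, ⟨w, x, -, -⟩, -⟩, -⟩
    simp only [res_comp, res_id, res_reflMap, ap0_comp, reflMap0_pair, ap0_reflAssoc, ap0_id,
      pair0_act_left, pair0_act_right, ap0_act, S.pentagon_act0]
  · rintro _ _ ⟨_, z, ⟨_, y, ⟨w, x, -, -⟩, -⟩, -⟩
    simp only [ap1_comp, reflMap1_pair, ap1_reflAssoc, ap1_id,
      pair1_act_left, pair1_act_right, ap1_act, S.pentagon_act1]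

theorem reflTensor_triangle (hF : Sm F) (hG : Sm G) :
    comp1 (reflAssoc S adj hhom F (Presheaf.yoneda I) G)
        (reflMap1 T L (id1 F) (reflLeftUnit S adj hG)) =
      reflMap1 T L (reflRightUnit S adj hF) (id1 G) := by
  refine Dense0.ext_one reflTensor_mem
    -- The middle factor is representable and is tested at its universal element only; there the
    -- unitors are plain pullbacks along those of `C`.
    (Dense0.prod adj hhom hshift (Dense0.prod adj hhom hshift dense0_all dense0_generic)
      dense0_all)
    (Dense1.prod adj hhom hshift (Dense1.prod adj hhom hshift dense1_all dense1_generic)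
      dense1_all)
    ?_ ?_
  · rintro _ _ ⟨_, z, ⟨x, _, -, ⟨⟩⟩, -⟩
    simp only [res_comp, res_id, res_reflMap, ap0_comp, reflMap0_pair, ap0_reflAssoc, ap0_id,
      ap0_reflLeftUnit, ap0_reflRightUnit, pair0_act_left, pair0_act_right, ap0_act,
      Presheaf.toHom0_generic, T.map0_id, Presheaf.act0_id, S.triangle_act0]
  · rintro _ _ ⟨_, z, ⟨x, _, -, ⟨⟩⟩, -⟩
    simp only [ap1_comp, reflMap1_pair, ap1_reflAssoc, ap1_id,
      ap1_reflLeftUnit, ap1_reflRightUnit, pair1_act_left, pair1_act_right, ap1_act,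
      Presheaf.toHom1_generic, T.map1_id, Presheaf.act_id, S.triangle_act1]

theorem reflTensor_hexagon :
    comp1 (reflAssoc S adj hhom F G H) (comp1 (reflBraid S adj F (reflTensor T L G H))
        (reflAssoc S adj hhom G H F)) =
      comp1 (reflMap1 T L (reflBraid S adj F G) (id1 H)) (comp1 (reflAssoc S adj hhom G F H)
        (reflMap1 T L (id1 G) (reflBraid S adj F H))) := by
  refine Dense0.ext_one reflTensor_mem
    (Dense0.prod adj hhom hshift (Dense0.prod adj hhom hshift dense0_all dense0_all) dense0_all)
    (Dense1.prod adj hhom hshift (Dense1.prod adj hhom hshift dense1_all dense1_all) dense1_all)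
    ?_ ?_
  · rintro _ _ ⟨_, z, ⟨x, y, -, -⟩, -⟩
    simp only [res_comp, res_id, res_reflMap, ap0_comp, reflMap0_pair, ap0_reflAssoc, ap0_id,
      ap0_reflBraid, pair0_act_left, pair0_act_right, ap0_act, S.hexagon_act0]
  · rintro _ _ ⟨_, z, ⟨x, y, -, -⟩, -⟩
    simp only [ap1_comp, reflMap1_pair, ap1_reflAssoc, ap1_id, ap1_reflBraid,
      pair1_act_left, pair1_act_right, ap1_act, S.hexagon_act1]

/-- The symmetric monoidal structure of the reflected Day tensor product. -/
def reflElements (hI : Sm (Presheaf.yoneda I)) :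
    SymmetricMonoidalElements ((dayTensor T).reflect (incl Biset.{u} Sm) L)
      ⟨Presheaf.yoneda I, hI⟩ where
  a X Y Z := reflAssoc S adj hhom X.1 Y.1 Z.1
  a' X Y Z := reflAssocInv S adj hshift X.1 Y.1 Z.1
  l X := reflLeftUnit S adj X.2
  l' X := reflLeftUnitInv S adj X.1
  r X := reflRightUnit S adj X.2
  r' X := reflRightUnitInv S adj X.1
  b X Y := reflBraid S adj X.1 Y.1
  a_a' _ _ _ := reflAssoc_inv S adj hhom hshift
  a'_a _ _ _ := reflAssocInv_hom S adj hhom hshift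
  l_l' X := reflLeftUnit_inv S adj X.2
  l'_l X := reflLeftUnitInv_hom S adj X.2
  r_r' X := reflRightUnit_inv S adj X.2
  r'_r X := reflRightUnitInv_hom S adj X.2
  b_b _ _ := reflBraid_symmetry S adj
  a_nat0 f g h := reflAssoc_naturality0 S adj hhom hshift f g h
  a_nat1 f g h := reflAssoc_naturality1 S adj hhom hshift f g h
  l_nat0 {X X'} f := reflLeftUnit_naturality0 S adj X.2 X'.2 f
  l_nat1 {X X'} f := reflLeftUnit_naturality1 S adj X.2 X'.2 f
  r_nat0 {X X'} f := reflRightUnit_naturality0 S adj X.2 X'.2 f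
  r_nat1 {X X'} f := reflRightUnit_naturality1 S adj X.2 X'.2 f
  b_nat0 f g := reflBraid_naturality0 S adj f g
  b_nat1 f g := reflBraid_naturality1 S adj f g
  pentagon _ _ _ _ := reflTensor_pentagon S adj hhom hshift
  triangle X Y := reflTensor_triangle S adj hhom hshift X.2 Y.2
  hexagon _ _ _ := reflTensor_hexagon S adj hhom hshift

end ReflectedStructure

/-! ## The reflection of presheaves into presheaves that invert a class of cocones -/

section Universal

variable {C : Type u} [EnrichedCategory Biset.{u} C] {Sm : Presheaf C → Prop}

/-- A universal arrow from a presheaf to the presheaves in `Sm`. -/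
structure UniversalArrow (Sm : Presheaf C → Prop) (F : Presheaf C) where
  obj : Presheaf C
  mem : Sm obj
  unit : (F ⟶[Biset.{u}] obj).one
  desc0 {W : Presheaf C} (hW : Sm W) (β : (F ⟶[Biset.{u}] W).zero) :
    (obj ⟶[Biset.{u}] W).zero
  desc1 {W : Presheaf C} (hW : Sm W) (β : (F ⟶[Biset.{u}] W).one) : (obj ⟶[Biset.{u}] W).one
  res_desc {W : Presheaf C} (hW : Sm W) (β : (F ⟶[Biset.{u}] W).one) :
    Biset.res _ (desc1 hW β) = desc0 hW (Biset.res _ β)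
  fac0 {W : Presheaf C} (hW : Sm W) (β : (F ⟶[Biset.{u}] W).zero) :
    comp0 (Biset.res _ unit) (desc0 hW β) = β
  fac1 {W : Presheaf C} (hW : Sm W) (β : (F ⟶[Biset.{u}] W).one) :
    comp1 unit (desc1 hW β) = β
  uniq0 {W : Presheaf C} (hW : Sm W) (β : (obj ⟶[Biset.{u}] W).zero) :
    desc0 hW (comp0 (Biset.res _ unit) β) = β
  uniq1 {W : Presheaf C} (hW : Sm W) (β : (obj ⟶[Biset.{u}] W).one) :
    desc1 hW (comp1 unit β) = β

namespace UniversalArrow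

variable (U : ∀ F : Presheaf C, UniversalArrow Sm F)

include U in
theorem ext0 {F W : Presheaf C} (hW : Sm W) {β γ : ((U F).obj ⟶[Biset.{u}] W).zero}
    (h : comp0 (Biset.res _ (U F).unit) β = comp0 (Biset.res _ (U F).unit) γ) : β = γ := by
  rw [← (U F).uniq0 hW β, h, (U F).uniq0]

theorem ext1 {F W : Presheaf C} (hW : Sm W) {β γ : ((U F).obj ⟶[Biset.{u}] W).one}
    (h : comp1 (U F).unit β = comp1 (U F).unit γ) : β = γ := by
  rw [← (U F).uniq1 hW β, h, (U F).uniq1]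

/-- The action of the reflection on the zero parts. -/
def map0 {F G : Presheaf C} (β : (F ⟶[Biset.{u}] G).zero) :
    ((U F).obj ⟶[Biset.{u}] (U G).obj).zero :=
  (U F).desc0 (U G).mem (comp0 β (Biset.res _ (U G).unit))

/-- The action of the reflection on the one parts. -/
def map1 {F G : Presheaf C} (β : (F ⟶[Biset.{u}] G).one) :
    ((U F).obj ⟶[Biset.{u}] (U G).obj).one :=
  (U F).desc1 (U G).mem (comp1 β (U G).unit)

theorem unit_map0 {F G : Presheaf C} (β : (F ⟶[Biset.{u}] G).zero) :
    comp0 (Biset.res _ (U F).unit) (map0 U β) = comp0 β (Biset.res _ (U G).unit) :=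
  (U F).fac0 _ _

theorem unit_map1 {F G : Presheaf C} (β : (F ⟶[Biset.{u}] G).one) :
    comp1 (U F).unit (map1 U β) = comp1 β (U G).unit :=
  (U F).fac1 _ _

theorem res_map {F G : Presheaf C} (β : (F ⟶[Biset.{u}] G).one) :
    Biset.res _ (map1 U β) = map0 U (Biset.res _ β) :=
  ((U F).res_desc _ _).trans (congrArg ((U F).desc0 (U G).mem) (res_comp _ _))

theorem map0_id (F : Presheaf C) : map0 U (id0 F) = id0 (U F).obj :=
  ext0 U (U F).mem (by rw [unit_map0, id0_comp, comp0_id])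

theorem map1_id (F : Presheaf C) : map1 U (id1 F) = id1 (U F).obj :=
  ext1 U (U F).mem (by rw [unit_map1, id1_comp, comp1_id])

theorem map0_comp {F G H : Presheaf C} (β : (F ⟶[Biset.{u}] G).zero)
    (γ : (G ⟶[Biset.{u}] H).zero) : map0 U (comp0 β γ) = comp0 (map0 U β) (map0 U γ) :=
  ext0 U (U H).mem (by rw [unit_map0, ← assoc0, unit_map0, assoc0, assoc0, unit_map0])

theorem map1_comp {F G H : Presheaf C} (β : (F ⟶[Biset.{u}] G).one)
    (γ : (G ⟶[Biset.{u}] H).one) : map1 U (comp1 β γ) = comp1 (map1 U β) (map1 U γ) :=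
  ext1 U (U H).mem (by rw [unit_map1, ← assoc1, unit_map1, assoc1, assoc1, unit_map1])

/-- The reflection given by universal arrows. -/
def reflection : EnrichedFunctor Biset.{u} (Presheaf C) { F // Sm F } where
  obj F := ⟨(U F).obj, (U F).mem⟩
  map _ _ := Biset.Hom.mk (fun β => map0 U β) (fun β => map1 U β) (fun β => res_map U β)
  map_id F := Biset.hom_ext (fun _ => map0_id U F) (fun _ => map1_id U F)
  map_comp _ _ _ := Biset.hom_ext (fun p => map0_comp U p.1 p.2) (fun p => map1_comp U p.1 p.2)

/-- The reflection given by universal arrows is left adjoint to the inclusion. -/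
def adjunction : VAdjunction Biset.{u} (reflection U) (incl Biset.{u} Sm) where
  homIso F Y :=
    { hom := Biset.Hom.mk (fun β => comp0 (Z := Y.1) (Biset.res _ (U F).unit) β)
        (fun β => comp1 (Z := Y.1) (U F).unit β) (fun β => res_comp (Z := Y.1) (U F).unit β)
      inv := Biset.Hom.mk (fun β => (U F).desc0 Y.2 β) (fun β => (U F).desc1 Y.2 β)
        (fun β => (U F).res_desc Y.2 β)
      hom_inv_id := Biset.hom_ext (fun β => (U F).uniq0 Y.2 β) (fun β => (U F).uniq1 Y.2 β)
      inv_hom_id := Biset.hom_ext (fun β => (U F).fac0 Y.2 β) (fun β => (U F).fac1 Y.2 β) }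
  naturality_left F G Y := Biset.hom_ext
    (fun p => by
      have h := congrArg (fun t => comp0 (Z := Y.1) t p.2) (unit_map0 U p.1)
      exact (assoc0 (Z := Y.1) _ _ _).symm.trans (h.symm.trans (assoc0 (Z := Y.1) _ _ _)))
    (fun p => by
      have h := congrArg (fun t => comp1 (Z := Y.1) t p.2) (unit_map1 U p.1)
      exact (assoc1 (Z := Y.1) _ _ _).symm.trans (h.symm.trans (assoc1 (Z := Y.1) _ _ _)))
  naturality_right F Y Z := Biset.hom_ext
    (fun p => assoc0 (Y := Y.1) (Z := Z.1) (Biset.res _ (U F).unit) p.1 p.2)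
    (fun p => assoc1 (Y := Y.1) (Z := Z.1) (U F).unit p.1 p.2)

end UniversalArrow

end Universal

/-! ### The free completion of a presheaf under gluing along a class of cocones. -/

section Completion

variable {C : Type u} [EnrichedCategory Biset.{u} C]
  (K : ∀ A B P : C, (A ⟶[Biset.{u}] P).zero → (B ⟶[Biset.{u}] P).zero → Prop)

/-- The zero parts of `F` take the cocones in the class `K` to products. -/
def IsContinuous (F : Presheaf C) : Prop :=
  ∀ (A B P : C) (i : (A ⟶[Biset.{u}] P).zero) (j : (B ⟶[Biset.{u}] P).zero), K A B P i j →
    Function.Bijective (fun x : F.el0 P => (F.act0 i x, F.act0 j x))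

variable {K} in
/-- The element of `F P` with given restrictions along a cocone in `K`. -/
def IsContinuous.glue {F : Presheaf C} (hF : IsContinuous K F) {A B P : C}
    {i : (A ⟶[Biset.{u}] P).zero} {j : (B ⟶[Biset.{u}] P).zero} (h : K A B P i j) (x : F.el0 A)
    (y : F.el0 B) : F.el0 P :=
  ((hF A B P i j h).2 (x, y)).choose

theorem IsContinuous.act_glue {F : Presheaf C} (hF : IsContinuous K F) {A B P : C}
    {i : (A ⟶[Biset.{u}] P).zero} {j : (B ⟶[Biset.{u}] P).zero} (h : K A B P i j) (x : F.el0 A)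
    (y : F.el0 B) : (F.act0 i (hF.glue h x y), F.act0 j (hF.glue h x y)) = (x, y) :=
  ((hF A B P i j h).2 (x, y)).choose_spec

variable (F : Presheaf C)

/-- Formal expressions for the elements of the completion of the zero parts of `F`. -/
inductive Term : C → Type u
  | of {A : C} (x : F.el0 A) : Term A
  | act {A B : C} (f : (A ⟶[Biset.{u}] B).zero) (t : Term B) : Term A
  | glue {A B P : C} (i : (A ⟶[Biset.{u}] P).zero) (j : (B ⟶[Biset.{u}] P).zero)
      (h : K A B P i j) (s : Term A) (t : Term B) : Term P

/-- The identifications between formal expressions. -/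
inductive Term.Rel : ∀ {A : C}, Term K F A → Term K F A → Prop
  | refl {A : C} (t : Term K F A) : Rel t t
  | symm {A : C} {s t : Term K F A} : Rel s t → Rel t s
  | trans {A : C} {r s t : Term K F A} : Rel r s → Rel s t → Rel r t
  | act {A B : C} (f : (A ⟶[Biset.{u}] B).zero) {s t : Term K F B} :
      Rel s t → Rel (.act f s) (.act f t)
  | glue {A B P : C} (i : (A ⟶[Biset.{u}] P).zero) (j : (B ⟶[Biset.{u}] P).zero)
      (h : K A B P i j) {s s' : Term K F A} {t t' : Term K F B} :
      Rel s s' → Rel t t' → Rel (.glue i j h s t) (.glue i j h s' t')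
  -- The relation `act_of` makes the inclusion of `F` natural, the next two make the quotient a
  -- presheaf, and the last three make `glue` inverse to the pair of restrictions.
  | act_of {A B : C} (f : (A ⟶[Biset.{u}] B).zero) (x : F.el0 B) :
      Rel (.act f (.of x)) (.of (F.act0 f x))
  | act_id {A : C} (t : Term K F A) : Rel (.act (id0 A) t) t
  | act_comp {A B D : C} (f : (A ⟶[Biset.{u}] B).zero) (g : (B ⟶[Biset.{u}] D).zero)
      (t : Term K F D) : Rel (.act (comp0 f g) t) (.act f (.act g t))
  | act_glue_left {A B P : C} (i : (A ⟶[Biset.{u}] P).zero) (j : (B ⟶[Biset.{u}] P).zero)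
      (h : K A B P i j) (s : Term K F A) (t : Term K F B) : Rel (.act i (.glue i j h s t)) s
  | act_glue_right {A B P : C} (i : (A ⟶[Biset.{u}] P).zero) (j : (B ⟶[Biset.{u}] P).zero)
      (h : K A B P i j) (s : Term K F A) (t : Term K F B) : Rel (.act j (.glue i j h s t)) t
  | glue_act {A B P : C} (i : (A ⟶[Biset.{u}] P).zero) (j : (B ⟶[Biset.{u}] P).zero)
      (h : K A B P i j) (t : Term K F P) : Rel (.glue i j h (.act i t) (.act j t)) t

/-- Formal expressions up to identifications. -/
def termSetoid (A : C) : Setoid (Term K F A) where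
  r := Term.Rel K F
  iseqv := ⟨.refl, .symm, .trans⟩

/-- The completion of `F`. -/
def completion : Presheaf C where
  -- Continuity says nothing about one parts, so they are kept, with restriction followed by the
  -- inclusion of `F` into terms.
  obj X := ⟨Quotient (termSetoid K F (unop X)), (F.obj X).one,
    fun x => Quotient.mk _ (.of ((F.obj X).res x))⟩
  map X Y := Biset.Hom.mk
    (fun f => Quotient.map (sa := termSetoid K F (unop X)) (sb := termSetoid K F (unop Y))
      (Term.act f) (fun _ _ h =>
        Term.Rel.act (K := K) (F := F) (A := unop Y) (B := unop X) f h))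
    (fun f => Biset.Hom.mk
      (Quotient.map (sa := termSetoid K F (unop X)) (sb := termSetoid K F (unop Y))
        (Term.act ((unop Y ⟶[Biset.{u}] unop X).res f)) (fun _ _ h => Term.Rel.act _ h))
      (fun x => F.act (X := unop Y) (Y := unop X) f x)
      (fun x => (congrArg (fun t => Quotient.mk (termSetoid K F (unop Y)) (.of t))
        (F.res_act (X := unop Y) (Y := unop X) f x)).trans
        (Quotient.sound (.symm (.act_of _ _)))))
    (fun _ => rfl)
  map_id X := Biset.hom_ext
    (fun _ => funext (by
      rintro ⟨t⟩
      exact Quotient.sound (.act_id t)))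
    (fun _ => Biset.hom_ext
      (by
        rintro ⟨t⟩
        refine Quotient.sound ?_
        exact (congrArg (fun s => Term.act s t) (res_id (unop X))) ▸ .act_id t)
      (fun x => F.act_id (X := unop X) x))
  map_comp X Y Z := Biset.hom_ext
    (fun p => funext (by
      rintro ⟨t⟩
      exact Quotient.sound (.act_comp (A := unop Z) (B := unop Y) (D := unop X) p.2 p.1 t)))
    (fun p => Biset.hom_ext
      (by
        rintro ⟨t⟩
        refine Quotient.sound ?_
        have h := Term.Rel.act_comp (K := K) (F := F) (A := unop Z) (B := unop Y) (D := unop X)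
          (Biset.res _ p.2) (Biset.res _ p.1) t
        rw [← res_comp] at h
        exact h)
      (fun x => F.act_comp (X := unop Z) (Y := unop Y) (Z := unop X) p.2 p.1 x))

/-- A term is equivalent to the gluing of its two restrictions and `glue` respects the relation,
which gives injectivity; a formal gluing has the prescribed restrictions, which gives surjectivity.
-/
theorem completion_isContinuous : IsContinuous K (completion K F) := by
  intro A B P i j h
  constructor
  · rintro ⟨s⟩ ⟨t⟩ e
    have e1 : Term.Rel K F (.act i s) (.act i t) := Quotient.exact (congrArg Prod.fst e)
    have e2 : Term.Rel K F (.act j s) (.act j t) := Quotient.exact (congrArg Prod.snd e)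
    exact Quotient.sound (.trans (.symm (.glue_act i j h s))
      (.trans (.glue i j h e1 e2) (.glue_act i j h t)))
  · rintro ⟨⟨s⟩, ⟨t⟩⟩
    exact ⟨Quotient.mk _ (.glue i j h s t), Prod.ext (Quotient.sound (.act_glue_left i j h s t))
      (Quotient.sound (.act_glue_right i j h s t))⟩

/-- The unit of the completion. -/
def completionUnit : (F ⟶[Biset.{u}] completion K F).one :=
  mkNat1 (mkNat0 (G := completion K F) (fun _ x => Quotient.mk _ (.of x))
    (fun _ _ g x => Quotient.sound (.symm (.act_of g x))))
    (fun _ x => x) (fun _ _ _ _ => rfl) (fun _ _ => rfl)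

variable {K F} {W : Presheaf C} (hW : IsContinuous K W) (β : (F ⟶[Biset.{u}] W).zero)

/-- Evaluation of formal expressions. -/
def Term.eval {A : C} : Term K F A → W.el0 A
  | .of x => ap0 β x
  | .act f t => W.act0 f (t.eval)
  | .glue _ _ h s t => hW.glue h s.eval t.eval

/-- Each identification holds in every continuous presheaf: those for `glue` are existence and
uniqueness of the glued element. Uniqueness also makes the choice in `IsContinuous.glue` harmless.
-/
theorem Term.Rel.eval {A : C} {s t : Term K F A} (h : Term.Rel K F s t) :
    s.eval hW β = t.eval hW β := by
  induction h with
  | refl => rfl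
  | symm _ ih => exact ih.symm
  | trans _ _ ih ih' => exact ih.trans ih'
  | act f _ ih => exact congrArg (W.act0 f) ih
  | glue i j h _ _ ih ih' => exact congrArg₂ (hW.glue h) ih ih'
  | act_of f x => exact (ap0_act β f x).symm
  | act_id t => exact W.act0_id _ _
  | act_comp f g t => exact W.act0_comp f g _
  | act_glue_left i j h s t => exact congrArg Prod.fst (hW.act_glue K h _ _)
  | act_glue_right i j h s t => exact congrArg Prod.snd (hW.act_glue K h _ _)
  | glue_act i j h t => exact (hW _ _ _ i j h).1 (hW.act_glue K h _ _)

/-- The extension of a map to the completion, on the zero parts. -/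
def completionDesc0 : (completion K F ⟶[Biset.{u}] W).zero :=
  mkNat0 (F := completion K F) (fun _ => Quotient.lift (Term.eval hW β) (fun _ _ h => h.eval hW β))
    (by
      rintro X Y g ⟨t⟩
      rfl)

/-- The extension of a map to the completion. -/
def completionDesc1 (β : (F ⟶[Biset.{u}] W).one) : (completion K F ⟶[Biset.{u}] W).one :=
  mkNat1 (F := completion K F) (completionDesc0 hW (Biset.res _ β)) (fun _ x => ap1 β x)
    (fun _ _ g x => ap1_act β g x) (fun _ x => res_ap1 β x)

/-- Induction on terms. For a gluing, continuity of `W` reduces the equality to the restrictions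
along `i` and `j`, where naturality of `γ` and the induction hypotheses apply. -/
theorem completion_uniq0 (γ : (completion K F ⟶[Biset.{u}] W).zero) :
    completionDesc0 hW (comp0 (Biset.res _ (completionUnit K F)) γ) = γ := by
  refine nat0_ext ?_
  suffices h : ∀ {X : C} (t : Term K F X), t.eval hW
      (comp0 (Biset.res _ (completionUnit K F)) γ) =
        ap0 (X := X) γ (Quotient.mk (termSetoid K F X) t) by
    rintro X ⟨t⟩
    exact h t
  intro X t
  induction t with
  | of x => rfl
  | act f t ih => exact (congrArg (W.act0 f) ih).trans (ap0_act γ f (Quotient.mk _ t)).symm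
  | @glue A B P i j h s t ih ih' =>
    refine (hW _ _ _ i j h).1 ((hW.act_glue K h _ _).trans (Prod.ext ?_ ?_))
    · refine ih.trans (Eq.trans ?_
        (ap0_act γ i (Quotient.mk (termSetoid K F P) (.glue i j h s t))))
      exact congrArg (ap0 (X := A) γ) (Quotient.sound (.symm (.act_glue_left i j h s t)))
    · refine ih'.trans (Eq.trans ?_
        (ap0_act γ j (Quotient.mk (termSetoid K F P) (.glue i j h s t))))
      exact congrArg (ap0 (X := B) γ) (Quotient.sound (.symm (.act_glue_right i j h s t)))

variable (K F) in
/-- The universal arrow from `F` to its completion. -/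
def completionArrow : UniversalArrow (IsContinuous K) F where
  obj := completion K F
  mem := completion_isContinuous K F
  unit := completionUnit K F
  desc0 hW β := completionDesc0 hW β
  desc1 hW β := completionDesc1 hW β
  res_desc _ _ := rfl
  -- Evaluating `of x` returns the value at `x`, and the unit is the identity on one parts.
  fac0 _ _ := rfl
  fac1 _ _ := rfl
  uniq0 hW β := completion_uniq0 hW β
  uniq1 hW β := nat1_ext
    (completion_uniq0 hW (Biset.res (completion K F ⟶[Biset.{u}] _) β)) fun _ _ => rfl

end Completion

/-! ### Closure of continuous presheaves under shifts and internal homs. -/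

section Closure

variable {C : Type u} [EnrichedCategory Biset.{u} C] {T : TensorBifunctor Biset.{u} C}
  {K : ∀ A B P : C, (A ⟶[Biset.{u}] P).zero → (B ⟶[Biset.{u}] P).zero → Prop}

/-- A cocone seen by `H (D ⊗ -)` is its image under `D ⊗ -` seen by `H`. -/
theorem IsContinuous.shift {H : Presheaf C} (hH : IsContinuous K H)
    (hK : ∀ (D : C) {A B P : C} (i : (A ⟶[Biset.{u}] P).zero) (j : (B ⟶[Biset.{u}] P).zero),
      K A B P i j → K _ _ _ (T.map0 (id0 D) i) (T.map0 (id0 D) j)) (D : C) :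
    IsContinuous K (shift T H D) :=
  fun _ _ _ i j h => hH _ _ _ _ _ (hK D i j h)

/-- Restricting `θ` along `f` pulls each value at `y ∈ G D` back along `f ⊗ D`. Hence gluing is done
value by value in `H`, along the cocones `i ⊗ D`, `j ⊗ D`, for arbitrary `G`. -/
theorem IsContinuous.dayHom {H : Presheaf C} (hH : IsContinuous K H)
    (hK : ∀ (D : C) {A B P : C} (i : (A ⟶[Biset.{u}] P).zero) (j : (B ⟶[Biset.{u}] P).zero),
      K A B P i j → K _ _ _ (T.map0 i (id0 D)) (T.map0 j (id0 D))) (G : Presheaf C) :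
    IsContinuous K (dayHomObj T G H) := by
  intro A B P i j h
  have act_id {A A' D : C} (f : (A ⟶[Biset.{u}] A').zero) (θ : (dayHomObj T G H).el0 A')
      (y : G.el0 D) : homEval0 T ((dayHomObj T G H).act0 f θ) y =
        H.act0 (T.map0 f (id0 D)) (homEval0 T θ y) := by
    rw [← homEval0_act, G.act0_id]
  constructor
  · intro θ θ' e
    refine homEval0_ext T fun D y => (hH _ _ _ _ _ (hK D i j h)).1 (Prod.ext ?_ ?_)
    · exact (act_id i θ y).symm.trans
        ((congrArg (fun t => homEval0 T t y) (congrArg Prod.fst e)).trans (act_id i θ' y))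
    · exact (act_id j θ y).symm.trans
        ((congrArg (fun t => homEval0 T t y) (congrArg Prod.snd e)).trans (act_id j θ' y))
  · rintro ⟨θ, θ'⟩
    have glue_i {D : C} (y : G.el0 D) := congrArg Prod.fst
      (hH.act_glue K (hK D i j h) (homEval0 T θ y) (homEval0 T θ' y))
    have glue_j {D : C} (y : G.el0 D) := congrArg Prod.snd
      (hH.act_glue K (hK D i j h) (homEval0 T θ y) (homEval0 T θ' y))
    have nat {A X Y : C} (i : (A ⟶[Biset.{u}] P).zero) (g : (X ⟶[Biset.{u}] Y).zero)
        (z : H.el0 (T.obj P Y)) : H.act0 (T.map0 i (id0 X)) (H.act0 (T.map0 (id0 P) g) z) =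
          H.act0 (T.map0 (id0 A) g) (H.act0 (T.map0 i (id0 Y)) z) := by
      rw [← H.act0_comp, ← H.act0_comp, ← T.map0_comp, ← T.map0_comp, comp0_id, id0_comp,
        id0_comp, comp0_id]
    have eval_nat {A X Y : C} (θ : (dayHomObj T G H).el0 A) (g : (X ⟶[Biset.{u}] Y).zero)
        (y : G.el0 Y) : homEval0 T θ (G.act0 g y) =
          H.act0 (T.map0 (id0 A) g) (homEval0 T θ y) := by
      rw [← homEval0_act, Presheaf.act0_id]
    -- The values are glued separately. Naturality in `D` follows from uniqueness of gluing:
    -- restricted along `i` and along `j` it becomes naturality of `θ` and of `θ'`.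
    refine ⟨mkHom0 T (fun D y => hH.glue (hK D i j h) (homEval0 T θ y) (homEval0 T θ' y))
      (fun X Y g y => (hH _ _ _ _ _ (hK X i j h)).1 (Prod.ext ?_ ?_)), Prod.ext ?_ ?_⟩
    · exact (glue_i _).trans ((eval_nat θ g y).trans
        ((congrArg _ (glue_i y)).symm.trans (nat i g _).symm))
    · exact (glue_j _).trans ((eval_nat θ' g y).trans
        ((congrArg _ (glue_j y)).symm.trans (nat j g _).symm))
    · exact homEval0_ext T fun D y => (act_id i _ y).trans (glue_i y)
    · exact homEval0_ext T fun D y => (act_id j _ y).trans (glue_j y)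

end Closure

/-! ### Coproduct cocones and the symmetric monoidal structure of the circuit category. -/

section Circuits

open Functor.LaxMonoidal Functor.OplaxMonoidal

/-- Unique existence turns transport along isomorphisms into cancellation, with no isomorphisms of
cocones or diagrams. -/
theorem nonempty_isColimit_binaryCofan_iff {Q : Type*} [Category Q] {A B P : Q} (i : A ⟶ P)
    (j : B ⟶ P) : Nonempty (Limits.IsColimit (Limits.BinaryCofan.mk i j)) ↔
      ∀ (Z : Q) (f : A ⟶ Z) (g : B ⟶ Z), ∃! l : P ⟶ Z, i ≫ l = f ∧ j ≫ l = g := by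
  constructor
  · rintro ⟨h⟩ Z f g
    obtain ⟨l, hl⟩ := Limits.BinaryCofan.IsColimit.desc' h f g
    exact ⟨l, hl, fun m hm => Limits.BinaryCofan.IsColimit.hom_ext h (hm.1.trans hl.1.symm)
      (hm.2.trans hl.2.symm)⟩
  · intro h
    exact ⟨Limits.BinaryCofan.isColimitMk (fun s => (h s.pt s.inl s.inr).choose)
      (fun s => (h s.pt s.inl s.inr).choose_spec.1.1)
      (fun s => (h s.pt s.inl s.inr).choose_spec.1.2)
      (fun s m hl hr => (h s.pt s.inl s.inr).choose_spec.2 m ⟨hl, hr⟩)⟩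

/-- A binary coproduct cocone transported along isomorphisms. -/
theorem nonempty_isColimit_binaryCofan_conj {Q : Type*} [Category Q] {A A' B B' P P' : Q}
    {i : A ⟶ P} {j : B ⟶ P} (h : Nonempty (Limits.IsColimit (Limits.BinaryCofan.mk i j)))
    (eA : A' ≅ A) (eB : B' ≅ B) (eP : P ≅ P') : Nonempty (Limits.IsColimit
      (Limits.BinaryCofan.mk (eA.hom ≫ i ≫ eP.hom) (eB.hom ≫ j ≫ eP.hom))) := by
  rw [nonempty_isColimit_binaryCofan_iff] at h ⊢
  intro Z f g
  obtain ⟨l, ⟨hi, hj⟩, hl⟩ := h Z (eA.inv ≫ f) (eB.inv ≫ g)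
  refine ⟨eP.inv ≫ l, ⟨by simp [hi], by simp [hj]⟩, fun m hm => ?_⟩
  rw [Iso.eq_inv_comp]
  refine hl _ ⟨?_, ?_⟩
  · rw [Iso.eq_inv_comp, ← hm.1, Category.assoc, Category.assoc]
  · rw [Iso.eq_inv_comp, ← hm.2, Category.assoc, Category.assoc]

variable {M Q : Type u} [SmallCategory M] [SmallCategory Q] (J : M ⥤ Q)

/-- The class of binary coproduct cocones of `Q`. -/
def IsCoproduct (A B P : CircCat J) (i : (A ⟶[Biset.{u}] P).zero)
    (j : (B ⟶[Biset.{u}] P).zero) : Prop :=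
  Nonempty (Limits.IsColimit (Limits.BinaryCofan.mk (C := Q) (X := J.obj A.toM)
    (Y := J.obj B.toM) (P := J.obj P.toM) i j))

variable [MonoidalCategory M] [SymmetricCategory M] [MonoidalCategory Q] [SymmetricCategory Q]
  [J.Braided]

/-- On zero parts the tensor product of `C` is that of `Q` conjugated by the isomorphisms `μ`. So
the cocone is the image of the given one under `J D ⊗ -`, transported along `μ`. -/
theorem isCoproduct_tensorLeft
    (hQ : ∀ X : Q, Limits.PreservesColimitsOfShape (Discrete Limits.WalkingPair) (tensorLeft X))
    (D : CircCat J) {A B P : CircCat J} (i : (A ⟶[Biset.{u}] P).zero)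
    (j : (B ⟶[Biset.{u}] P).zero) (h : IsCoproduct J A B P i j) :
    IsCoproduct J _ _ _ ((circTensor J).map0 (id0 D) i) ((circTensor J).map0 (id0 D) j) := by
  obtain ⟨h⟩ := h
  have := hQ (J.obj D.toM)
  have h' := nonempty_isColimit_binaryCofan_conj
    ⟨Limits.mapIsColimitOfPreservesOfIsColimit (tensorLeft (J.obj D.toM)) _ _ h⟩
    (Functor.Monoidal.μIso J D.toM A.toM).symm (Functor.Monoidal.μIso J D.toM B.toM).symm
    (Functor.Monoidal.μIso J D.toM P.toM)
  have e (A : CircCat J) (i : J.obj A.toM ⟶ J.obj P.toM) :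
      δ J D.toM A.toM ≫ (𝟙 (J.obj D.toM) ⊗ₘ i) ≫ μ J D.toM P.toM =
        δ J D.toM A.toM ≫ (J.obj D.toM ◁ i) ≫ μ J D.toM P.toM := by rw [id_tensorHom]
  exact (congrArg₂ (IsCoproduct J _ _ _) (e A i) (e B j)).mpr h'

/-- The assumption concerns `X ⊗ -`; the braiding of `Q` is composed with `μ` in the transporting
isomorphisms. -/
theorem isCoproduct_tensorRight
    (hQ : ∀ X : Q, Limits.PreservesColimitsOfShape (Discrete Limits.WalkingPair) (tensorLeft X))
    (D : CircCat J) {A B P : CircCat J} (i : (A ⟶[Biset.{u}] P).zero)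
    (j : (B ⟶[Biset.{u}] P).zero) (h : IsCoproduct J A B P i j) :
    IsCoproduct J _ _ _ ((circTensor J).map0 i (id0 D)) ((circTensor J).map0 j (id0 D)) := by
  obtain ⟨h⟩ := h
  have := hQ (J.obj D.toM)
  have h' := nonempty_isColimit_binaryCofan_conj
    ⟨Limits.mapIsColimitOfPreservesOfIsColimit (tensorLeft (J.obj D.toM)) _ _ h⟩
    ((Functor.Monoidal.μIso J A.toM D.toM).symm ≪≫ β_ (J.obj A.toM) (J.obj D.toM))
    ((Functor.Monoidal.μIso J B.toM D.toM).symm ≪≫ β_ (J.obj B.toM) (J.obj D.toM))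
    (β_ (J.obj D.toM) (J.obj P.toM) ≪≫ Functor.Monoidal.μIso J P.toM D.toM)
  have e (A : CircCat J) (i : J.obj A.toM ⟶ J.obj P.toM) :
      δ J A.toM D.toM ≫ (i ⊗ₘ 𝟙 (J.obj D.toM)) ≫ μ J P.toM D.toM =
        (δ J A.toM D.toM ≫ (β_ _ _).hom) ≫ (J.obj D.toM ◁ i) ≫ (β_ _ _).hom ≫
          μ J P.toM D.toM := by
    rw [tensorHom_id, BraidedCategory.braiding_naturality_right_assoc, Category.assoc,
      SymmetricCategory.symmetry_assoc]
  exact (congrArg₂ (IsCoproduct J _ _ _) (e A i) (e B j)).mpr h'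

/-- The arrows `f`, `g`, `h` of `Q` need not come from `M`, so functoriality of `J` does not
suffice. Writing `J α` through `μ`, `δ` and the associator of `Q`, the inner pairs cancel and
naturality in `Q` remains. -/
theorem map_associator_naturality {X X' Y Y' Z Z' : M} (f : J.obj X ⟶ J.obj X')
    (g : J.obj Y ⟶ J.obj Y') (h : J.obj Z ⟶ J.obj Z') :
    (δ J (X ⊗ Y) Z ≫ ((δ J X Y ≫ (f ⊗ₘ g) ≫ μ J X' Y') ⊗ₘ h) ≫ μ J (X' ⊗ Y') Z') ≫
        J.map (α_ X' Y' Z').hom =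
      J.map (α_ X Y Z).hom ≫ δ J X (Y ⊗ Z) ≫ (f ⊗ₘ (δ J Y Z ≫ (g ⊗ₘ h) ≫ μ J Y' Z')) ≫
        μ J X' (Y' ⊗ Z') := by
  have e : (δ J X Y ≫ (f ⊗ₘ g) ≫ μ J X' Y') ⊗ₘ h =
      δ J X Y ▷ J.obj Z ≫ ((f ⊗ₘ g) ⊗ₘ h) ≫ μ J X' Y' ▷ J.obj Z' := by
    rw [← tensorHom_id, ← tensorHom_id, tensorHom_comp_tensorHom, tensorHom_comp_tensorHom,
      Category.comp_id, Category.id_comp]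
  have e' : f ⊗ₘ (δ J Y Z ≫ (g ⊗ₘ h) ≫ μ J Y' Z') =
      J.obj X ◁ δ J Y Z ≫ (f ⊗ₘ (g ⊗ₘ h)) ≫ J.obj X' ◁ μ J Y' Z' := by
    rw [← id_tensorHom, ← id_tensorHom, tensorHom_comp_tensorHom, tensorHom_comp_tensorHom,
      Category.comp_id, Category.id_comp]
  rw [e, e', Functor.Monoidal.map_associator, Functor.Monoidal.map_associator]
  simp only [Category.assoc, Functor.Monoidal.μ_δ_assoc, Functor.Monoidal.whiskerRight_μ_δ_assoc,
    Functor.Monoidal.whiskerLeft_μ_δ_assoc, associator_naturality_assoc]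

theorem map_braiding_naturality {X X' Y Y' : M} (f : J.obj X ⟶ J.obj X')
    (g : J.obj Y ⟶ J.obj Y') :
    (δ J X Y ≫ (f ⊗ₘ g) ≫ μ J X' Y') ≫ J.map (β_ X' Y').hom =
      J.map (β_ X Y).hom ≫ δ J Y X ≫ (g ⊗ₘ f) ≫ μ J Y' X' := by
  -- Precomposition with the invertible `μ` turns `J β` into the braiding of `Q` followed by `μ`.
  rw [← cancel_epi (μ J X Y), Functor.LaxBraided.braided_assoc]
  simp only [Category.assoc, Functor.Monoidal.μ_δ_assoc, Functor.LaxBraided.braided,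
    BraidedCategory.braiding_naturality_assoc]

/-- The symmetric monoidal structure of the biset-category of circuits. -/
def circElements : SymmetricMonoidalElements (circTensor J) (CircCat.ofM J (𝟙_ M)) where
  a X Y Z := (α_ X.toM Y.toM Z.toM).hom
  a' X Y Z := (α_ X.toM Y.toM Z.toM).inv
  l X := (λ_ X.toM).hom
  l' X := (λ_ X.toM).inv
  r X := (ρ_ X.toM).hom
  r' X := (ρ_ X.toM).inv
  b X Y := (β_ X.toM Y.toM).hom
  a_a' _ _ _ := Iso.hom_inv_id _
  a'_a _ _ _ := Iso.inv_hom_id _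
  l_l' _ := Iso.hom_inv_id _
  l'_l _ := Iso.inv_hom_id _
  r_r' _ := Iso.hom_inv_id _
  r'_r _ := Iso.inv_hom_id _
  b_b _ _ := SymmetricCategory.symmetry _ _
  a_nat0 {X X' Y Y' Z Z'} f g h := by
    change (δ J (X.toM ⊗ Y.toM) Z.toM ≫ ((δ J X.toM Y.toM ≫ (f ⊗ₘ g) ≫ μ J X'.toM Y'.toM) ⊗ₘ h) ≫
        μ J (X'.toM ⊗ Y'.toM) Z'.toM) ≫ J.map (α_ X'.toM Y'.toM Z'.toM).hom =
      J.map (α_ X.toM Y.toM Z.toM).hom ≫ δ J X.toM (Y.toM ⊗ Z.toM) ≫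
        (f ⊗ₘ (δ J Y.toM Z.toM ≫ (g ⊗ₘ h) ≫ μ J Y'.toM Z'.toM)) ≫ μ J X'.toM (Y'.toM ⊗ Z'.toM)
    exact map_associator_naturality J f g h
  a_nat1 f g h := associator_naturality _ _ _
  l_nat0 {X X'} f := by
    change (δ J (𝟙_ M) X.toM ≫ (𝟙 (J.obj (𝟙_ M)) ⊗ₘ f) ≫ μ J (𝟙_ M) X'.toM) ≫
      J.map (λ_ X'.toM).hom = J.map (λ_ X.toM).hom ≫ f
    -- With `J λ` written as `δ`, the counit and the unitor of `Q`, the pair `μ`, `δ` cancels and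
    -- the counit slides past `f`.
    rw [Functor.Monoidal.map_leftUnitor, Functor.Monoidal.map_leftUnitor]
    simp only [Category.assoc, Functor.Monoidal.μ_δ_assoc, id_tensorHom]
    rw [whisker_exchange_assoc, leftUnitor_naturality]
  l_nat1 f := (congrArg (· ≫ _) (id_tensorHom _ _)).trans (leftUnitor_naturality _)
  r_nat0 {X X'} f := by
    change (δ J X.toM (𝟙_ M) ≫ (f ⊗ₘ 𝟙 (J.obj (𝟙_ M))) ≫ μ J X'.toM (𝟙_ M)) ≫
      J.map (ρ_ X'.toM).hom = J.map (ρ_ X.toM).hom ≫ f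
    rw [Functor.Monoidal.map_rightUnitor, Functor.Monoidal.map_rightUnitor]
    simp only [Category.assoc, Functor.Monoidal.μ_δ_assoc, tensorHom_id]
    rw [← whisker_exchange_assoc, rightUnitor_naturality]
  r_nat1 f := (congrArg (· ≫ _) (tensorHom_id _ _)).trans (rightUnitor_naturality _)
  b_nat0 {X X' Y Y'} f g := by
    change (δ J X.toM Y.toM ≫ (f ⊗ₘ g) ≫ μ J X'.toM Y'.toM) ≫ J.map (β_ X'.toM Y'.toM).hom =
      J.map (β_ X.toM Y.toM).hom ≫ δ J Y.toM X.toM ≫ (g ⊗ₘ f) ≫ μ J Y'.toM X'.toM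
    exact map_braiding_naturality J f g
  b_nat1 f g := BraidedCategory.braiding_naturality _ _
  pentagon W X Y Z := by
    change ((α_ W.toM X.toM Y.toM).hom ⊗ₘ 𝟙 Z.toM) ≫ (α_ W.toM (X.toM ⊗ Y.toM) Z.toM).hom ≫
      (𝟙 W.toM ⊗ₘ (α_ X.toM Y.toM Z.toM).hom) = (α_ (W.toM ⊗ X.toM) Y.toM Z.toM).hom ≫
        (α_ W.toM X.toM (Y.toM ⊗ Z.toM)).hom
    rw [tensorHom_id, id_tensorHom, MonoidalCategory.pentagon]
  triangle X Y := by
    change (α_ X.toM (𝟙_ M) Y.toM).hom ≫ (𝟙 X.toM ⊗ₘ (λ_ Y.toM).hom) =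
      ((ρ_ X.toM).hom ⊗ₘ 𝟙 Y.toM)
    rw [tensorHom_id, id_tensorHom, MonoidalCategory.triangle]
  hexagon X Y Z := by
    change (α_ X.toM Y.toM Z.toM).hom ≫ (β_ X.toM (Y.toM ⊗ Z.toM)).hom ≫
      (α_ Y.toM Z.toM X.toM).hom = ((β_ X.toM Y.toM).hom ⊗ₘ 𝟙 Z.toM) ≫
        (α_ Y.toM X.toM Z.toM).hom ≫ (𝟙 Y.toM ⊗ₘ (β_ X.toM Z.toM).hom)
    rw [tensorHom_id, id_tensorHom, BraidedCategory.hexagon_forward]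

end Circuits

end EnrichedSM

open EnrichedSM in
theorem mainTheorem5 {M Q : Type u} [SmallCategory M] [SmallCategory Q]
    [MonoidalCategory M] [SymmetricCategory M] [MonoidalCategory Q] [SymmetricCategory Q]
    (J : M ⥤ Q) [J.Braided] (hJ : Function.Bijective J.obj)
    (hQ : ∀ X : Q, Limits.PreservesColimitsOfShape (Discrete Limits.WalkingPair) (tensorLeft X)) :
    (∃ L : EnrichedFunctor Biset.{u} (Presheaf (CircCat J)) (SmoothPresheaf J),
      Nonempty (VAdjunction Biset.{u} L (smoothIncl J))) ∧
    ∃ hsm : ∀ (G : Presheaf (CircCat J)) (H : SmoothPresheaf J),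
        IsSmooth J ((dayHom (circTensor J)).obj G H.1),
      ∀ L : EnrichedFunctor Biset.{u} (Presheaf (CircCat J)) (SmoothPresheaf J),
        Nonempty (VAdjunction Biset.{u} L (smoothIncl J)) →
          Nonempty (SymmetricMonoidalStructure
            ((dayTensor (circTensor J)).reflect (smoothIncl J) L)
            (lambek J (CircCat.ofM J (𝟙_ M)))) ∧
          Nonempty (TensorHomAdjunction
            ((dayTensor (circTensor J)).reflect (smoothIncl J) L)
            ((dayHom (circTensor J)).restrict (fun G H => hsm G.1 H))) := by
  -- By definition `IsSmooth J` is continuity for the class `IsCoproduct J`, so the general results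
  -- on `IsContinuous` apply directly.
  have hhom : ∀ G H : Presheaf (CircCat J), IsSmooth J H →
      IsSmooth J (dayHomObj (circTensor J) G H) := fun G _ hH =>
    IsContinuous.dayHom (K := IsCoproduct J) hH (isCoproduct_tensorRight J hQ) G
  have hshift : ∀ (H : Presheaf (CircCat J)) (A : CircCat J), IsSmooth J H →
      IsSmooth J (shift (circTensor J) H A) := fun _ A hH =>
    IsContinuous.shift (K := IsCoproduct J) hH (isCoproduct_tensorLeft J hQ) A
  refine ⟨⟨UniversalArrow.reflection (completionArrow (IsCoproduct J)),
    ⟨UniversalArrow.adjunction (completionArrow (IsCoproduct J))⟩⟩,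
    fun G H => hhom G H.1 H.2, ?_⟩
  -- From here `L` is an arbitrary left adjoint, known only through `adj`.
  rintro L ⟨adj⟩
  exact ⟨⟨(reflElements (circElements J) adj hhom hshift (isSmooth_yoneda J _)).toStructure⟩,
    ⟨reflTensorHomAdjunction (circTensor J) adj fun G H => hhom G.1 H.1 H.2⟩⟩
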